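/- For $v\in\mathbb{C}\setminus\{0\}$ let $f_v(z)=v(\cos z-1)$. It has the superattracting fixed point $0$ and the two critical values $0$ and $-2v$. Let $B_v$ be the Fatou component of $f_v$ containing $0$. Let $\mathcal{H}$ be the set of $v\ne 0$ such that $-2v$ is attracted by an attracting (possibly superattracting) cycle of $f_v$. A connected component of $\mathcal{H}$ is called a hyperbolic component, and it is of type A if $-2v\in B_v$ for its parameters $v$. A Böttcher map of $f_v$ is a conformal isomorphism $\phi_v:U_v\to D(0,r)$, for some $r>0$, from an open neighbourhood $U_v$ of $0$ with $f_v(U_v)\subset U_v$, satisfying $\phi_v(0)=0$ and $\phi_v\circ f_v=\phi_v^2$. Let $\mathbb{D}^*=\{w\in\mathbb{C}:0<|w|<1\}$. Proposition. There is a hyperbolic component $\mathcal{H}_0$ that contains a punctured disc $\{v:0<|v|<\rho\}$ with $\rho>0$. It is of type A, that is, $-2v\in B_v$ for every $v\in\mathcal{H}_0$, and it is the only one: a hyperbolic component containing at least one parameter $v$ with $-2v\in B_v$ equals $\mathcal{H}_0$. For every $v\in\mathcal{H}_0$ there is a Böttcher map $\phi_v$ of $f_v$ whose domain contains $-2v$,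 and the value $\Phi_0(v):=\phi_v(-2v)$ does not depend on its choice. The map $\Phi_0$ takes $\mathcal{H}_0$ into $\mathbb{D}^*$, and $\Phi_0:\mathcal{H}_0\to\mathbb{D}^*$ is an analytic covering map of degree $2$, i.e. it is holomorphic, it is a covering map, and every $w\in\mathbb{D}^*$ has exactly two preimages in $\mathcal{H}_0$. -/

import Mathlib

open Set Filter Topology

namespace CosFamily

/-- The cosine map `f_v(z) = v (cos z - 1)`. -/
noncomputable def f (v z : ℂ) : ℂ := v * (Complex.cos z - 1)

/-- The iterates of `g` form a normal family on `U` (as maps into the Riemann sphere): every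
sequence of iterates has a subsequence which, locally uniformly on `U`, either converges to a
finite function or tends to infinity. -/
def IteratesNormalOn (g : ℂ → ℂ) (U : Set ℂ) : Prop :=
  ∀ s : ℕ → ℕ, StrictMono s → ∃ t : ℕ → ℕ, StrictMono t ∧
    ((∃ l : ℂ → ℂ, TendstoLocallyUniformlyOn (fun k => g^[s (t k)]) l atTop U) ∨
      (∀ K ⊆ U, IsCompact K → ∀ M : ℝ, ∀ᶠ k in atTop, ∀ z ∈ K, M ≤ ‖g^[s (t k)] z‖))

/-- The Fatou set of an entire function `g`. -/
def fatouSet (g : ℂ → ℂ) : Set ℂ :=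
  {z | ∃ U : Set ℂ, IsOpen U ∧ z ∈ U ∧ IteratesNormalOn g U}

/-- `B_v`, the Fatou component of `f_v` that contains the superattracting fixed point `0`. -/
def B (v : ℂ) : Set ℂ := connectedComponentIn (fatouSet (f v)) 0

/-- The orbit of `w` under `g` is attracted by an attracting cycle of `g`; here `z` is the point
of the cycle to which `g^[p * n] w` converges, and multiplier `0` (a superattracting cycle) is
allowed. -/
def AttractedByAttractingCycle (g : ℂ → ℂ) (w : ℂ) : Prop :=
  ∃ (p : ℕ) (z : ℂ), 0 < p ∧ Function.IsPeriodicPt g p z ∧ ‖deriv g^[p] z‖ < 1 ∧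
    Tendsto (fun n : ℕ => g^[p * n] w) atTop (𝓝 z)

/-- The hyperbolic parameters: `v ≠ 0` such that the free critical value `-2v` of `f_v` is
attracted by an attracting cycle. -/
def hyperbolicLocus : Set ℂ :=
  {v | v ≠ 0 ∧ AttractedByAttractingCycle (f v) (-2 * v)}

/-- A hyperbolic component is a connected component of the hyperbolic locus. -/
def IsHyperbolicComponent (U : Set ℂ) : Prop :=
  ∃ v ∈ hyperbolicLocus, U = connectedComponentIn hyperbolicLocus v

/-- The parameter `v` is of type A: `-2v` lies in the immediate basin of `0`. -/
def IsTypeAParameter (v : ℂ) : Prop := -2 * v ∈ B v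

/-- `φ : U → D(0, r)` is a Böttcher map of `f_v` at `0`: a conformal isomorphism from an open
forward invariant neighbourhood `U` of `0` onto a round disc, with `φ(0) = 0` and
`φ ∘ f_v = φ²`. -/
structure IsBottcherMap (v : ℂ) (U : Set ℂ) (r : ℝ) (φ : ℂ → ℂ) : Prop where
  isOpen : IsOpen U
  zero_mem : (0 : ℂ) ∈ U
  radius_pos : 0 < r
  mapsTo : MapsTo (f v) U U
  differentiableOn : DifferentiableOn ℂ φ U
  bijOn : BijOn φ U (Metric.ball 0 r)
  map_zero : φ 0 = 0
  conj : ∀ z ∈ U, φ (f v z) = φ z ^ 2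

/-- `w` is the value at `-2v` of a Böttcher map of `f_v` whose domain contains `-2v`. -/
def IsBottcherValue (v w : ℂ) : Prop :=
  ∃ (U : Set ℂ) (r : ℝ) (φ : ℂ → ℂ), IsBottcherMap v U r φ ∧ -2 * v ∈ U ∧ φ (-2 * v) = w

open Classical in
/-- `Φ₀(v) = φ_v(-2v)` (and `0` if no Böttcher map is defined at `-2v`). -/
noncomputable def Phi0 (v : ℂ) : ℂ :=
  if h : ∃ w, IsBottcherValue v w then h.choose else 0

/-- The punctured unit disc. -/
def puncturedDisc : Set ℂ := Metric.ball 0 1 \ {0}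

end CosFamily

namespace CosFamily
open Metric

/-! In the coordinate `z = -2ζ` the map becomes `ζ ↦ v sin² ζ`, with free critical value `ζ = v`.
The proof works with inverse Böttcher maps: holomorphic `ζ` on a disc of radius `R ≤ 1` with `ζ(u²)
= v sin²(ζ u)`, `ζ(0) = 0`, `ζ'(0) = 1/v`. The germ is unique (`IsSol.eventuallyEq`), and `ζ` is
injective on every disc of definition (`IsSol.injOn`). If `ζ` misses `v` on the disc of radius `R`,
then `ζ(u²)/v` and its difference from `1` have holomorphic square roots, so an arcsine extends `ζ`
to radius `√R` (`IsSol.extend`). Iterating, either `v = ζ(w)` for a unique `w` (`IsVal`), or `ζ`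
exists on the whole unit disc and its image contains the immediate basin (`IsSol.B_subset_domainU`).
Hence type A means `v ∈ paramA`, and `w = val v` is the value of `Φ₀`.

The function `val` is even and holomorphic. Solutions on a common disc are locally bounded
(`exists_uniform_bound`), so the graph of `val` is closed over `v ≠ 0`, `‖w‖ < 1`
(`isVal_of_tendsto`). Together with `‖v‖ < 8` and `val v → 0` as `v → 0`, this makes `val : paramA →
𝔻*` proper. Since `val v` is asymptotic to `v²` at `0`, small values have exactly the two preimages
`±v`, both noncritical. This property is open, and closed by properness, so it holds on all of the
connected set `𝔻*`; a proper local homeomorphism with two-point fibres is the required covering.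

Every connected component of `paramA` maps onto `𝔻*`, hence contains parameters near `0`, so
`paramA` is connected. It is open, and it is closed in the hyperbolic locus: at a hyperbolic limit
parameter the critical orbit either enters the Böttcher disc, which keeps `‖val‖` away from `1`, or
is trapped near a nonzero attracting point, which is stable under perturbation and incompatible with
convergence to `0`. So `paramA` is a hyperbolic component, and the only one of type A. -/

/-! ### Tools from one-variable complex analysis -/

/-- A nonvanishing holomorphic function on a disc has a holomorphic logarithm with any prescribed
admissible value at the centre. -/
theorem exists_log_on_ball {R : ℝ} (hR : 0 < R) {f : ℂ → ℂ} (hf : DifferentiableOn ℂ f (ball 0 R))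
    (h0 : ∀ z ∈ ball (0 : ℂ) R, f z ≠ 0) {a : ℂ} (ha : Complex.exp a = f 0) :
    ∃ g : ℂ → ℂ, DifferentiableOn ℂ g (ball 0 R) ∧ g 0 = a ∧
      ∀ z ∈ ball (0 : ℂ) R, Complex.exp (g z) = f z := by
  have hd : DifferentiableOn ℂ (fun z => deriv f z / f z) (ball 0 R) :=
    (hf.deriv isOpen_ball).div hf h0
  obtain ⟨g, hg0, hg⟩ := hd.isExactOn_ball.with_val_at 0 a
  have hgd : DifferentiableOn ℂ g (ball 0 R) := fun z hz =>
    (hg z hz).differentiableAt.differentiableWithinAt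
  refine ⟨g, hgd, hg0, fun z hz => ?_⟩
  have hc : ∀ x ∈ ball (0 : ℂ) R, HasDerivAt (fun z => f z * Complex.exp (-g z)) 0 x := by
    intro x hx
    have h1 := (hf.differentiableAt (isOpen_ball.mem_nhds hx)).hasDerivAt
    have h2 := h1.mul ((hg x hx).neg.cexp)
    refine h2.congr_deriv ?_
    have hfx := h0 x hx
    field_simp
    ring
  have key : f z * Complex.exp (-g z) = f 0 * Complex.exp (-g 0) := by
    refine (convex_ball (0 : ℂ) R).is_const_of_fderivWithin_eq_zero (𝕜 := ℂ)
      (f := fun z => f z * Complex.exp (-g z))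
      (fun x hx => (hc x hx).differentiableAt.differentiableWithinAt) ?_ hz (mem_ball_self hR)
    intro x hx
    rw [fderivWithin_of_isOpen isOpen_ball hx]
    have := (hc x hx).hasFDerivAt.fderiv
    rw [this]; ext; simp
  rw [hg0, ← ha, ← Complex.exp_add, add_neg_cancel, Complex.exp_zero] at key
  calc Complex.exp (g z) = (f z * Complex.exp (-g z)) * Complex.exp (g z) := by rw [key, one_mul]
    _ = f z := by rw [mul_assoc, ← Complex.exp_add]; simp

/-- Coefficients of a power series in `t` depending holomorphically on a parameter are
holomorphic. -/
theorem differentiableOn_coeff {N : Set ℂ} (hN : IsOpen N) {F : ℂ → ℂ → ℂ} {a : ℂ → ℕ → ℂ}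
    {ρ C : ℝ} (hρ : 0 < ρ) (ha : ∀ v ∈ N, ∀ n, ‖a v n‖ * ρ ^ n ≤ C)
    (hs : ∀ v ∈ N, ∀ t ∈ ball (0 : ℂ) ρ, HasSum (fun n => a v n * t ^ n) (F v t))
    (hF : ∀ t ∈ ball (0 : ℂ) ρ, DifferentiableOn ℂ (fun v => F v t) N) (n : ℕ) :
    DifferentiableOn ℂ (fun v => a v n) N := by
  rcases N.eq_empty_or_nonempty with rfl | ⟨v₀, hv₀⟩
  · exact differentiableOn_empty
  have hC : 0 ≤ C := le_trans (by positivity) (ha v₀ hv₀ 0)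
  induction n using Nat.strong_induction_on with
  | _ n ih =>
  -- Sample points tending to `0`. The `n`-th coefficient is the uniform limit of the quotients `G
  -- j`, which involve only lower coefficients, holomorphic by induction.
  set t : ℕ → ℂ := fun j => ((ρ / 2 / (j + 1) : ℝ) : ℂ) with ht
  have htn : ∀ j, ‖t j‖ = ρ / 2 / (j + 1) := fun j => by
    simp only [ht, Complex.norm_real, Real.norm_eq_abs]; exact abs_of_pos (by positivity)
  have ht2 : ∀ j, ‖t j‖ ≤ ρ / 2 := fun j => by
    rw [htn]; exact div_le_self (by positivity) (by linarith [(Nat.cast_nonneg j : (0 : ℝ) ≤ j)])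
  have htb : ∀ j, t j ∈ ball (0 : ℂ) ρ := fun j => by
    rw [mem_ball_zero_iff]; linarith [ht2 j]
  have ht0 : ∀ j, t j ≠ 0 := fun j => by
    rw [← norm_pos_iff, htn]; positivity
  set G : ℕ → ℂ → ℂ := fun j v =>
    (F v (t j) - ∑ i ∈ Finset.range n, a v i * t j ^ i) / t j ^ n with hG
  have hGd : ∀ j, DifferentiableOn ℂ (G j) N := fun j => by
    refine ((hF _ (htb j)).sub ?_).div_const _
    exact DifferentiableOn.fun_sum fun i hi => (ih i (Finset.mem_range.1 hi)).mul_const _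
  have hb : ∀ j, ∀ v ∈ N, ‖G j v - a v n‖ ≤ ‖t j‖ * (2 * C / ρ ^ (n + 1)) := by
    intro j v hv
    have h1 := (hasSum_nat_add_iff' (n + 1)).2 (hs v hv _ (htb j))
    rw [Finset.sum_range_succ] at h1
    have h2 : HasSum (fun i => a v (i + (n + 1)) * t j ^ (i + 1)) (G j v - a v n) := by
      have h3 := h1.div_const (t j ^ n)
      have hp := pow_ne_zero n (ht0 j)
      have e1 : G j v - a v n = (F v (t j) - (∑ x ∈ Finset.range n, a v x * t j ^ x +
          a v n * t j ^ n)) / t j ^ n := by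
        rw [eq_div_iff hp, sub_mul, div_mul_cancel₀ _ hp]; ring
      rw [e1]
      refine h3.congr_fun fun i => ?_
      rw [eq_div_iff hp]; ring
    have hgeo : HasSum (fun i : ℕ => ‖t j‖ * (C / ρ ^ (n + 1)) * (1 / 2 : ℝ) ^ i)
        (‖t j‖ * (C / ρ ^ (n + 1)) * 2) := hasSum_geometric_two.mul_left _
    have := h2.norm_le_of_bounded hgeo (fun i => ?_)
    · calc _ ≤ _ := this
        _ = _ := by ring
    rw [norm_mul, norm_pow]
    have h3 : ‖a v (i + (n + 1))‖ ≤ C / ρ ^ (i + (n + 1)) := by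
      rw [le_div_iff₀ (by positivity)]; exact ha v hv _
    calc ‖a v (i + (n + 1))‖ * ‖t j‖ ^ (i + 1)
        ≤ C / ρ ^ (i + (n + 1)) * (‖t j‖ * (ρ / 2) ^ i) := by
          rw [pow_succ' ‖t j‖]; gcongr; exact ht2 j
      _ = _ := by rw [div_pow, pow_add, div_pow, one_pow]; field_simp
  have hlim : TendstoUniformlyOn G (fun v => a v n) atTop N := by
    rw [Metric.tendstoUniformlyOn_iff]
    intro ε hε
    have htend : Tendsto (fun j => ‖t j‖ * (2 * C / ρ ^ (n + 1))) atTop (𝓝 0) := by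
      have : Tendsto (fun j : ℕ => ρ / 2 / ((j : ℝ) + 1)) atTop (𝓝 0) :=
        tendsto_const_nhds.div_atTop (tendsto_atTop_add_const_right _ _ tendsto_natCast_atTop_atTop)
      simp only [htn]
      simpa using this.mul_const (2 * C / ρ ^ (n + 1))
    filter_upwards [htend.eventually (gt_mem_nhds hε)] with j hj v hv
    rw [dist_comm, dist_eq_norm]
    exact (hb j v hv).trans_lt hj
  exact hlim.tendstoLocallyUniformlyOn.differentiableOn (Eventually.of_forall hGd) hN

/-- Zeros persist under uniform convergence of injective holomorphic functions. -/
theorem eventually_exists_zero {ι : Type*} {l : Filter ι} {F : ι → ℂ → ℂ} {g : ℂ → ℂ} {c : ℂ}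
    {r : ℝ} (hr : 0 < r) (hF : TendstoUniformlyOn F g l (closedBall c r))
    (hd : ∀ᶠ i in l, DiffContOnCl ℂ (F i) (ball c r)) (hinj : ∀ᶠ i in l, InjOn (F i) (ball c r))
    (hgc : ContinuousOn g (sphere c r)) (hg0 : g c = 0) (hg : ∀ z ∈ sphere c r, g z ≠ 0) :
    ∀ᶠ i in l, ∃ u ∈ closedBall c r, F i u = 0 := by
  obtain ⟨z₁, hz₁, hmin⟩ := (isCompact_sphere c r).exists_isMinOn
    (NormedSpace.sphere_nonempty.2 hr.le) hgc.norm
  set ε := ‖g z₁‖ with hε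
  have hεpos : 0 < ε := norm_pos_iff.2 (hg z₁ hz₁)
  rw [Metric.tendstoUniformlyOn_iff] at hF
  filter_upwards [hF (ε / 8) (by positivity), hd, hinj] with i hi hdi hinji
  have hc : ‖F i c‖ < ε / 8 := by
    have := hi c (mem_closedBall_self hr.le)
    rwa [hg0, dist_zero_left] at this
  have hs : ∀ z ∈ sphere c r, ε / 2 ≤ ‖F i z - F i c‖ := by
    intro z hz
    have h1 := hi z (sphere_subset_closedBall hz)
    rw [dist_eq_norm] at h1
    have h2 : ε ≤ ‖g z‖ := hmin hz
    have h3 : ‖g z‖ ≤ ‖g z - F i z‖ + ‖F i z - F i c‖ + ‖F i c‖ := by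
      calc ‖g z‖ = ‖(g z - F i z) + (F i z - F i c) + F i c‖ := by ring_nf
        _ ≤ _ := norm_add₃_le
    linarith
  have hfreq : ∃ᶠ z in 𝓝 c, F i z ≠ F i c := by
    have h1 : ∀ᶠ z in 𝓝[≠] c, F i z ≠ F i c := by
      filter_upwards [self_mem_nhdsWithin, mem_nhdsWithin_of_mem_nhds (ball_mem_nhds c hr)]
        with z hz hzb h
      exact hz (hinji hzb (mem_ball_self hr) h)
    exact h1.frequently.filter_mono nhdsWithin_le_nhds
  -- The quantitative open mapping theorem replaces Rouché: the image covers the disc of radius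
  -- `ε/4` about `F i c`, and `‖F i c‖ < ε/8`.
  obtain ⟨u, hu, hu0⟩ := hdi.ball_subset_image_closedBall hr hs hfreq
    (show (0 : ℂ) ∈ ball (F i c) (ε / 2 / 2) by
      rw [mem_ball, dist_zero_left]; linarith)
  exact ⟨u, hu, hu0⟩

/-- Local normal form of a nonconstant analytic function. -/
theorem exists_local_pow {g : ℂ → ℂ} {z₀ : ℂ} (hg : AnalyticAt ℂ g z₀)
    (hne : ¬ ∀ᶠ z in 𝓝 z₀, g z = g z₀) :
    ∃ (k : ℕ) (h : ℂ → ℂ), 1 ≤ k ∧ AnalyticAt ℂ h z₀ ∧ h z₀ = 0 ∧ deriv h z₀ ≠ 0 ∧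
      ∀ᶠ z in 𝓝 z₀, g z = g z₀ + h z ^ k := by
  have h1 : AnalyticAt ℂ (fun z => g z - g z₀) z₀ := hg.sub analyticAt_const
  obtain ⟨k, q, hq, hq0, hqe⟩ := h1.exists_eventuallyEq_pow_smul_nonzero_iff.2
    (by simpa [sub_eq_zero] using hne)
  have hk : k ≠ 0 := by
    rintro rfl
    have := hqe.self_of_nhds
    simp at this
    exact hq0 this.symm
  set b : ℂ := (q z₀) ^ ((k : ℂ)⁻¹) with hb
  have hbk : b ^ k = q z₀ := Complex.cpow_nat_inv_pow _ hk
  have hb0 : b ≠ 0 := by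
    intro h; rw [h, zero_pow hk] at hbk; exact hq0 hbk.symm
  -- An analytic `k`-th root of `q`: dividing by `q z₀` keeps the argument near `1`, where the
  -- principal logarithm is analytic, and `b` restores the constant.
  set e : ℂ → ℂ := fun z => b * Complex.exp (Complex.log (q z / q z₀) / k) with he
  have hquot : AnalyticAt ℂ (fun z => q z / q z₀) z₀ := hq.div analyticAt_const hq0
  have hea : AnalyticAt ℂ e z₀ := by
    refine analyticAt_const.mul (AnalyticAt.cexp ((hquot.clog ?_).div analyticAt_const ?_))
    · simp [hq0]
    · exact_mod_cast hk
  have he0 : e z₀ = b := by simp [he, hq0]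
  refine ⟨k, fun z => (z - z₀) * e z, Nat.one_le_iff_ne_zero.2 hk,
    (analyticAt_id.sub analyticAt_const).mul hea, by simp, ?_, ?_⟩
  · have : HasDerivAt (fun z => (z - z₀) * e z) (1 * e z₀ + (z₀ - z₀) * deriv e z₀) z₀ :=
      ((hasDerivAt_id z₀).sub_const z₀).mul hea.differentiableAt.hasDerivAt
    rw [this.deriv, he0]; simpa using hb0
  · have hqne : ∀ᶠ z in 𝓝 z₀, q z ≠ 0 := hq.continuousAt.eventually_ne hq0
    filter_upwards [hqe, hqne] with z hz hzq
    have : e z ^ k = q z := by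
      simp only [he]
      rw [mul_pow, hbk, ← Complex.exp_nat_mul, mul_div_cancel₀ _ (by exact_mod_cast hk),
        Complex.exp_log (div_ne_zero hzq hq0)]
      field_simp
    rw [mul_pow, this]
    rw [smul_eq_mul] at hz
    rw [← hz]; ring

/-- An analytic function with nonzero derivative maps neighbourhoods onto neighbourhoods and is
locally injective. -/
theorem local_inverse {h : ℂ → ℂ} {z₀ : ℂ} (hh : AnalyticAt ℂ h z₀) (hd : deriv h z₀ ≠ 0) :
    (∀ N ∈ 𝓝 z₀, h '' N ∈ 𝓝 (h z₀)) ∧ ∃ N ∈ 𝓝 z₀, InjOn h N := by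
  have hs : HasStrictDerivAt h (deriv h z₀) z₀ := hh.hasStrictDerivAt
  refine ⟨fun N hN => ?_, ?_⟩
  · have := hs.map_nhds_eq hd
    rw [← this]; exact image_mem_map hN
  · have e := (hs.hasStrictFDerivAt_equiv hd).toOpenPartialHomeomorph h
    refine ⟨_, ((hs.hasStrictFDerivAt_equiv hd).toOpenPartialHomeomorph h).open_source.mem_nhds
      (hs.hasStrictFDerivAt_equiv hd).mem_toOpenPartialHomeomorph_source, ?_⟩
    exact ((hs.hasStrictFDerivAt_equiv hd).toOpenPartialHomeomorph h).injOn

/-- Near a critical point a nonconstant analytic function takes nearby values at least twice. -/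
theorem exists_two_preimages {g : ℂ → ℂ} {z₀ : ℂ} (hg : AnalyticAt ℂ g z₀)
    (hne : ¬ ∀ᶠ z in 𝓝 z₀, g z = g z₀) (hd : deriv g z₀ = 0) {N : Set ℂ} (hN : N ∈ 𝓝 z₀) :
    ∀ᶠ w in 𝓝[≠] (g z₀), ∃ x ∈ N, ∃ y ∈ N, x ≠ y ∧ g x = w ∧ g y = w := by
  obtain ⟨k, h, hk1, hh, hh0, hhd, hgh⟩ := exists_local_pow hg hne
  have hk2 : 2 ≤ k := by
    by_contra hlt
    have : k = 1 := by omega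
    subst this
    have h1 : deriv g z₀ = deriv h z₀ := by
      have : g =ᶠ[𝓝 z₀] fun z => g z₀ + h z := by
        filter_upwards [hgh] with z hz; rw [hz, pow_one]
      rw [this.deriv_eq, deriv_const_add]
    exact hhd (h1 ▸ hd)
  have hopen := (local_inverse hh hhd).1 (N ∩ {z | g z = g z₀ + h z ^ k}) (inter_mem hN hgh)
  rw [hh0] at hopen
  obtain ⟨δ, hδ, hball⟩ := Metric.mem_nhds_iff.1 hopen
  have hδk : 0 < δ ^ k := by positivity
  rw [eventually_nhdsWithin_iff]
  filter_upwards [ball_mem_nhds (g z₀) hδk] with w hw hwne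
  set ω : ℂ := (w - g z₀) ^ ((k : ℂ)⁻¹)
  have hωk : ω ^ k = w - g z₀ := Complex.cpow_nat_inv_pow _ (by omega)
  have hω0 : ω ≠ 0 := by
    intro h0; rw [h0, zero_pow (by omega)] at hωk
    exact hwne (sub_eq_zero.1 hωk.symm)
  have hωδ : ‖ω‖ < δ := by
    rw [mem_ball, dist_eq_norm, ← hωk, norm_pow] at hw
    exact lt_of_pow_lt_pow_left₀ k hδ.le hw
  obtain ⟨ξ, hξ⟩ : ∃ ξ : ℂ, IsPrimitiveRoot ξ k := ⟨_, Complex.isPrimitiveRoot_exp k (by omega)⟩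
  have hξn : ‖ξ‖ = 1 := hξ.norm'_eq_one (by omega)
  obtain ⟨x, ⟨hxN, hxg⟩, hx⟩ := hball (mem_ball_zero_iff.2 hωδ)
  obtain ⟨y, ⟨hyN, hyg⟩, hy⟩ := hball (show ξ * ω ∈ ball (0 : ℂ) δ by
    rw [mem_ball_zero_iff, norm_mul, hξn, one_mul]; exact hωδ)
  refine ⟨x, hxN, y, hyN, ?_, ?_, ?_⟩
  · rintro rfl
    rw [hx] at hy
    have : ξ = 1 := by
      have h2 : ω * (ξ - 1) = 0 := by rw [mul_sub, mul_comm ω ξ, ← hy]; ring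
      rcases mul_eq_zero.1 h2 with h3 | h3
      · exact absurd h3 hω0
      · exact sub_eq_zero.1 h3
    rw [this] at hξ
    have := hξ.eq_orderOf
    simp at this
    omega
  · rw [hxg, hx, hωk]; ring
  · rw [hyg, hy, mul_pow, hξ.pow_eq_one, one_mul, hωk]; ring


/-! ### Local inverse Böttcher maps on a uniform disc -/

theorem norm_exp_sub_exp_le {a b : ℂ} (ha : ‖a‖ ≤ 1) (hb : ‖b‖ ≤ 1) :
    ‖Complex.exp a - Complex.exp b‖ ≤ 3 * ‖a - b‖ := by
  refine (convex_closedBall (0 : ℂ) 1).norm_image_sub_le_of_norm_deriv_le (f := Complex.exp)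
    (fun x _ => Complex.differentiableAt_exp) (fun x hx => ?_)
    (mem_closedBall_zero_iff.2 hb) (mem_closedBall_zero_iff.2 ha)
  rw [Complex.deriv_exp, Complex.norm_exp]
  have h1 : x.re ≤ 1 := (Complex.re_le_norm x).trans (mem_closedBall_zero_iff.1 hx)
  calc Real.exp x.re ≤ Real.exp 1 := Real.exp_le_exp.2 h1
    _ ≤ 3 := by linarith [Real.exp_one_lt_d9]

/-- A holomorphic logarithm of `sin x / x` near the origin. -/
theorem exists_log_sinc : ∃ (lam : ℂ → ℂ) (δ K : ℝ), 0 < δ ∧ 0 ≤ K ∧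
    DifferentiableOn ℂ lam (ball 0 δ) ∧ lam 0 = 0 ∧
    (∀ x ∈ ball (0 : ℂ) δ, ∀ y ∈ ball (0 : ℂ) δ, ‖lam x - lam y‖ ≤ K * ‖x - y‖) ∧
    ∀ x ∈ ball (0 : ℂ) δ, Complex.sin x = x * Complex.exp (lam x) := by
  set q : ℂ → ℂ := dslope Complex.sin 0 with hq
  have hqd : Differentiable ℂ q := by
    rw [← differentiableOn_univ]
    exact (Complex.differentiableOn_dslope univ_mem).2 Complex.differentiable_sin.differentiableOn
  have hq0 : q 0 = 1 := by simp [hq, dslope_same]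
  have hsl : ∀ᶠ x in 𝓝 (0 : ℂ), q x ∈ Complex.slitPlane :=
    hqd.continuous.continuousAt.eventually_mem
      (Complex.isOpen_slitPlane.mem_nhds (by rw [hq0]; simp))
  have han : AnalyticAt ℂ (fun x => Complex.log (q x)) 0 :=
    (hqd.analyticAt 0).clog (by rw [hq0]; simp)
  obtain ⟨K, s, hs, hK⟩ := (han.contDiffAt (n := 1)).exists_lipschitzOnWith
  obtain ⟨δ, hδ, hball⟩ := Metric.mem_nhds_iff.1 (inter_mem hs hsl)
  refine ⟨fun x => Complex.log (q x), δ, K, hδ, K.2, ?_, by simp [hq0], ?_, ?_⟩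
  · exact fun x hx => ((hqd x).clog (hball hx).2).differentiableWithinAt
  · intro x hx y hy
    simpa [dist_eq_norm] using hK.dist_le_mul x (hball hx).1 y (hball hy).1
  · intro x hx
    rw [Complex.exp_log (Complex.slitPlane_ne_zero (hball hx).2)]
    have := sub_smul_dslope Complex.sin 0 x
    simpa using this.symm

/-- Rescaled inverse Böttcher maps of `ζ ↦ v sin² ζ`, defined on a disc that is uniform for
`|v| < V`, including `v = 0`. -/
theorem exists_local_family {V : ℝ} (hV : 0 < V) : ∃ ρ K : ℝ, 0 < ρ ∧ V * ρ ≤ 1 ∧ 0 < K ∧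
    ∃ η : ℂ → ℂ → ℂ, (∀ t ∈ ball (0 : ℂ) ρ, DifferentiableOn ℂ (fun v => η v t) (ball 0 V)) ∧
      ∀ v ∈ ball (0 : ℂ) V, DifferentiableOn ℂ (η v) (ball 0 ρ) ∧
        (∀ t ∈ ball (0 : ℂ) ρ, ‖η v t - t‖ ≤ K * ‖t‖ ^ 2) ∧
        ∀ t ∈ ball (0 : ℂ) ρ, η v (v * t ^ 2) = v * Complex.sin (η v t) ^ 2 := by
  obtain ⟨lam, δ, K, hδ, hK, hld, hl0, hlip, hlsin⟩ := exists_log_sinc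
  -- The first bound makes `S` preserve the polydisc, the second keeps `t * exp z` with `‖z‖ ≤ 1` in
  -- the domain of `lam`, and the third makes `z ↦ lam (t * exp z)` Lipschitz with constant `1/4`.
  set ρ : ℝ := min (1 / V) (min (δ / 4) (1 / (12 * (K + 1)))) with hρdef
  have hρ : 0 < ρ := by positivity
  have hρV : V * ρ ≤ 1 := by
    calc V * ρ ≤ V * (1 / V) := by gcongr; exact min_le_left _ _
      _ = 1 := by field_simp
  have hρδ : 3 * ρ < δ := by
    have : ρ ≤ δ / 4 := (min_le_right _ _).trans (min_le_left _ _)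
    linarith
  have hρK : 12 * (K * ρ) ≤ 1 := by
    have h1 : ρ ≤ 1 / (12 * (K + 1)) := (min_le_right _ _).trans (min_le_right _ _)
    rw [le_div_iff₀ (by positivity)] at h1
    nlinarith
  set P : Set (ℂ × ℂ) := ball 0 V ×ˢ ball 0 ρ with hP
  set S : ℂ × ℂ → ℂ × ℂ := fun p => (p.1, p.1 * p.2 ^ 2) with hS
  have hSP : MapsTo S P P := by
    rintro ⟨v, t⟩ ⟨hv, ht⟩
    refine ⟨hv, ?_⟩
    simp only [mem_ball_zero_iff] at hv ht ⊢
    simp only [hS, norm_mul, norm_pow]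
    calc ‖v‖ * ‖t‖ ^ 2 = (‖v‖ * ‖t‖) * ‖t‖ := by ring
      _ ≤ (V * ρ) * ‖t‖ := by gcongr
      _ ≤ 1 * ‖t‖ := by gcongr
      _ < ρ := by linarith
  -- With `η = t exp h` and `sin x = x exp (lam x)`, the functional equation reads `h(v, vt²) = 2
  -- h(v, t) + 2 lam(t exp h(v, t))`. Solved for `h(v, t)` it is a fixed point equation with
  -- contraction factor `1/2 + 1/4 = 3/4`; it makes sense at `v = 0` too.
  let H : ℕ → ℂ × ℂ → ℂ := fun n => Nat.rec (fun _ => 0)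
    (fun _ g p => 1 / 2 * g (S p) - lam (p.2 * Complex.exp (g p))) n
  have hH0 : ∀ p, H 0 p = 0 := fun _ => rfl
  have hHs : ∀ n p, H (n + 1) p = 1 / 2 * H n (S p) - lam (p.2 * Complex.exp (H n p)) :=
    fun _ _ => rfl
  have hexp : ∀ z : ℂ, ‖z‖ ≤ 1 → ‖Complex.exp z‖ ≤ 3 := by
    intro z hz
    rw [Complex.norm_exp]
    have h1 : z.re ≤ 1 := (Complex.re_le_norm z).trans hz
    calc Real.exp z.re ≤ Real.exp 1 := Real.exp_le_exp.2 h1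
      _ ≤ 3 := by linarith [Real.exp_one_lt_d9]
  have harg : ∀ t : ℂ, ‖t‖ < ρ → ∀ z : ℂ, ‖z‖ ≤ 1 → ‖t * Complex.exp z‖ ≤ 3 * ρ := by
    intro t ht z hz
    rw [norm_mul, mul_comm 3]
    exact mul_le_mul ht.le (hexp z hz) (norm_nonneg _) hρ.le
  have hargb : ∀ t : ℂ, ‖t‖ < ρ → ∀ z : ℂ, ‖z‖ ≤ 1 → t * Complex.exp z ∈ ball (0 : ℂ) δ :=
    fun t ht z hz => mem_ball_zero_iff.2 ((harg t ht z hz).trans_lt hρδ)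
  have hlam : ∀ t : ℂ, ‖t‖ < ρ → ∀ z : ℂ, ‖z‖ ≤ 1 → ‖lam (t * Complex.exp z)‖ ≤ 1 / 2 := by
    intro t ht z hz
    have h1 := hlip _ (hargb t ht z hz) 0 (mem_ball_self hδ)
    rw [hl0, sub_zero, sub_zero] at h1
    have h2 := mul_le_mul_of_nonneg_left (harg t ht z hz) hK
    linarith
  have hlamlip : ∀ t : ℂ, ‖t‖ < ρ → ∀ y z : ℂ, ‖y‖ ≤ 1 → ‖z‖ ≤ 1 →
      ‖lam (t * Complex.exp y) - lam (t * Complex.exp z)‖ ≤ 1 / 4 * ‖y - z‖ := by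
    intro t ht y z hy hz
    calc _ ≤ K * ‖t * Complex.exp y - t * Complex.exp z‖ :=
          hlip _ (hargb t ht y hy) _ (hargb t ht z hz)
      _ = K * (‖t‖ * ‖Complex.exp y - Complex.exp z‖) := by rw [← mul_sub, norm_mul]
      _ ≤ K * (ρ * (3 * ‖y - z‖)) := by gcongr; exact norm_exp_sub_exp_le hy hz
      _ = 3 * (K * ρ) * ‖y - z‖ := by ring
      _ ≤ 1 / 4 * ‖y - z‖ := by gcongr; linarith
  have hbd : ∀ n, ∀ p ∈ P, ‖H n p‖ ≤ 1 := by
    intro n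
    induction n with
    | zero => intro p _; rw [hH0]; simp
    | succ n ih =>
      intro p hp
      rw [hHs]
      have h1 := ih _ (hSP hp)
      have h2 := hlam p.2 (mem_ball_zero_iff.1 hp.2) _ (ih p hp)
      calc _ ≤ ‖1 / 2 * H n (S p)‖ + ‖lam (p.2 * Complex.exp (H n p))‖ := norm_sub_le _ _
        _ ≤ 1 := by
          rw [norm_mul]
          norm_num
          norm_num at h2
          linarith
  have hPo : IsOpen P := isOpen_ball.prod isOpen_ball
  have hSd : DifferentiableOn ℂ S P := by
    refine Differentiable.differentiableOn ?_
    simp only [hS]; fun_prop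
  have hdiff : ∀ n, DifferentiableOn ℂ (H n) P := by
    intro n
    induction n with
    | zero => exact differentiableOn_const _
    | succ n ih =>
      have h1 : DifferentiableOn ℂ (fun p : ℂ × ℂ => p.2 * Complex.exp (H n p)) P :=
        differentiable_snd.differentiableOn.mul ih.cexp
      exact ((ih.comp hSd hSP).const_mul (1 / 2)).sub
        (hld.comp h1 fun p hp => hargb p.2 (mem_ball_zero_iff.1 hp.2) _ (hbd n p hp))
  have hstep : ∀ n, ∀ p ∈ P, ‖H n p - H (n + 1) p‖ ≤ 1 * (3 / 4 : ℝ) ^ n := by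
    intro n
    induction n with
    | zero => intro p hp; rw [hH0, zero_sub, norm_neg]; simpa using hbd 1 p hp
    | succ n ih =>
      intro p hp
      rw [hHs n, hHs (n + 1)]
      have h1 := ih _ (hSP hp)
      have h2 := hlamlip p.2 (mem_ball_zero_iff.1 hp.2) _ _ (hbd n p hp) (hbd (n + 1) p hp)
      have h3 := ih p hp
      calc _ = ‖1 / 2 * (H n (S p) - H (n + 1) (S p)) -
            (lam (p.2 * Complex.exp (H n p)) - lam (p.2 * Complex.exp (H (n + 1) p)))‖ := by
            congr 1; ring
        _ ≤ ‖1 / 2 * (H n (S p) - H (n + 1) (S p))‖ + _ := norm_sub_le _ _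
        _ ≤ 1 / 2 * (1 * (3 / 4 : ℝ) ^ n) + 1 / 4 * (1 * (3 / 4 : ℝ) ^ n) := by
            rw [norm_mul]
            have : ‖(1 / 2 : ℂ)‖ = 1 / 2 := by norm_num
            rw [this]
            gcongr
            linarith
        _ = _ := by ring
  have hconv : ∀ p, ∃ y, p ∈ P → Tendsto (fun n => H n p) atTop (𝓝 y) := by
    intro p
    by_cases hp : p ∈ P
    · have hc : CauchySeq (fun n => H n p) :=
        cauchySeq_of_le_geometric (3 / 4) 1 (by norm_num) fun n => by
          rw [dist_eq_norm]; exact hstep n p hp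
      obtain ⟨y, hy⟩ := cauchySeq_tendsto_of_complete hc
      exact ⟨y, fun _ => hy⟩
    · exact ⟨0, fun h => absurd h hp⟩
  choose h hh using hconv
  have hunif : TendstoUniformlyOn H h atTop P := by
    rw [Metric.tendstoUniformlyOn_iff]
    intro ε hε
    have : Tendsto (fun n : ℕ => 1 * (3 / 4 : ℝ) ^ n / (1 - 3 / 4)) atTop (𝓝 0) := by
      have := (tendsto_pow_atTop_nhds_zero_of_lt_one (r := (3 / 4 : ℝ)) (by norm_num)
        (by norm_num)).const_mul (1 : ℝ)
      simpa using this.div_const (1 - 3 / 4 : ℝ)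
    filter_upwards [this.eventually (gt_mem_nhds hε)] with n hn p hp
    rw [dist_comm]
    exact (dist_le_of_le_geometric_of_tendsto (3 / 4) 1 (by norm_num)
      (fun n => by rw [dist_eq_norm]; exact hstep n p hp) (hh p hp) n).trans_lt hn
  have hhb : ∀ p ∈ P, ‖h p‖ ≤ 1 := fun p hp =>
    le_of_tendsto (hh p hp).norm (Eventually.of_forall fun n => hbd n p hp)
  have heq : ∀ p ∈ P, h p = 1 / 2 * h (S p) - lam (p.2 * Complex.exp (h p)) := by
    intro p hp
    refine tendsto_nhds_unique ((tendsto_add_atTop_iff_nat 1).2 (hh p hp)) ?_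
    refine ((hh _ (hSP hp)).const_mul (1 / 2)).sub ?_
    have hb := hargb p.2 (mem_ball_zero_iff.1 hp.2) _ (hhb p hp)
    have hc : ContinuousAt lam (p.2 * Complex.exp (h p)) :=
      (hld.differentiableAt (isOpen_ball.mem_nhds hb)).continuousAt
    exact hc.tendsto.comp (((Complex.continuous_exp.tendsto _).comp (hh p hp)).const_mul p.2)
  have hslice₁ : ∀ t ∈ ball (0 : ℂ) ρ, DifferentiableOn ℂ (fun v => h (v, t)) (ball 0 V) := by
    intro t ht
    have hm : MapsTo (fun v : ℂ => (v, t)) (ball 0 V) P := fun v hv => ⟨hv, ht⟩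
    have h1 : TendstoUniformlyOn (fun n v => H n (v, t)) (fun v => h (v, t)) atTop (ball 0 V) := by
      rw [Metric.tendstoUniformlyOn_iff] at hunif ⊢
      intro ε hε
      filter_upwards [hunif ε hε] with n hn v hv using hn _ (hm hv)
    refine h1.tendstoLocallyUniformlyOn.differentiableOn (Eventually.of_forall fun n => ?_)
      isOpen_ball
    exact (hdiff n).comp (by fun_prop) hm
  have hslice₂ : ∀ v ∈ ball (0 : ℂ) V, DifferentiableOn ℂ (fun t => h (v, t)) (ball 0 ρ) := by
    intro v hv
    have hm : MapsTo (fun t : ℂ => (v, t)) (ball 0 ρ) P := fun t ht => ⟨hv, ht⟩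
    have h1 : TendstoUniformlyOn (fun n t => H n (v, t)) (fun t => h (v, t)) atTop (ball 0 ρ) := by
      rw [Metric.tendstoUniformlyOn_iff] at hunif ⊢
      intro ε hε
      filter_upwards [hunif ε hε] with n hn t ht using hn _ (hm ht)
    refine h1.tendstoLocallyUniformlyOn.differentiableOn (Eventually.of_forall fun n => ?_)
      isOpen_ball
    exact (hdiff n).comp (by fun_prop) hm
  have hh0 : ∀ v ∈ ball (0 : ℂ) V, h (v, 0) = 0 := by
    intro v hv
    have h1 := heq (v, 0) ⟨hv, mem_ball_self hρ⟩
    simp only [hS, zero_mul, hl0, sub_zero] at h1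
    norm_num at h1
    linear_combination 2 * h1
  refine ⟨ρ, 3 * (1 / ρ), hρ, hρV, by positivity, fun v t => t * Complex.exp (h (v, t)), ?_, ?_⟩
  · exact fun t ht => (hslice₁ t ht).cexp.const_mul t
  intro v hv
  refine ⟨differentiable_id.differentiableOn.mul (hslice₂ v hv).cexp, ?_, ?_⟩
  · intro t ht
    -- Schwarz lemma: `h (v, ·)` is bounded by `1` and vanishes at `0`.
    have hs : ‖h (v, t)‖ ≤ 1 / ρ * ‖t‖ := by
      have := Complex.dist_le_div_mul_dist_of_mapsTo_ball (R₂ := 1) (hslice₂ v hv)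
        (fun x hx => by
          rw [hh0 v hv]
          simpa using hhb (v, x) ⟨hv, hx⟩) ht
      simpa [hh0 v hv] using this
    have h1 := norm_exp_sub_exp_le (hhb (v, t) ⟨hv, ht⟩) (b := 0) (by simp)
    rw [Complex.exp_zero, sub_zero] at h1
    calc ‖t * Complex.exp (h (v, t)) - t‖ = ‖t‖ * ‖Complex.exp (h (v, t)) - 1‖ := by
          rw [← norm_mul]; congr 1; ring
      _ ≤ ‖t‖ * (3 * (1 / ρ * ‖t‖)) := by gcongr; linarith
      _ = _ := by ring
  · intro t ht
    have hp : (v, t) ∈ P := ⟨hv, ht⟩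
    have h1 := heq (v, t) hp
    have hb := hargb t (mem_ball_zero_iff.1 ht) _ (hhb _ hp)
    beta_reduce
    rw [hlsin _ hb]
    have h2 : h (v, v * t ^ 2) = 2 * h (v, t) + 2 * lam (t * Complex.exp (h (v, t))) := by
      simp only [hS] at h1
      linear_combination (-2) * h1
    rw [h2, Complex.exp_add, two_mul, two_mul, Complex.exp_add, Complex.exp_add]
    ring


/-! ### Uniqueness, oddness and injectivity of inverse Böttcher maps -/

/-- `ζ` is an inverse Böttcher map, on the disc of radius `R`, of the map `ζ ↦ v sin² ζ`, which is
`f_v` in the coordinate `z = -2ζ`. -/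
structure IsSol (v : ℂ) (R : ℝ) (ζ : ℂ → ℂ) : Prop where
  pos : 0 < R
  le_one : R ≤ 1
  diff : DifferentiableOn ℂ ζ (ball 0 R)
  map_zero : ζ 0 = 0
  deriv_zero : deriv ζ 0 = v⁻¹
  eq : ∀ u ∈ ball (0 : ℂ) R, ζ (u ^ 2) = v * Complex.sin (ζ u) ^ 2

theorem sq_mem_ball {R : ℝ} (hR : R ≤ 1) {u : ℂ} (hu : u ∈ ball (0 : ℂ) R) :
    u ^ 2 ∈ ball (0 : ℂ) R := by
  rw [mem_ball_zero_iff] at hu ⊢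
  rw [norm_pow]
  nlinarith [norm_nonneg u]

theorem pow_two_pow_mem_ball {R : ℝ} (hR : R ≤ 1) {u : ℂ} (hu : u ∈ ball (0 : ℂ) R) (k : ℕ) :
    u ^ 2 ^ k ∈ ball (0 : ℂ) R := by
  induction k with
  | zero => simpa using hu
  | succ k ih => rw [pow_succ, pow_mul]; exact sq_mem_ball hR ih

theorem tendsto_pow_two_pow {u : ℂ} (hu : ‖u‖ < 1) :
    Tendsto (fun k : ℕ => u ^ 2 ^ k) atTop (𝓝 0) :=
  (tendsto_pow_atTop_nhds_zero_of_norm_lt_one hu).comp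
    (tendsto_pow_atTop_atTop_of_one_lt one_lt_two)

/-- Two germs with the same nonzero derivative and the same value of `sin²` agree. -/
theorem eventuallyEq_of_sin_sq_eq {a b : ℂ → ℂ} {d : ℂ} (ha0 : a 0 = 0) (hb0 : b 0 = 0)
    (ha : HasDerivAt a d 0) (hb : HasDerivAt b d 0) (hd : d ≠ 0)
    (h : ∀ᶠ u in 𝓝 0, Complex.sin (a u) ^ 2 = Complex.sin (b u) ^ 2) : a =ᶠ[𝓝 0] b := by
  have hsin : ∀ᶠ x in 𝓝 (0 : ℂ), Complex.sin x = 0 → x = 0 := by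
    have h1 : HasDerivAt Complex.sin 1 0 := by simpa using Complex.hasDerivAt_sin 0
    have := h1.eventually_ne one_ne_zero (c := 0)
    rw [eventually_nhdsWithin_iff] at this
    filter_upwards [this] with x hx h0
    by_contra hne
    exact hx hne h0
  have hsum : HasDerivAt (fun u => a u + b u) (d + d) 0 := ha.fun_add hb
  have hdd : d + d ≠ 0 := by rw [← two_mul]; exact mul_ne_zero two_ne_zero hd
  have h1 := hsum.eventually_ne hdd (c := 0)
  rw [eventually_nhdsWithin_iff] at h1
  have ht1 : Tendsto (fun u => a u + b u) (𝓝 0) (𝓝 0) := by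
    have := hsum.continuousAt.tendsto; simpa [ha0, hb0] using this
  have ht2 : Tendsto (fun u => a u - b u) (𝓝 0) (𝓝 0) := by
    have := (ha.fun_sub hb).continuousAt.tendsto; simpa [ha0, hb0] using this
  filter_upwards [h, h1, ht1.eventually hsin, ht2.eventually hsin] with u hu h1u h2u h3u
  by_cases hu0 : u = 0
  · rw [hu0, ha0, hb0]
  -- This product is `sin² a - sin² b`. The second factor cannot vanish for small `u ≠ 0`, because
  -- `a + b` has derivative `2d ≠ 0`.
  have e1 : Complex.sin (a u - b u) * Complex.sin (a u + b u) = 0 := by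
    rw [Complex.sin_sub, Complex.sin_add]
    linear_combination hu + Complex.sin (b u) ^ 2 * Complex.cos_sq' (a u) * (-1 : ℂ) +
      Complex.sin (a u) ^ 2 * Complex.cos_sq' (b u)
  rcases mul_eq_zero.1 e1 with h4 | h4
  · exact sub_eq_zero.1 (h3u h4)
  · exact absurd (h2u h4) (h1u hu0)

namespace IsSol
variable {v : ℂ} {R R' : ℝ} {ζ ζ' : ℂ → ℂ}

theorem mono (h : IsSol v R ζ) (h0 : 0 < R') (hR : R' ≤ R) : IsSol v R' ζ :=
  ⟨h0, hR.trans h.le_one, h.diff.mono (ball_subset_ball hR), h.map_zero, h.deriv_zero,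
    fun u hu => h.eq u (ball_subset_ball hR hu)⟩

theorem congr (h : IsSol v R ζ) (he : EqOn ζ' ζ (ball 0 R)) : IsSol v R ζ' where
  pos := h.pos
  le_one := h.le_one
  diff := h.diff.congr he
  map_zero := by rw [he (mem_ball_self h.pos), h.map_zero]
  deriv_zero := by
    rw [← h.deriv_zero]
    exact (he.eventuallyEq_of_mem (ball_mem_nhds 0 h.pos)).deriv_eq
  eq u hu := by rw [he hu, he (sq_mem_ball h.le_one hu), h.eq u hu]

theorem analyticAt (h : IsSol v R ζ) {u : ℂ} (hu : u ∈ ball (0 : ℂ) R) : AnalyticAt ℂ ζ u :=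
  h.diff.analyticAt (isOpen_ball.mem_nhds hu)

theorem hasDerivAt_zero (h : IsSol v R ζ) : HasDerivAt ζ v⁻¹ 0 := by
  rw [← h.deriv_zero]
  exact (h.analyticAt (mem_ball_self h.pos)).differentiableAt.hasDerivAt

theorem iterate_eq (h : IsSol v R ζ) {u : ℂ} (hu : u ∈ ball (0 : ℂ) R) (k : ℕ) :
    ζ (u ^ 2 ^ k) = (fun x => v * Complex.sin x ^ 2)^[k] (ζ u) := by
  induction k with
  | zero => simp
  | succ k ih =>
    rw [Function.iterate_succ_apply', ← ih, pow_succ, pow_mul,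
      h.eq _ (pow_two_pow_mem_ball h.le_one hu k)]

/-- Suppose the difference has order `m` at `0`, with leading factor `g`; the initial conditions
give `m ≥ 2`. In `ζ(u²) - ζ'(u²) = v sin(ζ - ζ') sin(ζ + ζ')` the left side has order `2m` and the
right side order `m + 1`. Dividing by `u^(m+1)` and letting `u → 0` gives `0 = 2 g 0`. -/
theorem eventuallyEq (hv : v ≠ 0) (h : IsSol v R ζ) (h' : IsSol v R' ζ') : ζ =ᶠ[𝓝 0] ζ' := by
  have hza := h.analyticAt (mem_ball_self h.pos)
  have hza' := h'.analyticAt (mem_ball_self h'.pos)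
  have hΔ : AnalyticAt ℂ (fun u => ζ u - ζ' u) 0 := hza.sub hza'
  by_contra hne
  obtain ⟨m, g, hg, hg0, hge⟩ := hΔ.exists_eventuallyEq_pow_smul_nonzero_iff.2
    (by intro h1; exact hne (h1.mono fun u hu => sub_eq_zero.1 hu))
  have hΔ0 : ζ 0 - ζ' 0 = 0 := by rw [h.map_zero, h'.map_zero, sub_zero]
  have hΔd : HasDerivAt (fun u => ζ u - ζ' u) 0 0 := by
    simpa using h.hasDerivAt_zero.fun_sub h'.hasDerivAt_zero
  have hm0 : m ≠ 0 := by
    rintro rfl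
    have := hge.self_of_nhds
    rw [hΔ0] at this
    simp at this
    exact hg0 this.symm
  have hm1 : m ≠ 1 := by
    rintro rfl
    have h1 : HasDerivAt (fun u : ℂ => (u - 0) ^ 1 • g u) (1 * g 0 + (0 - 0) * deriv g 0) 0 := by
      simpa using ((hasDerivAt_id (0 : ℂ)).sub_const 0).fun_mul hg.differentiableAt.hasDerivAt
    have h2 := hΔd.congr_of_eventuallyEq (hge.mono fun u hu => hu.symm)
    have := h1.unique h2
    simp at this
    exact hg0 this
  have hσ : HasDerivAt (fun u => ζ u + ζ' u) (v⁻¹ + v⁻¹) 0 :=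
    h.hasDerivAt_zero.add h'.hasDerivAt_zero
  set σ : ℂ → ℂ := fun u => ζ u + ζ' u with hσdef
  have hσ0 : σ 0 = 0 := by simp [hσdef, h.map_zero, h'.map_zero]
  set q := dslope Complex.sin 0
  have hq : ∀ x, Complex.sin x = x * q x := fun x => by
    have := sub_smul_dslope Complex.sin 0 x
    simpa using this.symm
  have hqc : ContinuousAt q 0 := continuousAt_dslope_same.2 Complex.differentiableAt_sin
  have hq0 : q 0 = 1 := by simp [q, dslope_same]
  have hpc : ContinuousAt (dslope σ 0) 0 := continuousAt_dslope_same.2 hσ.differentiableAt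
  have hp0 : dslope σ 0 0 = v⁻¹ + v⁻¹ := by rw [dslope_same, hσ.deriv]
  have hp : ∀ u, σ u = u * dslope σ 0 u := fun u => by
    have := sub_smul_dslope σ 0 u
    simpa [hσ0] using this.symm
  have hsq : Tendsto (fun u : ℂ => u ^ 2) (𝓝 0) (𝓝 0) := by
    have : Continuous fun u : ℂ => u ^ 2 := by fun_prop
    simpa using this.tendsto 0
  have hev : ∀ᶠ u in 𝓝[≠] (0 : ℂ), u ^ (m - 1) * g (u ^ 2) =
      v * (g u * q (ζ u - ζ' u) * (dslope σ 0 u * q (σ u))) := by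
    rw [eventually_nhdsWithin_iff]
    filter_upwards [hge, hsq.eventually hge, ball_mem_nhds 0 h.pos, ball_mem_nhds 0 h'.pos]
      with u h1 h2 hu hu' hu0
    have hu0 : u ≠ 0 := hu0
    have e1 : ζ (u ^ 2) - ζ' (u ^ 2) =
        v * (Complex.sin (ζ u - ζ' u) * Complex.sin (ζ u + ζ' u)) := by
      rw [h.eq u hu, h'.eq u hu', ← mul_sub]
      congr 1
      rw [Complex.sin_sub, Complex.sin_add]
      linear_combination Complex.sin (ζ u) ^ 2 * Complex.cos_sq' (ζ' u) * (-1 : ℂ) +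
        Complex.sin (ζ' u) ^ 2 * Complex.cos_sq' (ζ u)
    rw [h2, hq (ζ u - ζ' u), show ζ u + ζ' u = σ u from rfl, hq (σ u)] at e1
    have e2 : σ u * q (σ u) = u * dslope σ 0 u * q (σ u) := by rw [← hp u]
    rw [e2] at e1
    have e3 : (ζ u - ζ' u) * q (ζ u - ζ' u) = u ^ m * g u * q (ζ u - ζ' u) := by
      rw [h1]; simp
    rw [e3] at e1
    simp only [sub_zero, smul_eq_mul] at e1
    obtain ⟨j, rfl⟩ : ∃ j, m = j + 1 := ⟨m - 1, by omega⟩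
    have hup : u ^ (j + 2) ≠ 0 := pow_ne_zero _ hu0
    simp only [Nat.add_sub_cancel]
    apply mul_left_cancel₀ hup
    linear_combination e1
  have hgc := hg.continuousAt
  have hL : Tendsto (fun u : ℂ => u ^ (m - 1) * g (u ^ 2)) (𝓝[≠] 0) (𝓝 (0 * g 0)) := by
    refine Tendsto.mono_left (Tendsto.mul ?_ (hgc.tendsto.comp hsq)) nhdsWithin_le_nhds
    have : Continuous fun u : ℂ => u ^ (m - 1) := by fun_prop
    simpa [show m - 1 ≠ 0 by omega] using this.tendsto 0
  have hΔc : Tendsto (fun u => ζ u - ζ' u) (𝓝 0) (𝓝 0) := by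
    have := hΔ.continuousAt.tendsto; rwa [hΔ0] at this
  have hσc : Tendsto σ (𝓝 0) (𝓝 0) := by
    have := hσ.continuousAt.tendsto; rwa [hσ0] at this
  have hRt : Tendsto (fun u => v * (g u * q (ζ u - ζ' u) * (dslope σ 0 u * q (σ u))))
      (𝓝[≠] 0) (𝓝 (v * (g 0 * q 0 * (dslope σ 0 0 * q 0)))) :=
    Tendsto.mono_left (tendsto_const_nhds.mul ((hgc.tendsto.mul (hqc.tendsto.comp hΔc)).mul
      (hpc.tendsto.mul (hqc.tendsto.comp hσc)))) nhdsWithin_le_nhds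
  have := tendsto_nhds_unique (hL.congr' hev) hRt
  rw [hq0, hp0] at this
  have h3 : v * v⁻¹ = 1 := mul_inv_cancel₀ hv
  apply hg0
  linear_combination (-1 / 2 : ℂ) * this - g 0 * h3

/-- Both `ζ(u)` and `-ζ(-u)` have the same `sin²`, since `u` and `-u` have the same square, and they
have the same derivative at `0`. -/
theorem neg_comp_neg (hv : v ≠ 0) (h : IsSol v R ζ) {u : ℂ} (hu : u ∈ ball (0 : ℂ) R) :
    ζ (-u) = -ζ u := by
  have hz : HasDerivAt (fun u => -ζ (-u)) v⁻¹ 0 := by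
    have h1 : HasDerivAt ζ v⁻¹ (-(0 : ℂ)) := by simpa using h.hasDerivAt_zero
    simpa [Function.comp_def] using (h1.comp (0 : ℂ) (hasDerivAt_neg (0 : ℂ))).fun_neg
  have hd : DifferentiableOn ℂ (fun u => -ζ (-u)) (ball 0 R) :=
    (h.diff.comp differentiable_neg.differentiableOn (fun u hu => by simpa using hu)).neg
  have h1 : ζ =ᶠ[𝓝 0] fun u => -ζ (-u) := by
    refine eventuallyEq_of_sin_sq_eq h.map_zero (by simp [h.map_zero]) h.hasDerivAt_zero hz
      (inv_ne_zero hv) ?_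
    filter_upwards [ball_mem_nhds 0 h.pos] with u hu
    have e1 := h.eq u hu
    have e2 := h.eq (-u) (by simpa using hu)
    rw [neg_sq, e1] at e2
    rw [Complex.sin_neg, neg_sq]
    exact mul_left_cancel₀ hv e2
  have h2 := AnalyticOnNhd.eqOn_of_preconnected_of_eventuallyEq
    (fun _ hu => h.analyticAt hu) (fun _ hu => hd.analyticAt (isOpen_ball.mem_nhds hu))
    (convex_ball _ _).isPreconnected (mem_ball_self h.pos) h1 hu
  rw [h2, neg_neg]

theorem neg (h : IsSol v R ζ) : IsSol (-v) R (fun u => -ζ u) where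
  pos := h.pos
  le_one := h.le_one
  diff := h.diff.neg
  map_zero := by simp [h.map_zero]
  deriv_zero := by
    rw [h.hasDerivAt_zero.fun_neg.deriv, inv_neg]
  eq u hu := by rw [h.eq u hu, Complex.sin_neg]; ring

theorem exists_injOn (hv : v ≠ 0) (h : IsSol v R ζ) : ∃ r > 0, InjOn ζ (ball 0 r) := by
  obtain ⟨N, hN, hinj⟩ := (local_inverse (h.analyticAt (mem_ball_self h.pos))
    (by rw [h.deriv_zero]; exact inv_ne_zero hv)).2
  obtain ⟨r, hr, hrN⟩ := Metric.mem_nhds_iff.1 hN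
  exact ⟨r, hr, hinj.mono hrN⟩

theorem norm_lt_one (h : IsSol v R ζ) {u : ℂ} (hu : u ∈ ball (0 : ℂ) R) : ‖u‖ < 1 :=
  (mem_ball_zero_iff.1 hu).trans_le h.le_one

/-- Points with equal images have equal forward orbits, so their `2^k`-th powers agree once these
lie in a small disc of injectivity. The square roots are then undone one at a time; the wrong sign
is excluded by oddness, which would force both points to be `0`. -/
theorem injOn (hv : v ≠ 0) (h : IsSol v R ζ) : InjOn ζ (ball 0 R) := by
  obtain ⟨r, hr, hinj⟩ := h.exists_injOn hv
  have hstep : ∀ a b : ℂ, ζ a = ζ b → a ∈ ball (0 : ℂ) R → b ∈ ball (0 : ℂ) R → ∀ k,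
      ζ (a ^ 2 ^ k) = ζ (b ^ 2 ^ k) := by
    intro a b hab ha hb k
    rw [h.iterate_eq ha, h.iterate_eq hb, hab]
  have hsmall : ∀ a ∈ ball (0 : ℂ) R, ∀ᶠ k : ℕ in atTop, a ^ 2 ^ k ∈ ball (0 : ℂ) r :=
    fun a ha => (tendsto_pow_two_pow (h.norm_lt_one ha)).eventually (ball_mem_nhds 0 hr)
  have hzero : ∀ a ∈ ball (0 : ℂ) R, ζ a = 0 → a = 0 := by
    intro a ha h0
    obtain ⟨k, hk⟩ := (hsmall a ha).exists
    have h1 : ζ (a ^ 2 ^ k) = ζ 0 := by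
      have := hstep a 0 (by rw [h0, h.map_zero]) ha (mem_ball_self h.pos) k
      rwa [zero_pow (by positivity)] at this
    exact pow_eq_zero_iff (by positivity) |>.1 (hinj hk (mem_ball_self hr) h1)
  have hdesc : ∀ k : ℕ, ∀ a ∈ ball (0 : ℂ) R, ∀ b ∈ ball (0 : ℂ) R, ζ a = ζ b →
      a ^ 2 ^ k = b ^ 2 ^ k → a = b := by
    intro k
    induction k with
    | zero => intro a _ b _ _ h1; simpa using h1
    | succ k ih =>
      intro a ha b hb hab h1
      rw [pow_succ', pow_mul, pow_mul] at h1
      have h2 := ih (a ^ 2) (sq_mem_ball h.le_one ha) (b ^ 2) (sq_mem_ball h.le_one hb)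
        (by rw [h.eq a ha, h.eq b hb, hab]) h1
      rcases sq_eq_sq_iff_eq_or_eq_neg.1 h2 with h3 | h3
      · exact h3
      · rw [h3, h.neg_comp_neg hv hb] at hab
        have h4 : ζ b = 0 := by linear_combination (-1 / 2 : ℂ) * hab
        rw [h3, hzero b hb h4, neg_zero]
  intro a ha b hb hab
  obtain ⟨k, hka, hkb⟩ := ((hsmall a ha).and (hsmall b hb)).exists
  exact hdesc k a ha b hb hab (hinj hka hkb (hstep a b hab ha hb k))

/-- Differentiating the functional equation, a critical point `x` forces `x²` to be critical, so
critical points would accumulate on or reach `0`, where the derivative is `v⁻¹`. -/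
theorem deriv_ne_zero (hv : v ≠ 0) (h : IsSol v R ζ) {u : ℂ} (hu : u ∈ ball (0 : ℂ) R) :
    deriv ζ u ≠ 0 := by
  have hne : ∀ᶠ x in 𝓝 (0 : ℂ), deriv ζ x ≠ 0 := by
    refine (h.analyticAt (mem_ball_self h.pos)).deriv.continuousAt.eventually_ne ?_
    rw [h.deriv_zero]; exact inv_ne_zero hv
  have hstep : ∀ x ∈ ball (0 : ℂ) R, deriv ζ x = 0 → deriv ζ (x ^ 2) = 0 := by
    intro x hx h0
    by_cases hx0 : x = 0
    · simpa [hx0] using hx0 ▸ h0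
    have h1 := ((h.analyticAt (sq_mem_ball h.le_one hx)).differentiableAt.hasDerivAt).comp x
      (hasDerivAt_pow 2 x)
    have h2 : HasDerivAt (fun x => v * Complex.sin (ζ x) ^ 2) 0 x := by
      have := (((h.analyticAt hx).differentiableAt.hasDerivAt.csin).fun_pow 2).const_mul v
      rw [h0] at this
      simpa using this
    have h3 : (ζ ∘ fun x => x ^ 2) =ᶠ[𝓝 x] fun x => v * Complex.sin (ζ x) ^ 2 := by
      filter_upwards [isOpen_ball.mem_nhds hx] with y hy using h.eq y hy
    have h4 := h1.unique (h2.congr_of_eventuallyEq h3)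
    rcases mul_eq_zero.1 h4 with h5 | h5
    · exact h5
    · simp [hx0] at h5
  intro h0
  have hall : ∀ k : ℕ, deriv ζ (u ^ 2 ^ k) = 0 := by
    intro k
    induction k with
    | zero => simpa using h0
    | succ k ih =>
      rw [pow_succ, pow_mul]; exact hstep _ (pow_two_pow_mem_ball h.le_one hu k) ih
  obtain ⟨k, hk⟩ := ((tendsto_pow_two_pow (h.norm_lt_one hu)).eventually hne).exists
  exact hk (hall k)

theorem eq_zero_of_map_eq_zero (hv : v ≠ 0) (h : IsSol v R ζ) {u : ℂ} (hu : u ∈ ball (0 : ℂ) R)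
    (h0 : ζ u = 0) : u = 0 :=
  h.injOn hv hu (mem_ball_self h.pos) (h0.trans h.map_zero.symm)

end IsSol

/-! ### The canonical solution and its dependence on the parameter -/

/-- Taylor coefficients of the inverse Böttcher germ. -/
noncomputable def coeff (v : ℂ) (n : ℕ) : ℂ :=
  ((n.factorial : ℂ))⁻¹ *
    iteratedDeriv n (Classical.epsilon fun ζ : ℂ → ℂ => ∃ R, IsSol v R ζ) 0

/-- The inverse Böttcher map as the sum of its Taylor series. -/
noncomputable def Z (v u : ℂ) : ℂ := ∑' n, coeff v n * u ^ n

/-- The choice hidden in `coeff` is immaterial, by uniqueness of the germ. -/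
theorem IsSol.coeff_eq {v : ℂ} {R : ℝ} {ζ : ℂ → ℂ} (hv : v ≠ 0) (h : IsSol v R ζ) (n : ℕ) :
    coeff v n = ((n.factorial : ℂ))⁻¹ * iteratedDeriv n ζ 0 := by
  obtain ⟨R', h'⟩ := Classical.epsilon_spec (p := fun ζ : ℂ → ℂ => ∃ R, IsSol v R ζ) ⟨ζ, R, h⟩
  rw [coeff, (h'.eventuallyEq hv h).iteratedDeriv_eq n]

theorem IsSol.hasSum {v : ℂ} {R : ℝ} {ζ : ℂ → ℂ} (hv : v ≠ 0) (h : IsSol v R ζ) {u : ℂ}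
    (hu : u ∈ ball (0 : ℂ) R) : HasSum (fun n => coeff v n * u ^ n) (ζ u) := by
  have := Complex.hasSum_taylorSeries_on_ball h.diff hu
  refine this.congr_fun fun n => ?_
  rw [h.coeff_eq hv, sub_zero, smul_eq_mul, smul_eq_mul]; ring

theorem IsSol.eqOn_Z {v : ℂ} {R : ℝ} {ζ : ℂ → ℂ} (hv : v ≠ 0) (h : IsSol v R ζ) :
    EqOn (Z v) ζ (ball 0 R) := fun _ hu => (h.hasSum hv hu).tsum_eq

theorem IsSol.isSol_Z {v : ℂ} {R : ℝ} {ζ : ℂ → ℂ} (hv : v ≠ 0) (h : IsSol v R ζ) :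
    IsSol v R (Z v) := h.congr (h.eqOn_Z hv)

theorem norm_coeff_mul_pow_le {v : ℂ} {R r C : ℝ} (hv : v ≠ 0) (h : IsSol v R (Z v)) (hr : 0 < r)
    (hrR : r < R) (hC : ∀ u : ℂ, ‖u‖ ≤ r → ‖Z v u‖ ≤ C) (n : ℕ) : ‖coeff v n‖ * r ^ n ≤ C := by
  have hd : DiffContOnCl ℂ (Z v) (ball 0 r) := by
    refine DifferentiableOn.diffContOnCl (h.diff.mono ?_)
    rw [closure_ball _ hr.ne']
    exact closedBall_subset_ball hrR
  have h1 := Complex.norm_iteratedDeriv_le_of_forall_mem_sphere_norm_le n hr hd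
    (fun z hz => hC z (by rw [mem_sphere_zero_iff_norm] at hz; exact hz.le))
  rw [h.coeff_eq hv, norm_mul, norm_inv, Complex.norm_natCast]
  have hf : (0 : ℝ) < n.factorial := by positivity
  calc _ ≤ ((n.factorial : ℝ))⁻¹ * (n.factorial * C / r ^ n) * r ^ n := by gcongr
    _ = C := by field_simp

theorem hasDerivAt_one_of_norm_sub_le {g : ℂ → ℂ} {ρ K : ℝ} (hρ : 0 < ρ)
    (h : ∀ t ∈ ball (0 : ℂ) ρ, ‖g t - t‖ ≤ K * ‖t‖ ^ 2) : g 0 = 0 ∧ HasDerivAt g 1 0 := by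
  have h0 : g 0 = 0 := by simpa using h 0 (mem_ball_self hρ)
  refine ⟨h0, ?_⟩
  rw [hasDerivAt_iff_isLittleO]
  have h1 : (fun t : ℂ => g t - g 0 - (t - 0) • (1 : ℂ)) =O[𝓝 0] fun t => ‖t‖ ^ 2 := by
    refine Asymptotics.IsBigO.of_bound K ?_
    filter_upwards [ball_mem_nhds 0 hρ] with t ht
    simpa [h0] using h t ht
  refine h1.trans_isLittleO ?_
  simp only [sub_zero]
  have := (Asymptotics.isLittleO_pow_id (𝕜 := ℂ) (n := 2) one_lt_two)
  exact (Asymptotics.isLittleO_norm_left.2 this).congr_left fun t => by simp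

/-- The solutions obtained from the uniform local family. -/
theorem isSol_of_local_family {v : ℂ} (hv : v ≠ 0) {V ρ K : ℝ} (hρ : 0 < ρ) (hVρ : V * ρ ≤ 1)
    (hvV : ‖v‖ < V) {η : ℂ → ℂ} (hd : DifferentiableOn ℂ η (ball 0 ρ))
    (hη : ∀ t ∈ ball (0 : ℂ) ρ, ‖η t - t‖ ≤ K * ‖t‖ ^ 2)
    (he : ∀ t ∈ ball (0 : ℂ) ρ, η (v * t ^ 2) = v * Complex.sin (η t) ^ 2) :
    IsSol v (‖v‖ * ρ) (fun u => η (u / v)) := by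
  have hvn : 0 < ‖v‖ := norm_pos_iff.2 hv
  obtain ⟨h0, h1⟩ := hasDerivAt_one_of_norm_sub_le hρ hη
  have hm : MapsTo (fun u : ℂ => u / v) (ball 0 (‖v‖ * ρ)) (ball 0 ρ) := by
    intro u hu
    rw [mem_ball_zero_iff] at hu ⊢
    rw [norm_div, div_lt_iff₀ hvn, mul_comm]; exact hu
  refine ⟨by positivity, ?_, hd.comp (by fun_prop) hm, by simp [h0], ?_, fun u hu => ?_⟩
  · exact (mul_le_mul_of_nonneg_right hvV.le hρ.le).trans hVρ
  · have h2 : HasDerivAt η 1 ((0 : ℂ) / v) := by simpa using h1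
    have := h2.comp (0 : ℂ) ((hasDerivAt_id (0 : ℂ)).div_const v)
    simpa [Function.comp_def] using this.deriv
  · have := he _ (hm hu)
    rw [← this]
    congr 1
    field_simp

/-- Uniform existence of inverse Böttcher maps. -/
theorem exists_uniform_isSol {V : ℝ} (hV : 0 < V) : ∃ ρ > 0, ∀ v : ℂ, v ≠ 0 → ‖v‖ < V →
    IsSol v (‖v‖ * ρ) (Z v) ∧ ∀ u ∈ ball (0 : ℂ) (‖v‖ * ρ), ‖Z v u‖ ≤ 1 := by
  obtain ⟨ρ, K, hρ, hVρ, hK, η, -, hη⟩ := exists_local_family hV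
  -- For `‖t‖ < ρ'` the error `K‖t‖²` is at most `1/4` and `‖t‖ ≤ 1/2`, so the solution stays below
  -- `1`.
  set ρ' := min ρ (min (1 / 2) (1 / (2 * K))) with hρ'
  have hρ'0 : 0 < ρ' := by positivity
  have hρ'ρ : ρ' ≤ ρ := min_le_left _ _
  refine ⟨ρ', hρ'0, fun v hv hvV => ?_⟩
  obtain ⟨hd, hη1, hη2⟩ := hη v (mem_ball_zero_iff.2 hvV)
  have hs := isSol_of_local_family hv hρ hVρ hvV hd hη1 hη2
  have hvn : 0 < ‖v‖ := norm_pos_iff.2 hv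
  refine ⟨(hs.isSol_Z hv).mono (by positivity) (by gcongr), fun u hu => ?_⟩
  rw [hs.eqOn_Z hv (ball_subset_ball (by gcongr) hu)]
  rw [mem_ball_zero_iff] at hu
  have ht : ‖u / v‖ < ρ' := by rw [norm_div, div_lt_iff₀ hvn, mul_comm]; exact hu
  have h1 := hη1 (u / v) (mem_ball_zero_iff.2 (ht.trans_le hρ'ρ))
  have h2 : ‖u / v‖ ≤ 1 / 2 := ht.le.trans ((min_le_right _ _).trans (min_le_left _ _))
  have h3 : ‖u / v‖ ≤ 1 / (2 * K) := ht.le.trans ((min_le_right _ _).trans (min_le_right _ _))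
  have h4 : K * ‖u / v‖ ^ 2 ≤ 1 / 4 := by
    calc K * ‖u / v‖ ^ 2 = K * ‖u / v‖ * ‖u / v‖ := by ring
      _ ≤ K * (1 / (2 * K)) * (1 / 2) := by gcongr
      _ = 1 / 4 := by field_simp; norm_num
  have h5 : ‖η v (u / v)‖ ≤ ‖η v (u / v) - u / v‖ + ‖u / v‖ := norm_le_norm_sub_add _ _
  linarith

/-- In the variable `t = u / v` the family lives on a disc independent of `v` and is holomorphic in
`v`; its coefficients are `coeff v n * v ^ n`. -/
theorem differentiableAt_coeff {v₀ : ℂ} (hv₀ : v₀ ≠ 0) (n : ℕ) :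
    DifferentiableAt ℂ (fun v => coeff v n) v₀ := by
  set V : ℝ := ‖v₀‖ + 1 with hV
  have hVpos : 0 < V := by positivity
  obtain ⟨ρ, K, hρ, hVρ, hK, η, hηv, hη⟩ := exists_local_family hVpos
  obtain ⟨σ, hσ, hσZ⟩ := exists_uniform_isSol hVpos
  set τ := min ρ σ / 2 with hτ
  have hτ0 : 0 < τ := by positivity
  have hτρ : τ < ρ := by
    have : min ρ σ ≤ ρ := min_le_left _ _
    have : 0 < min ρ σ := by positivity
    linarith
  have hτσ : τ < σ := by
    have : min ρ σ ≤ σ := min_le_right _ _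
    have : 0 < min ρ σ := by positivity
    linarith
  set N : Set ℂ := ball 0 V \ {0} with hN
  have hNo : IsOpen N := isOpen_ball.sdiff isClosed_singleton
  have hvN : v₀ ∈ N := ⟨mem_ball_zero_iff.2 (by linarith), hv₀⟩
  have key := differentiableOn_coeff hNo (F := η) (a := fun v n => coeff v n * v ^ n) (C := 1) hτ0
    (fun v hv n => ?_) (fun v hv t ht => ?_)
    (fun t ht => (hηv t (ball_subset_ball hτρ.le ht)).mono sdiff_subset) n
  · have h1 : DifferentiableAt ℂ (fun v => coeff v n * v ^ n / v ^ n) v₀ :=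
      (key.differentiableAt (hNo.mem_nhds hvN)).fun_div (by fun_prop) (pow_ne_zero n hv₀)
    refine h1.congr_of_eventuallyEq ?_
    filter_upwards [isOpen_ne.mem_nhds hv₀] with v hv
    rw [mul_div_cancel_right₀ _ (pow_ne_zero n hv)]
  · have hv0 : v ≠ 0 := hv.2
    have hvn : 0 < ‖v‖ := norm_pos_iff.2 hv0
    obtain ⟨h1, h2⟩ := hσZ v hv0 (mem_ball_zero_iff.1 hv.1)
    have := norm_coeff_mul_pow_le hv0 h1 (r := ‖v‖ * τ) (C := 1) (by positivity) (by gcongr)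
      (fun u hu => h2 u (mem_ball_zero_iff.2 (hu.trans_lt (by gcongr)))) n
    rw [norm_mul, norm_pow, mul_assoc, ← mul_pow]
    exact this
  · have hv0 : v ≠ 0 := hv.2
    have hvn : 0 < ‖v‖ := norm_pos_iff.2 hv0
    obtain ⟨hd, hη1, hη2⟩ := hη v hv.1
    have hs := isSol_of_local_family hv0 hρ hVρ (mem_ball_zero_iff.1 hv.1) hd hη1 hη2
    have htρ : ‖t‖ < ρ := (mem_ball_zero_iff.1 ht).trans hτρ
    have := hs.hasSum hv0 (u := v * t) (by
      rw [mem_ball_zero_iff, norm_mul]; gcongr)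
    rw [mul_div_cancel_left₀ _ hv0] at this
    refine this.congr_fun fun n => ?_
    rw [mul_pow]; ring

theorem continuousAt_coeff {v₀ : ℂ} (hv₀ : v₀ ≠ 0) (n : ℕ) :
    ContinuousAt (fun v => coeff v n) v₀ := (differentiableAt_coeff hv₀ n).continuousAt

theorem Z_neg {v : ℂ} {R : ℝ} (hv : v ≠ 0) (h : IsSol v R (Z v)) :
    IsSol (-v) R (Z (-v)) ∧ ∀ u ∈ ball (0 : ℂ) R, Z (-v) u = -Z v u :=
  ⟨h.neg.isSol_Z (neg_ne_zero.2 hv), h.neg.eqOn_Z (neg_ne_zero.2 hv)⟩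

/-! ### Extension by square roots and the critical Böttcher coordinate -/

/-- If the critical value is not attained, the inverse Böttcher map extends to the disc of radius
`√R`. -/
theorem IsSol.extend {v : ℂ} {R : ℝ} (hv : v ≠ 0) (h : IsSol v R (Z v))
    (hmiss : ∀ u ∈ ball (0 : ℂ) R, Z v u ≠ v) : IsSol v (√R) (Z v) := by
  set S := √R with hS
  have hSpos : 0 < S := Real.sqrt_pos.2 h.pos
  have hS1 : S ≤ 1 := Real.sqrt_le_one.2 h.le_one
  have hRS : R ≤ S := by
    rw [hS]; apply Real.le_sqrt_of_sq_le; nlinarith [h.pos, h.le_one]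
  have hsq : MapsTo (fun u : ℂ => u ^ 2) (ball 0 S) (ball 0 R) := by
    intro u hu
    rw [mem_ball_zero_iff] at hu ⊢
    rw [norm_pow]
    calc ‖u‖ ^ 2 < S ^ 2 := by gcongr
      _ = R := Real.sq_sqrt h.pos.le
  set k : ℂ → ℂ := dslope (Z v) 0 with hk
  have hkd : DifferentiableOn ℂ k (ball 0 R) :=
    (Complex.differentiableOn_dslope (ball_mem_nhds 0 h.pos)).2 h.diff
  have hkZ : ∀ x, Z v x = x * k x := fun x => by
    have := sub_smul_dslope (Z v) 0 x
    simpa [h.map_zero] using this.symm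
  have hk0 : k 0 = v⁻¹ := by rw [hk, dslope_same, h.deriv_zero]
  have hkne : ∀ x ∈ ball (0 : ℂ) R, k x ≠ 0 := by
    intro x hx h0
    by_cases hx0 : x = 0
    · rw [hx0, hk0] at h0; exact inv_ne_zero hv h0
    · exact hx0 (h.eq_zero_of_map_eq_zero hv hx (by rw [hkZ, h0, mul_zero]))
  have hpow : DifferentiableOn ℂ (fun u : ℂ => u ^ 2) (ball 0 S) := by fun_prop
  obtain ⟨a, ha⟩ : ∃ a : ℂ, Complex.exp a = v⁻¹ := ⟨_, Complex.exp_log (inv_ne_zero hv)⟩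
  -- Prescribing `a + a` with `exp a = v⁻¹` makes the square root `q` of `Z v (u²) / v` have
  -- derivative `v⁻¹` at `0`, as `sin ζ` must.
  obtain ⟨g, hgd, hg0, hg⟩ := exists_log_on_ball (f := fun u => k (u ^ 2) / v) (a := a + a) hSpos
    ((hkd.comp hpow hsq).div_const v)
    (fun u hu => div_ne_zero (hkne _ (hsq hu)) hv)
    (by rw [Complex.exp_add, ha]; simp [hk0, div_eq_mul_inv])
  set q : ℂ → ℂ := fun u => u * Complex.exp (g u / 2) with hq
  have hqd : DifferentiableOn ℂ q (ball 0 S) :=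
    differentiableOn_id.mul (hgd.div_const 2).cexp
  have hq2 : ∀ u ∈ ball (0 : ℂ) S, q u ^ 2 = Z v (u ^ 2) / v := by
    intro u hu
    rw [hq]; beta_reduce
    rw [mul_pow, ← Complex.exp_nat_mul, Nat.cast_ofNat, mul_div_cancel₀ _ two_ne_zero, hg u hu,
      hkZ (u ^ 2)]
    ring
  have hq0 : q 0 = 0 := by simp [hq]
  have hqd0 : HasDerivAt q v⁻¹ 0 := by
    have h1 := (hasDerivAt_id (0 : ℂ)).fun_mul
      (((hgd.differentiableAt (ball_mem_nhds 0 hSpos)).hasDerivAt.div_const 2).cexp)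
    simp only [id, hg0, one_mul, zero_mul, add_zero] at h1
    rw [show (a + a) / 2 = a by ring, ha] at h1
    exact h1
  -- Here the missed value enters: `Z v (u²) ≠ v` says `1 - q² ≠ 0`. With `s` a square root of it,
  -- `-i log(s + i q)` is an arcsine of `q`.
  obtain ⟨l, hld, hl0, hl⟩ := exists_log_on_ball (f := fun u => 1 - q u ^ 2) (a := 0) hSpos
    ((differentiableOn_const 1).sub (hqd.pow 2))
    (fun u hu h0 => by
      rw [hq2 u hu] at h0
      refine hmiss _ (hsq hu) ?_
      field_simp at h0
      linear_combination -h0)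
    (by simp [hq0])
  set s : ℂ → ℂ := fun u => Complex.exp (l u / 2) with hs
  have hsd : DifferentiableOn ℂ s (ball 0 S) := (hld.div_const 2).cexp
  have hs2 : ∀ u ∈ ball (0 : ℂ) S, s u ^ 2 = 1 - q u ^ 2 := by
    intro u hu
    rw [hs]; beta_reduce
    rw [← Complex.exp_nat_mul, Nat.cast_ofNat, mul_div_cancel₀ _ two_ne_zero, hl u hu]
  have hs0 : s 0 = 1 := by simp [hs, hl0]
  have hprod : ∀ u ∈ ball (0 : ℂ) S, (s u + Complex.I * q u) * (s u - Complex.I * q u) = 1 := by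
    intro u hu
    linear_combination hs2 u hu - q u ^ 2 * Complex.I_sq
  obtain ⟨m, hmd, hm0, hm⟩ := exists_log_on_ball (f := fun u => s u + Complex.I * q u) (a := 0)
    hSpos (hsd.add (hqd.const_mul _))
    (fun u hu h0 => by have := hprod u hu; rw [h0, zero_mul] at this; exact zero_ne_one this)
    (by simp [hs0, hq0])
  set ζ : ℂ → ℂ := fun u => -Complex.I * m u with hζ
  have hζd : DifferentiableOn ℂ ζ (ball 0 S) := hmd.const_mul _
  have hζ0 : ζ 0 = 0 := by simp [hζ, hm0]
  have hsin : ∀ u ∈ ball (0 : ℂ) S, Complex.sin (ζ u) = q u := by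
    intro u hu
    have e1 : Complex.exp (ζ u * Complex.I) = s u + Complex.I * q u := by
      rw [← hm u hu, hζ]; congr 1; linear_combination (-m u) * Complex.I_sq
    have e2 : Complex.exp (-ζ u * Complex.I) = s u - Complex.I * q u := by
      rw [neg_mul, Complex.exp_neg, e1]
      exact inv_eq_of_mul_eq_one_right (hprod u hu)
    rw [Complex.sin, e1, e2]
    linear_combination (-q u) * Complex.I_sq
  have hζderiv : HasDerivAt ζ v⁻¹ 0 := by
    have h1 := (hζd.differentiableAt (ball_mem_nhds 0 hSpos)).hasDerivAt
    have h2 := h1.csin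
    rw [hζ0, Complex.cos_zero, one_mul] at h2
    have h3 : (fun u => Complex.sin (ζ u)) =ᶠ[𝓝 0] q := by
      filter_upwards [ball_mem_nhds 0 hSpos] with u hu using hsin u hu
    rw [← h2.unique (hqd0.congr_of_eventuallyEq h3)]
    exact h1
  have hloc : ζ =ᶠ[𝓝 0] Z v := by
    refine eventuallyEq_of_sin_sq_eq hζ0 h.map_zero hζderiv h.hasDerivAt_zero (inv_ne_zero hv) ?_
    filter_upwards [ball_mem_nhds 0 h.pos] with u hu
    have huS := ball_subset_ball hRS hu
    rw [hsin u huS, hq2 u huS, h.eq u hu]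
    field_simp
  have hEq : EqOn ζ (Z v) (ball 0 R) :=
    AnalyticOnNhd.eqOn_of_preconnected_of_eventuallyEq
      (fun _ hu => hζd.analyticAt (isOpen_ball.mem_nhds (ball_subset_ball hRS hu)))
      (fun _ hu => h.analyticAt hu)
      (convex_ball _ _).isPreconnected (mem_ball_self h.pos) hloc
  refine IsSol.isSol_Z hv (ζ := ζ) ⟨hSpos, hS1, hζd, hζ0, hζderiv.deriv, fun u hu => ?_⟩
  rw [hEq (hsq hu), hsin u hu, hq2 u hu]
  field_simp

/-- `w` is the Böttcher coordinate of the critical value `ζ = v`. -/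
def IsVal (v w : ℂ) : Prop := v ≠ 0 ∧ ∃ R, IsSol v R (Z v) ∧ w ∈ ball (0 : ℂ) R ∧ Z v w = v

theorem IsVal.unique {v w w' : ℂ} (h : IsVal v w) (h' : IsVal v w') : w = w' := by
  obtain ⟨hv, R, hR, hw, hZ⟩ := h
  obtain ⟨-, R', hR', hw', hZ'⟩ := h'
  rcases le_total R R' with hle | hle
  · exact hR'.injOn hv (ball_subset_ball hle hw) hw' (hZ.trans hZ'.symm)
  · exact hR.injOn hv hw (ball_subset_ball hle hw') (hZ.trans hZ'.symm)

theorem IsVal.norm_lt_one {v w : ℂ} (h : IsVal v w) : ‖w‖ < 1 := by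
  obtain ⟨hv, R, hR, hw, hZ⟩ := h
  exact hR.norm_lt_one hw

theorem IsVal.ne_zero {v w : ℂ} (h : IsVal v w) : w ≠ 0 := by
  obtain ⟨hv, R, hR, hw, hZ⟩ := h
  rintro rfl
  exact hv (hZ.symm.trans hR.map_zero)

theorem norm_lt_sqrt {w : ℂ} (h0 : w ≠ 0) (h1 : ‖w‖ < 1) : ‖w‖ < √‖w‖ := by
  have : 0 < ‖w‖ := norm_pos_iff.2 h0
  apply Real.lt_sqrt_of_sq_lt; nlinarith

/-- By injectivity `v` is not attained on the disc of radius `‖w‖`, so one extension step applies.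
The gain from `‖w‖` to `√‖w‖` leaves room around `w` in all later limit arguments. -/
theorem IsVal.isSol_sqrt {v w : ℂ} (h : IsVal v w) : IsSol v (√‖w‖) (Z v) := by
  have hw0 := h.ne_zero
  obtain ⟨hv, R, hR, hw, hZ⟩ := h
  rw [mem_ball_zero_iff] at hw
  refine (hR.mono (norm_pos_iff.2 hw0) hw.le).extend hv fun u hu hu' => ?_
  rw [mem_ball_zero_iff] at hu
  have := hR.injOn hv (mem_ball_zero_iff.2 (hu.trans hw)) (mem_ball_zero_iff.2 hw)
    (hu'.trans hZ.symm)
  rw [this] at hu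
  exact lt_irrefl _ hu

/-- On a disc of definition the critical value lies outside the image of the squared disc. -/
theorem IsSol.Z_ne_of_mem_ball_sq {v : ℂ} {R : ℝ} (hv : v ≠ 0) (h : IsSol v R (Z v)) {u : ℂ}
    (hu : ‖u‖ < R ^ 2) : Z v u ≠ v := by
  intro hZ
  obtain ⟨x, hx⟩ : ∃ x : ℂ, x ^ 2 = u := ⟨_, Complex.cpow_nat_inv_pow u two_ne_zero⟩
  have hxR : x ∈ ball (0 : ℂ) R := by
    rw [mem_ball_zero_iff]
    rw [← hx, norm_pow] at hu
    exact lt_of_pow_lt_pow_left₀ 2 h.pos.le hu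
  have hx0 : x ≠ 0 := by
    rintro rfl
    rw [← hx, zero_pow two_ne_zero, h.map_zero] at hZ
    exact hv hZ.symm
  have hx2 : x ^ 2 ∈ ball (0 : ℂ) R := sq_mem_ball h.le_one hxR
  have e1 := h.eq x hxR
  rw [hx, hZ] at e1
  -- Hence the right side of the functional equation is critical at `x`, while the left side has
  -- derivative `2x (Z v)'(x²) ≠ 0`.
  have hsin2 : Complex.sin (Z v x) ^ 2 = 1 := by
    apply mul_left_cancel₀ hv; rw [← e1, mul_one]
  have hcos : Complex.cos (Z v x) = 0 := by
    have := Complex.sin_sq_add_cos_sq (Z v x)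
    rw [hsin2] at this
    exact pow_eq_zero_iff two_ne_zero |>.1 (by linear_combination this)
  have h1 := ((h.analyticAt hx2).differentiableAt.hasDerivAt).comp x (hasDerivAt_pow 2 x)
  have h2 : HasDerivAt (fun x => v * Complex.sin (Z v x) ^ 2) 0 x := by
    have := (((h.analyticAt hxR).differentiableAt.hasDerivAt.csin).fun_pow 2).const_mul v
    rw [hcos] at this
    simpa using this
  have h3 : (Z v ∘ fun x => x ^ 2) =ᶠ[𝓝 x] fun x => v * Complex.sin (Z v x) ^ 2 := by
    filter_upwards [isOpen_ball.mem_nhds hxR] with y hy using h.eq y hy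
  have h4 := h1.unique (h2.congr_of_eventuallyEq h3)
  rcases mul_eq_zero.1 h4 with h5 | h5
  · exact h.deriv_ne_zero hv hx2 h5
  · simp [hx0] at h5

theorem isSol_of_forall_lt {v : ℂ} {R : ℝ} (h0 : 0 < R)
    (h : ∀ r, 0 < r → r < R → IsSol v r (Z v)) : IsSol v R (Z v) := by
  have hmem : ∀ u ∈ ball (0 : ℂ) R, ∃ r, 0 < r ∧ r < R ∧ u ∈ ball (0 : ℂ) r := by
    intro u hu
    rw [mem_ball_zero_iff] at hu
    obtain ⟨r, h1, h2⟩ := exists_between hu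
    exact ⟨r, (norm_nonneg u).trans_lt h1, h2, mem_ball_zero_iff.2 h1⟩
  have hhalf := h (R / 2) (by linarith) (by linarith)
  refine ⟨h0, ?_, fun u hu => ?_, hhalf.map_zero, hhalf.deriv_zero, fun u hu => ?_⟩
  · exact le_of_forall_lt_imp_le_of_dense fun r hr => by
      rcases le_or_gt r 0 with h1 | h1
      · linarith
      · exact (h r h1 hr).le_one
  · obtain ⟨r, h1, h2, h3⟩ := hmem u hu
    exact ((h r h1 h2).analyticAt h3).differentiableAt.differentiableWithinAt
  · obtain ⟨r, h1, h2, h3⟩ := hmem u hu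
    exact (h r h1 h2).eq u h3

/-- Either the critical value is attained, or the inverse Böttcher map is defined on the unit
disc. -/
theorem exists_isVal_or_isSol_one {v : ℂ} (hv : v ≠ 0) : (∃ w, IsVal v w) ∨ IsSol v 1 (Z v) := by
  by_contra! hcon
  obtain ⟨hno, h1⟩ := hcon
  obtain ⟨ρ, hρ, hloc⟩ := exists_uniform_isSol (V := ‖v‖ + 1) (by positivity)
  set R₀ := ‖v‖ * ρ
  have h0 : IsSol v R₀ (Z v) := (hloc v hv (by linarith)).1
  -- Repeated square roots of the radius tend to `1`.
  have hk : ∀ k : ℕ, IsSol v (R₀ ^ ((1 / 2 : ℝ) ^ k)) (Z v) := by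
    intro k
    induction k with
    | zero => simpa using h0
    | succ k ih =>
      have := ih.extend hv fun u hu hZ => hno u ⟨hv, _, ih, hu, hZ⟩
      rwa [Real.sqrt_eq_rpow, ← Real.rpow_mul h0.pos.le, ← pow_succ] at this
  apply h1
  refine isSol_of_forall_lt one_pos fun r hr0 hr1 => ?_
  have ht : Tendsto (fun k : ℕ => R₀ ^ ((1 / 2 : ℝ) ^ k)) atTop (𝓝 (R₀ ^ (0 : ℝ))) :=
    tendsto_const_nhds.rpow (tendsto_pow_atTop_nhds_zero_of_lt_one (by norm_num) (by norm_num))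
      (Or.inl h0.pos.ne')
  rw [Real.rpow_zero] at ht
  obtain ⟨k, hk'⟩ := (ht.eventually (lt_mem_nhds hr1)).exists
  exact (hk k).mono hr0 hk'.le

theorem IsVal.neg {v w : ℂ} (h : IsVal v w) : IsVal (-v) w := by
  obtain ⟨hv, R, hR, hw, hZ⟩ := h
  obtain ⟨h1, h2⟩ := Z_neg hv hR
  exact ⟨neg_ne_zero.2 hv, R, h1, hw, by rw [h2 w hw, hZ]⟩


/-! ### Compactness: uniform bounds, limits and persistence of solutions -/

theorem normSq_sin (z : ℂ) :
    ‖Complex.sin z‖ ^ 2 = Real.sin z.re ^ 2 + Real.sinh z.im ^ 2 := by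
  have h : Complex.sin z = ⟨Real.sin z.re * Real.cosh z.im, Real.cos z.re * Real.sinh z.im⟩ := by
    apply Complex.ext
    · conv_lhs => rw [← Complex.re_add_im z]
      rw [Complex.sin_add_mul_I]
      simp [← Complex.ofReal_sin, ← Complex.ofReal_cos, ← Complex.ofReal_cosh,
        ← Complex.ofReal_sinh]
    · conv_lhs => rw [← Complex.re_add_im z]
      rw [Complex.sin_add_mul_I]
      simp [← Complex.ofReal_sin, ← Complex.ofReal_cos, ← Complex.ofReal_cosh,
        ← Complex.ofReal_sinh]
  rw [h, Complex.sq_norm, Complex.normSq_mk]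
  have h1 := Real.cosh_sq z.im
  have h2 := Real.sin_sq_add_cos_sq z.re
  linear_combination Real.sin z.re ^ 2 * h1 + Real.sinh z.im ^ 2 * h2

theorem abs_im_le_norm_sin (z : ℂ) : |z.im| ≤ ‖Complex.sin z‖ := by
  have h1 : |z.im| ≤ |Real.sinh z.im| := by
    rcases le_total 0 z.im with h | h
    · rw [abs_of_nonneg h, abs_of_nonneg (Real.sinh_nonneg_iff.2 h)]
      exact Real.self_le_sinh_iff.2 h
    · rw [abs_of_nonpos h, abs_of_nonpos (Real.sinh_nonpos_iff.2 h)]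
      exact neg_le_neg (Real.sinh_le_self_iff.2 h)
  refine h1.trans (abs_le_of_sq_le_sq ?_ (norm_nonneg _))
  rw [normSq_sin]; nlinarith [sq_nonneg (Real.sin z.re)]

theorem abs_sin_re_le_norm_sin (z : ℂ) : |Real.sin z.re| ≤ ‖Complex.sin z‖ := by
  refine abs_le_of_sq_le_sq ?_ (norm_nonneg _)
  rw [normSq_sin]; nlinarith [sq_nonneg (Real.sinh z.im)]

/-- Solutions on a common disc are locally uniformly bounded, uniformly for parameters in a
compact subset of the punctured plane. -/
theorem exists_uniform_bound {m V R : ℝ} (hm : 0 < m) (hV : 0 < V) (hR : 0 < R) (s : ℝ)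
    (hsR : s < R) :
    ∃ C : ℝ, ∀ v : ℂ, m ≤ ‖v‖ → ‖v‖ < V → IsSol v R (Z v) → ∀ u : ℂ, ‖u‖ ≤ s → ‖Z v u‖ ≤ C := by
  obtain ⟨ρ, hρ, hloc⟩ := exists_uniform_isSol hV
  let P : ℝ → Prop := fun t => ∀ s < R, ∃ C : ℝ, ∀ v : ℂ, m ≤ ‖v‖ → ‖v‖ < V → IsSol v R (Z v) →
    ∀ u : ℂ, ‖u‖ < t → ‖u‖ ≤ s → ‖Z v u‖ ≤ C
  set r₀ := min (m * ρ) (1 / 2) with hr₀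
  have hr₀pos : 0 < r₀ := by positivity
  have hr₀1 : r₀ < 1 := (min_le_right _ _).trans_lt (by norm_num)
  have hbase : P r₀ := by
    intro s _
    refine ⟨1, fun v hmv hvV _ u hu _ => ?_⟩
    have hv0 : v ≠ 0 := by rw [← norm_pos_iff]; linarith
    refine (hloc v hv0 hvV).2 u (mem_ball_zero_iff.2 (hu.trans_le ?_))
    exact (min_le_left _ _).trans (by gcongr)
  -- A bound for radius `t` bounds `sin (Z v u)`, hence the imaginary part of `Z v u`, for radius
  -- `√t`. Borel–Carathéodory turns this into a bound on a smaller disc; the exponent `3/4`,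
  -- strictly between `1/2` and `1`, leaves room yet still drives the radii to `1`.
  have hstep : ∀ t, 0 < t → t < 1 → P t → P (t ^ (3 / 4 : ℝ)) := by
    intro t ht0 ht1 hP s hs
    wlog hspos : 0 < s generalizing s
    · obtain ⟨C, hC⟩ := this (max s (R / 2)) (max_lt hs (by linarith))
        (lt_max_of_lt_right (by linarith))
      exact ⟨C, fun v h1 h2 h3 u h4 h5 => hC v h1 h2 h3 u h4 (h5.trans (le_max_left _ _))⟩
    set σ := (s + R) / 2 with hσ
    have hsσ : s < σ := by linarith
    have hσR : σ < R := by linarith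
    obtain ⟨C, hC⟩ := hP σ hσR
    set M := √(|C| / m) + 1 with hM
    have hMpos : 0 < M := by positivity
    set T := min (√t) σ with hT
    have hTpos : 0 < T := lt_min (Real.sqrt_pos.2 ht0) (hspos.trans hsσ)
    set T' := min (t ^ (3 / 4 : ℝ)) s with hT'
    have hTT : T' < T := by
      refine min_lt_min ?_ hsσ
      rw [Real.sqrt_eq_rpow]
      exact Real.rpow_lt_rpow_of_exponent_gt ht0 ht1 (by norm_num)
    refine ⟨2 * M * T' / (T - T'), fun v hmv hvV hsol u hu hus => ?_⟩
    have hv0 : v ≠ 0 := by rw [← norm_pos_iff]; linarith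
    have huT' : ‖u‖ ≤ T' := le_min hu.le hus
    have hTR : ball (0 : ℂ) T ⊆ ball 0 R := ball_subset_ball ((min_le_right _ _).trans hσR.le)
    have hmaps : MapsTo (fun x => -Complex.I * Z v x) (ball 0 T) {z | z.re ≤ M} := by
      intro x hx
      have hxT := mem_ball_zero_iff.1 hx
      have hx1 := hsol.norm_lt_one (hTR hx)
      have hxσ : ‖x‖ < σ := hxT.trans_le (min_le_right _ _)
      have hx2 : ‖x ^ 2‖ < t := by
        rw [norm_pow]
        calc ‖x‖ ^ 2 < √t ^ 2 := by gcongr; exact hxT.trans_le (min_le_left _ _)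
          _ = t := Real.sq_sqrt ht0.le
      have hx2σ : ‖x ^ 2‖ ≤ σ := by
        rw [norm_pow]; nlinarith [norm_nonneg x]
      have h1 := hC v hmv hvV hsol _ hx2 hx2σ
      rw [hsol.eq x (hTR hx), norm_mul, norm_pow] at h1
      have h2 : ‖Complex.sin (Z v x)‖ ^ 2 ≤ |C| / m := by
        rw [le_div_iff₀ hm]
        calc _ ≤ ‖Complex.sin (Z v x)‖ ^ 2 * ‖v‖ := by gcongr
          _ = _ := mul_comm _ _
          _ ≤ |C| := h1.trans (le_abs_self C)
      have h3 := Real.le_sqrt_of_sq_le h2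
      have h4 := abs_im_le_norm_sin (Z v x)
      have h5 := le_abs_self (Z v x).im
      simp only [mem_ofPred_eq, neg_mul, Complex.neg_re, Complex.mul_re, Complex.I_re, zero_mul,
        Complex.I_im, one_mul, zero_sub, neg_neg]
      linarith
    have := Complex.borelCaratheodory_zero hMpos
      ((hsol.diff.mono hTR).const_mul (-Complex.I)) hmaps hTpos
      (mem_ball_zero_iff.2 (huT'.trans_lt hTT)) (by simp [hsol.map_zero])
    simp only [norm_mul, norm_neg, Complex.norm_I, one_mul] at this
    refine this.trans ?_
    have : 0 < T - T' := by linarith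
    have hT'0 : 0 ≤ T' := (norm_nonneg u).trans huT'
    gcongr
  have hall : ∀ k : ℕ, P (r₀ ^ ((3 / 4 : ℝ) ^ k)) := by
    intro k
    induction k with
    | zero => simpa using hbase
    | succ k ih =>
      have := hstep _ (by positivity) (Real.rpow_lt_one hr₀pos.le hr₀1 (by positivity)) ih
      rwa [← Real.rpow_mul hr₀pos.le, ← pow_succ] at this
  have ht : Tendsto (fun k : ℕ => r₀ ^ ((3 / 4 : ℝ) ^ k)) atTop (𝓝 (r₀ ^ (0 : ℝ))) :=
    tendsto_const_nhds.rpow (tendsto_pow_atTop_nhds_zero_of_lt_one (by norm_num) (by norm_num))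
      (Or.inl hr₀pos.ne')
  rw [Real.rpow_zero] at ht
  by_cases hs1 : s < 1
  · obtain ⟨k, hk⟩ := (ht.eventually (lt_mem_nhds hs1)).exists
    obtain ⟨C, hC⟩ := hall k s hsR
    exact ⟨C, fun v h1 h2 h3 u h4 => hC v h1 h2 h3 u (h4.trans_lt hk) h4⟩
  · exact ⟨0, fun v _ _ h3 => absurd (hsR.trans_le h3.le_one) hs1⟩

theorem exists_coeff_bound {v₀ : ℂ} (hv₀ : v₀ ≠ 0) {R s : ℝ} (hs : 0 < s) (hsR : s < R) :
    ∃ C : ℝ, ∀ᶠ v in 𝓝 v₀, IsSol v R (Z v) → ∀ n, ‖coeff v n‖ * s ^ n ≤ C := by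
  have hv0 : 0 < ‖v₀‖ := norm_pos_iff.2 hv₀
  obtain ⟨C, hC⟩ := exists_uniform_bound (m := ‖v₀‖ / 2) (V := ‖v₀‖ + 1) (by positivity)
    (by positivity) (hs.trans hsR) s hsR
  refine ⟨C, ?_⟩
  have hc : Tendsto (fun v : ℂ => ‖v‖) (𝓝 v₀) (𝓝 ‖v₀‖) := continuous_norm.tendsto _
  filter_upwards [hc.eventually (lt_mem_nhds (show ‖v₀‖ / 2 < ‖v₀‖ by linarith)),
    hc.eventually (gt_mem_nhds (show ‖v₀‖ < ‖v₀‖ + 1 by linarith))] with v h1 h2 h3 n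
  exact norm_coeff_mul_pow_le (by rw [← norm_pos_iff]; linarith) h3 hs hsR
    (hC v h1.le h2 h3) n

theorem tendsto_Z_of_coeff_bound {ι : Type*} {l : Filter ι} {v : ι → ℂ} {v₀ : ℂ} (hv₀ : v₀ ≠ 0)
    (hv : Tendsto v l (𝓝 v₀)) {s C : ℝ} (hs : 0 < s)
    (hC : ∀ᶠ i in l, ∀ n, ‖coeff (v i) n‖ * s ^ n ≤ C) {u : ι → ℂ} {u₀ : ℂ}
    (hu : Tendsto u l (𝓝 u₀)) (hu₀ : ‖u₀‖ < s) :
    Tendsto (fun i => Z (v i) (u i)) l (𝓝 (Z v₀ u₀)) := by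
  obtain ⟨r, hr1, hr2⟩ := exists_between hu₀
  have hr0 : 0 ≤ r := (norm_nonneg _).trans hr1.le
  have hq : r / s < 1 := (div_lt_one hs).2 hr2
  refine tendsto_tsum_of_dominated_convergence (bound := fun n => C * (r / s) ^ n)
    ((summable_geometric_of_lt_one (by positivity) hq).mul_left C) (fun n => ?_) ?_
  · exact ((continuousAt_coeff hv₀ n).tendsto.comp hv).mul (hu.pow n)
  · filter_upwards [hC, hu.norm.eventually (gt_mem_nhds hr1)] with i h1 h2 n
    rw [norm_mul, norm_pow]
    have h3 : ‖coeff (v i) n‖ ≤ C / s ^ n := by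
      rw [le_div_iff₀ (by positivity)]; exact h1 n
    have hC0 : 0 ≤ C := le_trans (by positivity) (h1 0)
    calc _ ≤ C / s ^ n * r ^ n := by gcongr
      _ = C * (r / s) ^ n := by rw [div_pow]; ring

/-- Limits of parameters whose inverse Böttcher map is defined on a fixed disc. -/
theorem isSol_of_tendsto {ι : Type*} {l : Filter ι} [l.NeBot] {v : ι → ℂ} {v₀ : ℂ} (hv₀ : v₀ ≠ 0)
    (hv : Tendsto v l (𝓝 v₀)) {R : ℝ} (hR : 0 < R) (hR1 : R ≤ 1)
    (h : ∀ᶠ i in l, IsSol (v i) R (Z (v i))) :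
    IsSol v₀ R (Z v₀) ∧ ∀ (u : ι → ℂ) (u₀ : ℂ), Tendsto u l (𝓝 u₀) → u₀ ∈ ball (0 : ℂ) R →
      Tendsto (fun i => Z (v i) (u i)) l (𝓝 (Z v₀ u₀)) := by
  have hb : ∀ s, 0 < s → s < R → ∃ C : ℝ, ∀ᶠ i in l, ∀ n, ‖coeff (v i) n‖ * s ^ n ≤ C := by
    intro s hs hsR
    obtain ⟨C, hC⟩ := exists_coeff_bound hv₀ hs hsR
    exact ⟨C, by filter_upwards [hv.eventually hC, h] with i h1 h2 using h1 h2⟩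
  have hbetween : ∀ u₀ ∈ ball (0 : ℂ) R, ∃ s, 0 < s ∧ s < R ∧ ‖u₀‖ < s := by
    intro u₀ hu₀
    obtain ⟨s, h1, h2⟩ := exists_between (mem_ball_zero_iff.1 hu₀)
    exact ⟨s, (norm_nonneg _).trans_lt h1, h2, h1⟩
  have hlim : ∀ (u : ι → ℂ) (u₀ : ℂ), Tendsto u l (𝓝 u₀) → u₀ ∈ ball (0 : ℂ) R →
      Tendsto (fun i => Z (v i) (u i)) l (𝓝 (Z v₀ u₀)) := by
    intro u u₀ hu hu₀
    obtain ⟨s, hs, hsR, hus⟩ := hbetween u₀ hu₀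
    obtain ⟨C, hC⟩ := hb s hs hsR
    exact tendsto_Z_of_coeff_bound hv₀ hv hs hC hu hus
  refine ⟨?_, hlim⟩
  obtain ⟨ρ, hρ, hloc⟩ := exists_uniform_isSol (V := ‖v₀‖ + 1) (by positivity)
  have hloc0 := (hloc v₀ hv₀ (by linarith)).1
  refine ⟨hR, hR1, fun u₀ hu₀ => ?_, hloc0.map_zero, hloc0.deriv_zero, fun u hu => ?_⟩
  · obtain ⟨s, hs, hsR, hus⟩ := hbetween u₀ hu₀
    obtain ⟨C, hC⟩ := hb s hs hsR
    obtain ⟨r, hr1, hr2⟩ := exists_between hus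
    have hr0 : 0 ≤ r := (norm_nonneg _).trans hr1.le
    have hC0 : ∀ n, ‖coeff v₀ n‖ * s ^ n ≤ C := fun n =>
      le_of_tendsto ((((continuousAt_coeff hv₀ n).tendsto.comp hv).norm).mul_const (s ^ n))
        (hC.mono fun i hi => hi n)
    have hd : DifferentiableOn ℂ (Z v₀) (ball 0 r) := by
      refine Complex.differentiableOn_tsum_of_summable_norm (u := fun n => C * (r / s) ^ n)
        ((summable_geometric_of_lt_one (by positivity) ((div_lt_one hs).2 hr2)).mul_left C)
        (fun n => by fun_prop) isOpen_ball fun n w hw => ?_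
      rw [norm_mul, norm_pow]
      have h3 : ‖coeff v₀ n‖ ≤ C / s ^ n := by
        rw [le_div_iff₀ (by positivity)]; exact hC0 n
      have hC0 : 0 ≤ C := le_trans (by positivity) (hC0 0)
      have hwr := (mem_ball_zero_iff.1 hw).le
      calc _ ≤ C / s ^ n * r ^ n := by gcongr
        _ = C * (r / s) ^ n := by rw [div_pow]; ring
    exact (hd.differentiableAt (isOpen_ball.mem_nhds
      (mem_ball_zero_iff.2 hr1))).differentiableWithinAt
  · have h1 := hlim (fun _ => u) u tendsto_const_nhds hu
    have h2 := hlim (fun _ => u ^ 2) (u ^ 2) tendsto_const_nhds (sq_mem_ball hR1 hu)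
    refine tendsto_nhds_unique h2 ?_
    refine (hv.mul (((Complex.continuous_sin.tendsto _).comp h1).pow 2)).congr' ?_
    filter_upwards [h] with i hi
    exact (hi.eq u hu).symm

/-- Solutions near `v₀` share a disc, and the critical value lies outside the image of the disc of
squared radius. This keeps limits of critical coordinates away from `0`. -/
theorem exists_lower_bound_isVal {v₀ : ℂ} (hv₀ : v₀ ≠ 0) :
    ∃ c > 0, ∀ᶠ v in 𝓝 v₀, ∀ w, IsVal v w → c ≤ ‖w‖ := by
  obtain ⟨ρ, hρ, hloc⟩ := exists_uniform_isSol (V := ‖v₀‖ + 1) (by positivity)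
  have hv0 : 0 < ‖v₀‖ := norm_pos_iff.2 hv₀
  refine ⟨(‖v₀‖ / 2 * ρ) ^ 2, by positivity, ?_⟩
  have hc : Tendsto (fun v : ℂ => ‖v‖) (𝓝 v₀) (𝓝 ‖v₀‖) := continuous_norm.tendsto _
  filter_upwards [hc.eventually (lt_mem_nhds (show ‖v₀‖ / 2 < ‖v₀‖ by linarith)),
    hc.eventually (gt_mem_nhds (show ‖v₀‖ < ‖v₀‖ + 1 by linarith))] with v h1 h2 w hw
  by_contra! hlt
  refine (hloc v hw.1 h2).1.Z_ne_of_mem_ball_sq hw.1 (hlt.trans_le ?_) hw.2.choose_spec.2.2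
  gcongr

/-- The graph of the critical Böttcher coordinate is closed. -/
theorem isVal_of_tendsto {ι : Type*} {l : Filter ι} [l.NeBot] {v w : ι → ℂ} {v₀ w₀ : ℂ}
    (hv₀ : v₀ ≠ 0) (hv : Tendsto v l (𝓝 v₀)) (hw : Tendsto w l (𝓝 w₀)) (hw₀ : ‖w₀‖ < 1)
    (h : ∀ᶠ i in l, IsVal (v i) (w i)) : IsVal v₀ w₀ := by
  obtain ⟨c, hc, hlow⟩ := exists_lower_bound_isVal hv₀
  have hwc : c ≤ ‖w₀‖ := by
    refine ge_of_tendsto hw.norm ?_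
    filter_upwards [hv.eventually hlow, h] with i h1 h2 using h1 _ h2
  have hw0 : w₀ ≠ 0 := by rw [← norm_pos_iff]; linarith
  -- Nearby solutions all exist on the disc of radius `s < √‖w₀‖`, which contains `w₀` in its
  -- interior.
  obtain ⟨s, hs1, hs2⟩ := exists_between (norm_lt_sqrt hw0 hw₀)
  have hs0 : 0 < s := (norm_nonneg _).trans_lt hs1
  have hs_one : s ≤ 1 := hs2.le.trans (Real.sqrt_le_one.2 hw₀.le)
  have hev : ∀ᶠ i in l, IsSol (v i) s (Z (v i)) := by
    filter_upwards [h, (hw.norm.sqrt).eventually (lt_mem_nhds hs2)] with i h1 h2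
    exact h1.isSol_sqrt.mono hs0 h2.le
  obtain ⟨h1, h2⟩ := isSol_of_tendsto hv₀ hv hs0 hs_one hev
  refine ⟨hv₀, s, h1, mem_ball_zero_iff.2 hs1, ?_⟩
  refine tendsto_nhds_unique (h2 w w₀ hw (mem_ball_zero_iff.2 hs1)) (hv.congr' ?_)
  filter_upwards [h] with i hi
  exact hi.2.choose_spec.2.2.symm

/-- Solutions persist on smaller discs under perturbation of the parameter. -/
theorem eventually_isSol {v₀ : ℂ} (hv₀ : v₀ ≠ 0) {R s : ℝ} (h : IsSol v₀ R (Z v₀)) (hs : 0 < s)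
    (hsR : s < R) : ∀ᶠ v in 𝓝 v₀, IsSol v s (Z v) := by
  by_contra hcon
  have hfreq : ∃ᶠ v in 𝓝 v₀, v ≠ 0 ∧ ¬ IsSol v s (Z v) :=
    ((not_eventually.1 hcon).and_eventually (isOpen_ne.mem_nhds hv₀)).mono fun v hv =>
      ⟨hv.2, hv.1⟩
  -- Failure on the disc of radius `s` means a critical coordinate of norm at most `s²`. A limit of
  -- these would be a critical coordinate of `v₀` of norm below `R²`, which a solution on radius `R`
  -- forbids.
  have hw : ∀ v, ∃ w : ℂ, v ≠ 0 ∧ ¬ IsSol v s (Z v) → IsVal v w ∧ ‖w‖ ≤ s ^ 2 := by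
    intro v
    by_cases hv : v ≠ 0 ∧ ¬ IsSol v s (Z v)
    · rcases exists_isVal_or_isSol_one hv.1 with ⟨w, hw⟩ | h1
      · refine ⟨w, fun _ => ⟨hw, ?_⟩⟩
        by_contra! hlt
        exact hv.2 (hw.isSol_sqrt.mono hs (Real.le_sqrt_of_sq_le hlt.le))
      · exact absurd (h1.mono hs (hsR.le.trans h.le_one)) hv.2
    · exact ⟨0, fun h => absurd h hv⟩
  choose w hw using hw
  set l := 𝓝 v₀ ⊓ 𝓟 {v | v ≠ 0 ∧ ¬ IsSol v s (Z v)}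
  have : l.NeBot := frequently_mem_iff_neBot.1 hfreq
  set U := Ultrafilter.of l
  have hUl : (U : Filter ℂ) ≤ l := Ultrafilter.of_le l
  have hmem : ∀ᶠ v in (U : Filter ℂ), v ≠ 0 ∧ ¬ IsSol v s (Z v) :=
    hUl (mem_inf_of_right (mem_principal_self _))
  have hcl : (Ultrafilter.map w U : Filter ℂ) ≤ 𝓟 (closedBall (0 : ℂ) (s ^ 2)) := by
    rw [le_principal_iff]
    exact (hmem.mono fun v hv => mem_closedBall_zero_iff.2 (hw v hv).2)
  obtain ⟨w₀, hw₀, hlim⟩ := (isCompact_closedBall (0 : ℂ) (s ^ 2)).ultrafilter_le_nhds _ hcl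
  have hs1 : s < 1 := hsR.trans_le h.le_one
  have hw₀' := mem_closedBall_zero_iff.1 hw₀
  have hval : IsVal v₀ w₀ := isVal_of_tendsto (l := (U : Filter ℂ)) (v := id) hv₀
    (hUl.trans inf_le_left) hlim (hw₀'.trans_lt (by nlinarith))
    (hmem.mono fun v hv => (hw v hv).1)
  exact h.Z_ne_of_mem_ball_sq hv₀ (hw₀'.trans_lt (by gcongr)) hval.2.choose_spec.2.2

theorem tendstoUniformlyOn_Z {v₀ : ℂ} (hv₀ : v₀ ≠ 0) {R : ℝ} (h : IsSol v₀ R (Z v₀)) :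
    TendstoLocallyUniformlyOn Z (Z v₀) (𝓝 v₀) (ball 0 R) := by
  rw [tendstoLocallyUniformlyOn_iff_forall_tendsto]
  intro u hu
  obtain ⟨s, h1, h2⟩ := exists_between (mem_ball_zero_iff.1 hu)
  have hs : 0 < s := (norm_nonneg _).trans_lt h1
  have hsol := eventually_isSol hv₀ h hs h2
  have hfst : Tendsto (fun p : ℂ × ℂ => p.1) (𝓝 v₀ ×ˢ 𝓝[ball 0 R] u) (𝓝 v₀) := tendsto_fst
  have hsnd : Tendsto (fun p : ℂ × ℂ => p.2) (𝓝 v₀ ×ˢ 𝓝[ball 0 R] u) (𝓝 u) :=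
    tendsto_snd.mono_right nhdsWithin_le_nhds
  have : (𝓝[ball 0 R] u).NeBot := mem_closure_iff_nhdsWithin_neBot.1 (subset_closure hu)
  have hA := (isSol_of_tendsto hv₀ hfst hs (h2.le.trans h.le_one)
    (hfst.eventually hsol)).2 _ u hsnd (mem_ball_zero_iff.2 h1)
  have hB : Tendsto (fun p : ℂ × ℂ => Z v₀ p.2) (𝓝 v₀ ×ˢ 𝓝[ball 0 R] u) (𝓝 (Z v₀ u)) :=
    (h.analyticAt hu).continuousAt.tendsto.comp hsnd
  exact (hB.prodMk_nhds hA).mono_right (nhds_le_uniformity _)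


/-! ### Openness of `paramA` and holomorphy of `val` -/

/-- Solutions `u` of `Z v u = τ v` persist under perturbation of `v`. -/
theorem eventually_exists_Z_eq {v₀ w₀ : ℂ} (hv₀ : v₀ ≠ 0) {R : ℝ} (h : IsSol v₀ R (Z v₀))
    (hw₀ : w₀ ∈ ball (0 : ℂ) R) {τ : ℂ → ℂ} (hτ : ContinuousAt τ v₀) (hτ₀ : τ v₀ = Z v₀ w₀)
    {ε : ℝ} (hε : 0 < ε) : ∃ s, 0 < s ∧ s < R ∧ w₀ ∈ ball (0 : ℂ) s ∧
      ∀ᶠ v in 𝓝 v₀, IsSol v s (Z v) ∧ ∃ u ∈ ball (0 : ℂ) s, dist u w₀ ≤ ε ∧ Z v u = τ v := by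
  obtain ⟨s, h1, h2⟩ := exists_between (mem_ball_zero_iff.1 hw₀)
  have hs : 0 < s := (norm_nonneg _).trans_lt h1
  set r := min ε ((s - ‖w₀‖) / 2) with hr
  have hr0 : 0 < r := lt_min hε (by linarith)
  have hrs : closedBall w₀ r ⊆ ball 0 s := by
    intro u hu
    rw [mem_closedBall, dist_eq_norm] at hu
    have h3 : r ≤ (s - ‖w₀‖) / 2 := min_le_right _ _
    have h4 : ‖u‖ ≤ ‖u - w₀‖ + ‖w₀‖ := norm_le_norm_sub_add _ _
    rw [mem_ball_zero_iff]; linarith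
  have hsol₀ := h.mono hs h2.le
  refine ⟨s, hs, h2, mem_ball_zero_iff.2 h1, ?_⟩
  have hsol := eventually_isSol hv₀ h hs h2
  have hunif : TendstoUniformlyOn (fun v u => Z v u - τ v) (fun u => Z v₀ u - τ v₀) (𝓝 v₀)
      (closedBall w₀ r) := by
    have h3 : TendstoUniformlyOn Z (Z v₀) (𝓝 v₀) (closedBall w₀ r) :=
      (tendstoLocallyUniformlyOn_iff_forall_isCompact isOpen_ball).1
        (tendstoUniformlyOn_Z hv₀ hsol₀) _ hrs (isCompact_closedBall _ _)
    have h4 : TendstoUniformlyOn (fun v (_ : ℂ) => τ v) (fun _ => τ v₀) (𝓝 v₀)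
        (closedBall w₀ r) := by
      rw [Metric.tendstoUniformlyOn_iff]
      intro δ hδ
      filter_upwards [Metric.tendsto_nhds.1 hτ.tendsto δ hδ] with v hv u _
      rw [dist_comm]; exact hv
    exact h3.sub h4
  have hroot := eventually_exists_zero hr0 hunif
    (hsol.mono fun v hv => (((hv.diff.mono hrs).sub_const _).mono
      closure_ball_subset_closedBall).diffContOnCl)
    ((hsol.and (isOpen_ne.mem_nhds hv₀)).mono fun v hv a ha b hb hab =>
      hv.1.injOn hv.2 (hrs (ball_subset_closedBall ha)) (hrs (ball_subset_closedBall hb))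
        (sub_left_inj.1 hab))
    (((hsol₀.diff.mono hrs).sub_const _).continuousOn.mono sphere_subset_closedBall)
    (by rw [hτ₀, sub_self])
    (fun z hz h0 => by
      rw [hτ₀, sub_eq_zero] at h0
      have := hsol₀.injOn hv₀ (hrs (sphere_subset_closedBall hz)) (mem_ball_zero_iff.2 h1) h0
      rw [this, mem_sphere, dist_self] at hz
      exact hr0.ne hz)
  filter_upwards [hsol, hroot] with v hv ⟨u, hu, hu0⟩
  exact ⟨hv, u, hrs hu, (mem_closedBall.1 hu).trans (min_le_left _ _), sub_eq_zero.1 hu0⟩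

/-- Parameters for which the critical value lies in the domain of a Böttcher map. -/
def paramA : Set ℂ := {v | ∃ w, IsVal v w}

/-- The Böttcher coordinate of the critical value. -/
noncomputable def val (v : ℂ) : ℂ := Classical.epsilon fun w => IsVal v w

theorem isVal_val {v : ℂ} (h : v ∈ paramA) : IsVal v (val v) := Classical.epsilon_spec h

theorem IsVal.val_eq {v w : ℂ} (h : IsVal v w) : val v = w := (isVal_val ⟨w, h⟩).unique h

theorem ne_zero_of_mem_paramA {v : ℂ} (h : v ∈ paramA) : v ≠ 0 := (isVal_val h).1

theorem eventually_isVal {v₀ : ℂ} (h : v₀ ∈ paramA) {ε : ℝ} (hε : 0 < ε) :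
    ∀ᶠ v in 𝓝 v₀, ∃ w, IsVal v w ∧ dist w (val v₀) ≤ ε := by
  obtain ⟨hv₀, R, hR, hw, hZ⟩ := isVal_val h
  obtain ⟨s, -, -, -, hev⟩ := eventually_exists_Z_eq hv₀ hR hw (τ := id) continuousAt_id hZ.symm hε
  filter_upwards [hev, isOpen_ne.mem_nhds hv₀] with v ⟨h1, u, hu, hd, hZu⟩ hv
  exact ⟨u, ⟨hv, s, h1, hu, hZu⟩, hd⟩

theorem isOpen_paramA : IsOpen paramA := by
  rw [isOpen_iff_mem_nhds]
  intro v₀ h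
  filter_upwards [eventually_isVal h one_pos] with v ⟨w, hw, _⟩ using ⟨w, hw⟩

theorem continuousAt_val {v₀ : ℂ} (h : v₀ ∈ paramA) : ContinuousAt val v₀ := by
  rw [ContinuousAt, Metric.tendsto_nhds]
  intro ε hε
  filter_upwards [eventually_isVal h (half_pos hε)] with v ⟨w, hw, hd⟩
  rw [hw.val_eq]; linarith

theorem differentiableAt_Z_param {v₀ w₀ : ℂ} (hv₀ : v₀ ≠ 0) {R : ℝ} (h : IsSol v₀ R (Z v₀))
    (hw₀ : w₀ ∈ ball (0 : ℂ) R) : DifferentiableAt ℂ (fun v => Z v w₀) v₀ := by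
  obtain ⟨s, h1, h2⟩ := exists_between (mem_ball_zero_iff.1 hw₀)
  have hs : 0 < s := (norm_nonneg _).trans_lt h1
  obtain ⟨t, h3, h4⟩ := exists_between h2
  obtain ⟨C, hC⟩ := exists_coeff_bound hv₀ hs h3
  have hsol := eventually_isSol hv₀ h (hs.trans h3) h4
  obtain ⟨U, hU, hUo, hvU⟩ := _root_.eventually_nhds_iff.1 (hC.and (hsol.and (isOpen_ne.mem_nhds hv₀)))
  have hC0 : 0 ≤ C := le_trans (by positivity) ((hU v₀ hvU).1 (hU v₀ hvU).2.1 0)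
  have := Complex.differentiableOn_tsum_of_summable_norm (F := fun n v => coeff v n * w₀ ^ n)
    (u := fun n => C * (‖w₀‖ / s) ^ n)
    ((summable_geometric_of_lt_one (by positivity) ((div_lt_one hs).2 h1)).mul_left C)
    (fun n v hv => ((differentiableAt_coeff (hU v hv).2.2 n).mul_const
      _).differentiableWithinAt) hUo fun n v hv => ?_
  · exact this.differentiableAt (hUo.mem_nhds hvU)
  · rw [norm_mul, norm_pow]
    have h5 : ‖coeff v n‖ ≤ C / s ^ n := by
      rw [le_div_iff₀ (by positivity)]; exact (hU v hv).1 (hU v hv).2.1 n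
    calc _ ≤ C / s ^ n * ‖w₀‖ ^ n := by gcongr
      _ = C * (‖w₀‖ / s) ^ n := by rw [div_pow]; ring

/-- An implicit function argument: `v - Z v w₀ = Z v (val v) - Z v w₀ = (val v - w₀) q(v)`, where
the left side is differentiable in `v` and `q` tends to the nonzero derivative of `Z v₀` at `w₀`. -/
theorem differentiableAt_val {v₀ : ℂ} (h : v₀ ∈ paramA) : DifferentiableAt ℂ val v₀ := by
  obtain ⟨hv₀, R, hR, hw, hZ⟩ := isVal_val h
  set w₀ := val v₀ with hw₀
  have hlu := tendstoUniformlyOn_Z hv₀ hR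
  obtain ⟨s, h1, h2⟩ := exists_between (mem_ball_zero_iff.1 hw)
  have hs : 0 < s := (norm_nonneg _).trans_lt h1
  have hsol₀ := hR.mono hs h2.le
  have hsol := eventually_isSol hv₀ hR hs h2
  have hderiv := (tendstoUniformlyOn_Z hv₀ hsol₀).deriv (hsol.mono fun v hv => hv.diff) isOpen_ball
  obtain ⟨r, hr, hrs⟩ := Metric.nhds_basis_closedBall.mem_iff.1
    (isOpen_ball.mem_nhds (mem_ball_zero_iff.2 h1))
  have hdu := (tendstoLocallyUniformlyOn_iff_forall_isCompact isOpen_ball).1 hderiv _ hrs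
    (isCompact_closedBall _ _)
  rw [Metric.tendstoUniformlyOn_iff] at hdu
  have hcont := continuousAt_val h
  -- the difference quotient of `Z v` between `w₀` and `val v`
  set q : ℂ → ℂ := fun v => dslope (Z v) w₀ (val v) with hq
  have hD : DifferentiableAt ℂ (Z v₀) w₀ := (hR.analyticAt hw).differentiableAt
  have hqlim : Tendsto q (𝓝 v₀) (𝓝 (deriv (Z v₀) w₀)) := by
    have hA : Tendsto (fun v => dslope (Z v₀) w₀ (val v)) (𝓝 v₀) (𝓝 (deriv (Z v₀) w₀)) := by
      have h3 := (continuousAt_dslope_same.2 hD).tendsto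
      rw [dslope_same] at h3
      exact h3.comp hcont
    have hB : Tendsto (fun v => q v - dslope (Z v₀) w₀ (val v)) (𝓝 v₀) (𝓝 0) := by
      rw [Metric.tendsto_nhds]
      intro ε hε
      filter_upwards [hdu (ε / 2) (half_pos hε), hsol,
        hcont.eventually_mem (closedBall_mem_nhds _ hr)] with v hv1 hv2 hv3
      rw [dist_zero_right]
      refine lt_of_le_of_lt ?_ (half_lt_self hε)
      have hw₀r : w₀ ∈ closedBall w₀ r := mem_closedBall_self hr.le
      have hdv : ∀ x ∈ closedBall w₀ r, DifferentiableAt ℂ (Z v) x := fun x hx =>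
        (hv2.analyticAt (hrs hx)).differentiableAt
      have hdv₀ : ∀ x ∈ closedBall w₀ r, DifferentiableAt ℂ (Z v₀) x := fun x hx =>
        (hsol₀.analyticAt (hrs hx)).differentiableAt
      have hbd : ∀ x ∈ closedBall w₀ r, ‖deriv (fun x => Z v x - Z v₀ x) x‖ ≤ ε / 2 := by
        intro x hx
        rw [deriv_fun_sub (hdv x hx) (hdv₀ x hx), ← dist_eq_norm, dist_comm]
        exact (hv1 x hx).le
      by_cases hne : val v = w₀
      · simp only [hq, hne, dslope_same]
        rw [← deriv_fun_sub (hdv _ hw₀r) (hdv₀ _ hw₀r)]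
        exact hbd _ hw₀r
      · simp only [hq]
        rw [dslope_of_ne _ hne, dslope_of_ne _ hne, slope_def_field, slope_def_field, ← sub_div,
          norm_div, div_le_iff₀ (norm_pos_iff.2 (sub_ne_zero.2 hne))]
        have := (convex_closedBall w₀ r).norm_image_sub_le_of_norm_deriv_le
          (f := fun x => Z v x - Z v₀ x) (fun x hx => (hdv x hx).fun_sub (hdv₀ x hx)) hbd hw₀r hv3
        refine le_trans (le_of_eq ?_) this
        congr 1; ring
    simpa using hB.add hA
  have hD0 : deriv (Z v₀) w₀ ≠ 0 := hR.deriv_ne_zero hv₀ hw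
  set E : ℂ → ℂ := fun v => v - Z v w₀ with hE
  have hEd : DifferentiableAt ℂ E v₀ := differentiableAt_id.sub (differentiableAt_Z_param hv₀ hR hw)
  have hE0 : E v₀ = 0 := by simp [hE, hZ]
  have hkey : ∀ᶠ v in 𝓝 v₀, val v - w₀ = E v * (q v)⁻¹ := by
    filter_upwards [hqlim.eventually_ne hD0, isOpen_paramA.mem_nhds h] with v hqv hvA
    rw [eq_mul_inv_iff_mul_eq₀ hqv]
    have h3 := sub_smul_dslope (Z v) w₀ (val v)
    rw [smul_eq_mul] at h3
    rw [hq, h3, (isVal_val hvA).2.choose_spec.2.2]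
  have hder : HasDerivAt val (deriv E v₀ * (deriv (Z v₀) w₀)⁻¹) v₀ := by
    rw [hasDerivAt_iff_tendsto_slope]
    have h3 := (hasDerivAt_iff_tendsto_slope.1 hEd.hasDerivAt).mul
      ((hqlim.inv₀ hD0).mono_left nhdsWithin_le_nhds)
    refine h3.congr' ?_
    filter_upwards [hkey.filter_mono nhdsWithin_le_nhds] with v hv
    rw [slope_def_field, slope_def_field, hE0, sub_zero, hv]; ring
  exact hder.differentiableAt

/-! ### Large and small parameters -/

/-- The inverse Böttcher map is bounded for large parameters. -/
theorem norm_Z_le_two {v : ℂ} (hv : 8 ≤ ‖v‖) {R : ℝ} (h : IsSol v R (Z v)) {u : ℂ}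
    (hu : u ∈ ball (0 : ℂ) R) : ‖Z v u‖ ≤ 2 := by
  have hv0 : v ≠ 0 := by rw [← norm_pos_iff]; linarith
  have hcont := (h.analyticAt (mem_ball_self h.pos)).continuousAt
  have hsmall : ∀ᶠ x in 𝓝 (0 : ℂ), ‖Z v x‖ < 2 := by
    refine hcont.norm.eventually_lt continuousAt_const ?_
    rw [h.map_zero]; simp
  obtain ⟨r, hr, hrb⟩ := Metric.mem_nhds_iff.1 hsmall
  -- one step of the bootstrap
  have hstep : ∀ t : ℝ, 0 < t → (∀ x ∈ ball (0 : ℂ) R, ‖x‖ < t → ‖Z v x‖ ≤ 2) →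
      ∀ x ∈ ball (0 : ℂ) R, ‖x‖ < √t → ‖Z v x‖ ≤ 2 := by
    intro t ht hb x hx hxt
    set T := min (√t) R
    have hTR : ball (0 : ℂ) T ⊆ ball 0 R := ball_subset_ball (min_le_right _ _)
    -- From `‖v sin²‖ ≤ 2` and `‖v‖ ≥ 8`.
    have hsin : ∀ y ∈ ball (0 : ℂ) T, ‖Complex.sin (Z v y)‖ ≤ 1 / 2 := by
      intro y hy
      have hy' := mem_ball_zero_iff.1 hy
      have hyR := hTR hy
      have h1 := hb (y ^ 2) (sq_mem_ball h.le_one hyR) (by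
        rw [norm_pow]
        calc ‖y‖ ^ 2 < √t ^ 2 := by gcongr; exact hy'.trans_le (min_le_left _ _)
          _ = t := Real.sq_sqrt ht.le)
      rw [h.eq y hyR, norm_mul, norm_pow] at h1
      have h2 : ‖Complex.sin (Z v y)‖ ^ 2 ≤ (1 / 2) ^ 2 := by nlinarith [sq_nonneg ‖Complex.sin (Z v y)‖]
      exact le_of_sq_le_sq h2 (by norm_num)
    -- The real part starts at `0` and cannot cross `±π/2`, where its sine would be `±1`. With the
    -- imaginary part at most `1/2` this recovers the bound `2`.
    have hpre : IsPreconnected ((fun y => (Z v y).re) '' ball (0 : ℂ) T) :=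
      (convex_ball _ _).isPreconnected.image _
        (Complex.continuous_re.comp_continuousOn (h.diff.mono hTR).continuousOn)
    have h0T : (0 : ℝ) ∈ (fun y => (Z v y).re) '' ball (0 : ℂ) T :=
      ⟨0, mem_ball_self (lt_min (Real.sqrt_pos.2 ht) h.pos), by simp [h.map_zero]⟩
    have hxT : x ∈ ball (0 : ℂ) T := mem_ball_zero_iff.2 (lt_min hxt (mem_ball_zero_iff.1 hx))
    have hno : ∀ y ∈ ball (0 : ℂ) T, |Real.sin (Z v y).re| ≤ 1 / 2 := fun y hy =>
      (abs_sin_re_le_norm_sin _).trans (hsin y hy)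
    have hre : |(Z v x).re| < Real.pi / 2 := by
      by_contra! hge
      have hpi := Real.pi_pos
      rcases le_abs.1 hge with h1 | h1
      · obtain ⟨y, hy, hye⟩ := hpre.ordConnected.out h0T ⟨x, hxT, rfl⟩
          (show Real.pi / 2 ∈ Icc 0 (Z v x).re from ⟨by positivity, h1⟩)
        have h2 := hno y hy
        have hye : (Z v y).re = Real.pi / 2 := hye
        rw [hye, Real.sin_pi_div_two] at h2
        norm_num at h2
      · obtain ⟨y, hy, hye⟩ := hpre.ordConnected.out ⟨x, hxT, rfl⟩ h0T
          (show -(Real.pi / 2) ∈ Icc (Z v x).re 0 from ⟨by linarith, by linarith⟩)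
        have h2 := hno y hy
        have hye : (Z v y).re = -(Real.pi / 2) := hye
        rw [hye, Real.sin_neg, Real.sin_pi_div_two] at h2
        norm_num at h2
    have him : |(Z v x).im| ≤ 1 / 2 := (abs_im_le_norm_sin _).trans (hsin x hxT)
    have hsq : ‖Z v x‖ ^ 2 ≤ 2 ^ 2 := by
      rw [Complex.sq_norm, Complex.normSq_apply, ← pow_two, ← pow_two, ← sq_abs (Z v x).re,
        ← sq_abs (Z v x).im]
      have := Real.pi_lt_d2
      have h3 : |(Z v x).re| < 1.575 := by linarith
      nlinarith [abs_nonneg (Z v x).re, abs_nonneg (Z v x).im]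
    exact le_of_sq_le_sq hsq (by norm_num)
  have hall : ∀ k : ℕ, ∀ x ∈ ball (0 : ℂ) R, ‖x ^ 2 ^ k‖ < r → ‖Z v x‖ ≤ 2 := by
    have hk : ∀ k : ℕ, ∃ t : ℝ, 0 < t ∧ t ^ 2 ^ k = r ∧
        ∀ x ∈ ball (0 : ℂ) R, ‖x‖ < t → ‖Z v x‖ ≤ 2 := by
      intro k
      induction k with
      | zero => exact ⟨r, hr, by simp, fun x _ hx => (hrb (mem_ball_zero_iff.2 hx)).le⟩
      | succ k ih =>
        obtain ⟨t, ht, htr, hb⟩ := ih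
        refine ⟨√t, Real.sqrt_pos.2 ht, ?_, hstep t ht hb⟩
        rw [pow_succ', pow_mul, Real.sq_sqrt ht.le, htr]
    intro k x hx hxr
    obtain ⟨t, ht, htr, hb⟩ := hk k
    refine hb x hx ?_
    rw [norm_pow, ← htr] at hxr
    exact lt_of_pow_lt_pow_left₀ _ ht.le hxr
  obtain ⟨k, hk⟩ := ((tendsto_pow_two_pow (h.norm_lt_one hu)).eventually
    (ball_mem_nhds 0 hr)).exists
  exact hall k u hu (mem_ball_zero_iff.1 hk)

theorem norm_lt_eight {v : ℂ} (h : v ∈ paramA) : ‖v‖ < 8 := by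
  by_contra! hge
  obtain ⟨-, R, hR, hw, hZ⟩ := isVal_val h
  have := norm_Z_le_two hge hR hw
  rw [hZ] at this
  linarith

theorem neg_mem_paramA {v : ℂ} (h : v ∈ paramA) : -v ∈ paramA ∧ val (-v) = val v :=
  ⟨⟨_, (isVal_val h).neg⟩, (isVal_val h).neg.val_eq⟩

/-- Small parameters belong to `paramA`, and the critical Böttcher coordinate is asymptotic
to `v²`. -/
theorem exists_small_param : ∃ δ K : ℝ, 0 < δ ∧ 0 < K ∧ ∀ v : ℂ, v ≠ 0 → ‖v‖ < δ →
    v ∈ paramA ∧ ‖val v - v ^ 2‖ ≤ K * ‖v‖ ^ 3 := by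
  obtain ⟨ρ, K, hρ, hVρ, hK, η, -, hη⟩ := exists_local_family (V := 1) one_pos
  set δ := min 1 (min (ρ / 4) (1 / (16 * K))) with hδ
  refine ⟨δ, 16 * K, by positivity, by positivity, fun v hv hvδ => ?_⟩
  have hvn : 0 < ‖v‖ := norm_pos_iff.2 hv
  have hv1 : ‖v‖ < 1 := hvδ.trans_le (min_le_left _ _)
  have hvρ : 4 * ‖v‖ < ρ := by
    have := hvδ.trans_le ((min_le_right _ _).trans (min_le_left _ _)); linarith
  have hvK : 16 * K * ‖v‖ ≤ 1 := by
    have := (hvδ.trans_le ((min_le_right _ _).trans (min_le_right _ _))).le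
    rw [le_div_iff₀ (by positivity)] at this; linarith
  obtain ⟨hd, hη1, hη2⟩ := hη v (mem_ball_zero_iff.2 hv1)
  obtain ⟨hη0, hηd⟩ := hasDerivAt_one_of_norm_sub_le hρ hη1
  have hcb : closedBall (0 : ℂ) (4 * ‖v‖) ⊆ ball 0 ρ := closedBall_subset_ball hvρ
  -- On the circle of radius `4‖v‖` the choice of `δ` gives `‖η v t‖ ≥ 4‖v‖ - 16K‖v‖² ≥ 3‖v‖`, so
  -- the value `v` is taken inside. The corresponding critical coordinate is `v * t`, with `t` close
  -- to `v`.
  have himg := DiffContOnCl.ball_subset_image_closedBall (f := η v) (z₀ := 0) (r := 4 * ‖v‖)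
    (ε := 3 * ‖v‖)
    ((hd.mono hcb).mono closure_ball_subset_closedBall).diffContOnCl (by positivity)
    (fun t ht => by
      have ht' := mem_sphere_zero_iff_norm.1 ht
      have h1 := hη1 t (hcb (sphere_subset_closedBall ht))
      rw [ht'] at h1
      have h2 : ‖t‖ ≤ ‖η v t - t‖ + ‖η v t‖ := by
        rw [norm_sub_rev]; exact norm_le_norm_sub_add _ _
      rw [hη0, sub_zero]
      nlinarith)
    ((hηd.eventually_ne one_ne_zero).frequently.filter_mono nhdsWithin_le_nhds)
  obtain ⟨t, ht, htv⟩ := himg (show v ∈ ball (η v 0) (3 * ‖v‖ / 2) by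
    rw [hη0, mem_ball_zero_iff]; linarith)
  have hsol := isSol_of_local_family hv hρ hVρ hv1 hd hη1 hη2
  have htn := mem_closedBall_zero_iff.1 ht
  have hmem : v * t ∈ ball (0 : ℂ) (‖v‖ * ρ) := by
    rw [mem_ball_zero_iff, norm_mul]; gcongr; linarith
  have hval : IsVal v (v * t) := by
    refine ⟨hv, _, hsol.isSol_Z hv, hmem, ?_⟩
    rw [hsol.eqOn_Z hv hmem]
    beta_reduce
    rw [mul_div_cancel_left₀ _ hv, htv]
  refine ⟨⟨_, hval⟩, ?_⟩
  rw [hval.val_eq]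
  have h1 := hη1 t (hcb ht)
  rw [htv] at h1
  calc ‖v * t - v ^ 2‖ = ‖v‖ * ‖v - t‖ := by
        rw [← norm_mul, ← norm_neg]; congr 1; ring
    _ ≤ ‖v‖ * (K * (4 * ‖v‖) ^ 2) := by gcongr; exact h1.trans (by gcongr)
    _ = _ := by ring


/-! ### Translation to Böttcher maps and the immediate basin -/

theorem f_neg_two_mul (v x : ℂ) : f v (-2 * x) = -2 * (v * Complex.sin x ^ 2) := by
  rw [f, show -2 * x = -(2 * x) by ring, Complex.cos_neg, Complex.cos_two_mul]
  linear_combination 2 * v * Complex.sin_sq_add_cos_sq x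

theorem differentiable_f (v : ℂ) : Differentiable ℂ (f v) := by
  unfold f; fun_prop

theorem f_zero (v : ℂ) : f v 0 = 0 := by simp [f]

theorem deriv_ne_zero_of_injOn {φ : ℂ → ℂ} {U : Set ℂ} (hU : IsOpen U)
    (hd : DifferentiableOn ℂ φ U) (hinj : InjOn φ U) {z : ℂ} (hz : z ∈ U) : deriv φ z ≠ 0 := by
  intro h0
  have hne : ¬ ∀ᶠ x in 𝓝 z, φ x = φ z := by
    intro h
    have h1 : ∀ᶠ x in 𝓝 z, x = z := by
      filter_upwards [h, hU.mem_nhds hz] with x hx hxU using hinj hxU hz hx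
    have h2 : ∀ᶠ x in 𝓝[≠] z, False := by
      filter_upwards [h1.filter_mono nhdsWithin_le_nhds, self_mem_nhdsWithin] with x hx hx'
        using hx' hx
    exact h2.exists.choose_spec
  obtain ⟨w, x, hx, y, hy, hxy, h1, h2⟩ :=
    (exists_two_preimages (hd.analyticAt (hU.mem_nhds hz)) hne h0 (hU.mem_nhds hz)).exists
  exact hxy (hinj hx hy (h1.trans h2.symm))

/-- The inverse of an injective holomorphic function is holomorphic. -/
theorem hasDerivAt_invFunOn {φ : ℂ → ℂ} {U : Set ℂ} (hU : IsOpen U)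
    (hd : DifferentiableOn ℂ φ U) (hinj : InjOn φ U) {z : ℂ} (hz : z ∈ U) :
    HasDerivAt (Function.invFunOn φ U) (deriv φ z)⁻¹ (φ z) := by
  have hs : HasStrictDerivAt φ (deriv φ z) z :=
    (hd.analyticAt (hU.mem_nhds hz)).hasStrictDerivAt
  refine (hs.to_local_left_inverse (deriv_ne_zero_of_injOn hU hd hinj hz) ?_).hasDerivAt
  filter_upwards [hU.mem_nhds hz] with x hx using hinj.leftInvOn_invFunOn hx

theorem isOpen_image_of_injOn {φ : ℂ → ℂ} {U : Set ℂ} (hU : IsOpen U)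
    (hd : DifferentiableOn ℂ φ U) (hinj : InjOn φ U) : IsOpen (φ '' U) := by
  rw [isOpen_iff_mem_nhds]
  rintro _ ⟨z, hz, rfl⟩
  exact (local_inverse (hd.analyticAt (hU.mem_nhds hz))
    (deriv_ne_zero_of_injOn hU hd hinj hz)).1 U (hU.mem_nhds hz)

/-- The domain of the Böttcher map with image the disc of radius `R`. -/
def domainU (v : ℂ) (R : ℝ) : Set ℂ := (fun u => -2 * Z v u) '' ball (0 : ℂ) R

namespace IsSol
variable {v : ℂ} {R : ℝ}

theorem injOn_neg_two (hv : v ≠ 0) (h : IsSol v R (Z v)) :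
    InjOn (fun u => -2 * Z v u) (ball (0 : ℂ) R) := fun a ha b hb hab =>
  h.injOn hv ha hb (mul_left_cancel₀ (by norm_num) hab)

theorem differentiableOn_neg_two (h : IsSol v R (Z v)) :
    DifferentiableOn ℂ (fun u => -2 * Z v u) (ball (0 : ℂ) R) := h.diff.const_mul _

theorem f_neg_two (h : IsSol v R (Z v)) {u : ℂ} (hu : u ∈ ball (0 : ℂ) R) :
    f v (-2 * Z v u) = -2 * Z v (u ^ 2) := by rw [f_neg_two_mul, h.eq u hu]

theorem f_iterate (h : IsSol v R (Z v)) {u : ℂ} (hu : u ∈ ball (0 : ℂ) R) (k : ℕ) :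
    (f v)^[k] (-2 * Z v u) = -2 * Z v (u ^ 2 ^ k) := by
  induction k with
  | zero => simp
  | succ k ih =>
    rw [Function.iterate_succ_apply', ih, h.f_neg_two (pow_two_pow_mem_ball h.le_one hu k),
      ← pow_mul, ← pow_succ]

theorem isBottcherMap (hv : v ≠ 0) (h : IsSol v R (Z v)) : IsBottcherMap v (domainU v R) R
    (Function.invFunOn (fun u => -2 * Z v u) (ball (0 : ℂ) R)) := by
  have hinj := h.injOn_neg_two hv
  have hleft := hinj.leftInvOn_invFunOn
  have hmaps : MapsTo (Function.invFunOn (fun u => -2 * Z v u) (ball (0 : ℂ) R)) (domainU v R)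
      (ball 0 R) := by
    rintro _ ⟨u, hu, rfl⟩
    rw [hleft hu]; exact hu
  refine ⟨isOpen_image_of_injOn isOpen_ball h.differentiableOn_neg_two hinj,
    ⟨0, mem_ball_self h.pos, by simp [h.map_zero]⟩, h.pos, ?_, ?_, ?_, ?_, ?_⟩
  · rintro _ ⟨u, hu, rfl⟩
    exact ⟨u ^ 2, sq_mem_ball h.le_one hu, (h.f_neg_two hu).symm⟩
  · rintro _ ⟨u, hu, rfl⟩
    exact (hasDerivAt_invFunOn isOpen_ball h.differentiableOn_neg_two hinj
      hu).differentiableAt.differentiableWithinAt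
  · refine InvOn.bijOn (f' := fun u => -2 * Z v u) ⟨?_, hleft⟩ hmaps (mapsTo_image _ _)
    rintro _ ⟨u, hu, rfl⟩
    beta_reduce
    rw [hleft hu]
  · have := hleft (mem_ball_self h.pos)
    simpa [h.map_zero] using this
  · rintro _ ⟨u, hu, rfl⟩
    beta_reduce
    rw [h.f_neg_two hu, hleft hu]
    exact hleft (sq_mem_ball h.le_one hu)

end IsSol

theorem IsVal.isBottcherValue {v w : ℂ} (h : IsVal v w) : IsBottcherValue v w := by
  obtain ⟨hv, R, hR, hw, hZ⟩ := h
  refine ⟨_, R, _, hR.isBottcherMap hv, ⟨w, hw, by beta_reduce; rw [hZ]⟩, ?_⟩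
  have := (hR.injOn_neg_two hv).leftInvOn_invFunOn hw
  rwa [hZ] at this

/-- For the inverse `ψ` of any Böttcher map, `-ψ/2` is a solution: the image disc is preserved by
squaring, so `r ≤ 1`, and comparing the `u²` terms gives `c = v c²`, so `c = v⁻¹`. Thus `Φ₀` does
not depend on the Böttcher map. -/
theorem IsBottcherValue.isVal {v w : ℂ} (hv : v ≠ 0) (h : IsBottcherValue v w) : IsVal v w := by
  obtain ⟨U, r, φ, hφ, hvU, hw⟩ := h
  have hinj := hφ.bijOn.injOn
  have hleft := hinj.leftInvOn_invFunOn
  set ψ := Function.invFunOn φ U with hψ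
  have hψd : ∀ u ∈ ball (0 : ℂ) r, ∃ z ∈ U, φ z = u ∧ ψ u = z ∧
      HasDerivAt ψ (deriv φ z)⁻¹ u := by
    intro u hu
    obtain ⟨z, hz, rfl⟩ := hφ.bijOn.surjOn hu
    exact ⟨z, hz, rfl, hleft hz, hasDerivAt_invFunOn hφ.isOpen hφ.differentiableOn hinj hz⟩
  have hsq : ∀ u ∈ ball (0 : ℂ) r, u ^ 2 ∈ ball (0 : ℂ) r ∧ ψ (u ^ 2) = f v (ψ u) := by
    intro u hu
    obtain ⟨z, hz, hzu, hψu, -⟩ := hψd u hu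
    have h1 := hφ.conj z hz
    have h2 := hφ.mapsTo hz
    rw [hzu] at h1
    refine ⟨h1 ▸ hφ.bijOn.mapsTo h2, ?_⟩
    rw [hψu, ← h1]; exact hleft h2
  have hr1 : r ≤ 1 := by
    by_contra! hlt
    have h1 : ((√r : ℝ) : ℂ) ∈ ball (0 : ℂ) r := by
      rw [mem_ball_zero_iff, Complex.norm_real, Real.norm_of_nonneg (Real.sqrt_nonneg _),
        Real.sqrt_lt' hφ.radius_pos]
      nlinarith
    have h2 := (hsq _ h1).1
    rw [mem_ball_zero_iff, norm_pow, Complex.norm_real, Real.norm_of_nonneg (Real.sqrt_nonneg _),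
      Real.sq_sqrt hφ.radius_pos.le] at h2
    exact lt_irrefl _ h2
  have h0 := mem_ball_self (x := (0 : ℂ)) hφ.radius_pos
  have hψ0 : ψ 0 = 0 := by
    have := hleft hφ.zero_mem
    rwa [hφ.map_zero] at this
  set ζ : ℂ → ℂ := fun u => -(ψ u) / 2 with hζ
  have hψζ : ∀ u, ψ u = -2 * ζ u := fun u => by simp only [hζ]; ring
  have hζeq : ∀ u ∈ ball (0 : ℂ) r, ζ (u ^ 2) = v * Complex.sin (ζ u) ^ 2 := by
    intro u hu
    have := (hsq u hu).2
    rw [hψζ u, f_neg_two_mul, hψζ] at this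
    exact mul_left_cancel₀ (by norm_num) this
  have hζ0 : ζ 0 = 0 := by simp [hζ, hψ0]
  obtain ⟨z₀, hz₀, -, -, hder⟩ := hψd 0 h0
  set c : ℂ := -(deriv φ z₀)⁻¹ / 2 with hc
  have hc0 : c ≠ 0 := by
    have := deriv_ne_zero_of_injOn hφ.isOpen hφ.differentiableOn hinj hz₀
    simp [hc, this]
  have hζd : HasDerivAt ζ c 0 := hder.fun_neg.div_const 2
  have hcv : c = v⁻¹ := by
    have h1 : Tendsto (fun u : ℂ => ζ u / u) (𝓝[≠] 0) (𝓝 c) := by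
      have := hasDerivAt_iff_tendsto_slope.1 hζd
      refine this.congr fun u => ?_
      rw [slope_def_field, hζ0, sub_zero, sub_zero]
    have h2 : Tendsto (fun u : ℂ => Complex.sin (ζ u) / u) (𝓝[≠] 0) (𝓝 c) := by
      have h3 := hζd.csin
      rw [hζ0, Complex.cos_zero, one_mul] at h3
      have := hasDerivAt_iff_tendsto_slope.1 h3
      refine this.congr fun u => ?_
      rw [slope_def_field, hζ0, sub_zero, Complex.sin_zero, sub_zero]
    have hpow : Tendsto (fun u : ℂ => u ^ 2) (𝓝[≠] 0) (𝓝[≠] 0) := by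
      refine tendsto_nhdsWithin_of_tendsto_nhds_of_eventually_within _ ?_ ?_
      · have : Continuous fun u : ℂ => u ^ 2 := by fun_prop
        simpa using (this.tendsto 0).mono_left nhdsWithin_le_nhds
      · filter_upwards [self_mem_nhdsWithin] with u hu using pow_ne_zero 2 hu
    have h4 := h1.comp hpow
    have h5 := (h2.pow 2).const_mul v
    have h6 : c = v * c ^ 2 := by
      refine tendsto_nhds_unique h4 (h5.congr' ?_)
      filter_upwards [mem_nhdsWithin_of_mem_nhds (isOpen_ball.mem_nhds h0)] with u hu
      simp only [Function.comp_apply]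
      rw [hζeq u hu]; ring
    refine eq_inv_of_mul_eq_one_left ?_
    apply mul_left_cancel₀ hc0
    linear_combination -h6
  have hsol : IsSol v r ζ := ⟨hφ.radius_pos, hr1, fun u hu => by
      obtain ⟨z, -, -, -, hd⟩ := hψd u hu
      exact (hd.fun_neg.div_const 2).differentiableAt.differentiableWithinAt, hζ0,
    hcv ▸ hζd.deriv, hζeq⟩
  have hwr : w ∈ ball (0 : ℂ) r := hw ▸ hφ.bijOn.mapsTo hvU
  refine ⟨hv, r, hsol.isSol_Z hv, hwr, ?_⟩
  rw [hsol.eqOn_Z hv hwr, hζ]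
  have : ψ w = -2 * v := by rw [← hw]; exact hleft hvU
  beta_reduce
  rw [this]; ring

theorem Phi0_eq_val {v : ℂ} (h : v ∈ paramA) : Phi0 v = val v := by
  have hex : ∃ w, IsBottcherValue v w := ⟨_, (isVal_val h).isBottcherValue⟩
  rw [Phi0, dif_pos hex]
  exact ((hex.choose_spec.isVal (ne_zero_of_mem_paramA h)).val_eq).symm

theorem IsSol.tendstoLocallyUniformlyOn_iterate {v : ℂ} {R : ℝ} (h : IsSol v R (Z v))
    (hv : v ≠ 0) :
    TendstoLocallyUniformlyOn (fun n => (f v)^[n]) (fun _ => 0) atTop (domainU v R) := by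
  rw [Metric.tendstoLocallyUniformlyOn_iff]
  rintro ε hε _ ⟨u₀, hu₀, rfl⟩
  obtain ⟨s, h1, h2⟩ := exists_between (mem_ball_zero_iff.1 hu₀)
  have hs : 0 < s := (norm_nonneg _).trans_lt h1
  have hsol := h.mono hs h2.le
  refine ⟨domainU v s, mem_nhdsWithin_of_mem_nhds ((hsol.isBottcherMap hv).isOpen.mem_nhds
    ⟨u₀, mem_ball_zero_iff.2 h1, rfl⟩), ?_⟩
  have hc : ContinuousAt (fun u => -2 * Z v u) 0 :=
    (h.differentiableOn_neg_two.differentiableAt (ball_mem_nhds 0 h.pos)).continuousAt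
  have hsmall : ∀ᶠ u in 𝓝 (0 : ℂ), ‖-2 * Z v u‖ < ε :=
    hc.norm.eventually_lt continuousAt_const (by simpa [h.map_zero] using hε)
  obtain ⟨δ, hδ, hδb⟩ := Metric.mem_nhds_iff.1 hsmall
  have hs1 : s < 1 := h2.trans_le h.le_one
  have ht : Tendsto (fun n : ℕ => s ^ 2 ^ n) atTop (𝓝 0) :=
    (tendsto_pow_atTop_nhds_zero_of_lt_one hs.le hs1).comp
      (tendsto_pow_atTop_atTop_of_one_lt one_lt_two)
  filter_upwards [ht.eventually (gt_mem_nhds hδ)] with n hn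
  rintro _ ⟨u, hu, rfl⟩
  rw [dist_zero_left, hsol.f_iterate hu]
  refine hδb (mem_ball_zero_iff.2 (lt_of_le_of_lt ?_ hn))
  rw [norm_pow]
  exact pow_le_pow_left₀ (norm_nonneg _) (mem_ball_zero_iff.1 hu).le _

theorem IsSol.domainU_subset_B {v : ℂ} {R : ℝ} (h : IsSol v R (Z v)) (hv : v ≠ 0) :
    domainU v R ⊆ B v := by
  have hb := h.isBottcherMap hv
  refine IsPreconnected.subset_connectedComponentIn ?_ hb.zero_mem fun z hz => ?_
  · exact (convex_ball _ _).isPreconnected.image _ h.differentiableOn_neg_two.continuousOn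
  · refine ⟨_, hb.isOpen, hz, fun s hs => ⟨id, strictMono_id, Or.inl ⟨fun _ => 0, ?_⟩⟩⟩
    have := h.tendstoLocallyUniformlyOn_iterate hv
    intro U hU x hx
    obtain ⟨t, ht, hev⟩ := this U hU x hx
    exact ⟨t, ht, hs.tendsto_atTop.eventually hev⟩

/-- If the inverse Böttcher map is defined on the unit disc, its image is the immediate basin. -/
theorem IsSol.B_subset_domainU {v : ℂ} (h : IsSol v 1 (Z v)) (hv : v ≠ 0) :
    B v ⊆ domainU v 1 := by
  have hb := h.isBottcherMap hv
  set U := domainU v 1 with hU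
  set φ := Function.invFunOn (fun u => -2 * Z v u) (ball (0 : ℂ) 1) with hφ
  -- Approximate `z` from `U`. The Böttcher coordinates cluster at some `u` with `u² = φ (f v z)`,
  -- so `‖u‖ < 1` and `z = -2 Z v u`. This is where radius `1` is needed.
  have hback : ∀ z ∈ closure U, f v z ∈ U → z ∈ U := by
    intro z hz hfz
    have hne : (𝓝 z ⊓ 𝓟 U).NeBot := mem_closure_iff_nhdsWithin_neBot.1 hz
    set W := Ultrafilter.of (𝓝 z ⊓ 𝓟 U)
    have hW : (W : Filter ℂ) ≤ 𝓝 z ⊓ 𝓟 U := Ultrafilter.of_le _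
    have hWU : ∀ᶠ x in (W : Filter ℂ), x ∈ U := hW (mem_inf_of_right (mem_principal_self _))
    have hWz : Tendsto id (W : Filter ℂ) (𝓝 z) := hW.trans inf_le_left
    have hcl : (Ultrafilter.map φ W : Filter ℂ) ≤ 𝓟 (closedBall (0 : ℂ) 1) := by
      rw [le_principal_iff]
      exact hWU.mono fun x hx => ball_subset_closedBall (hb.bijOn.mapsTo hx)
    obtain ⟨u, -, hlim⟩ := (isCompact_closedBall (0 : ℂ) 1).ultrafilter_le_nhds _ hcl
    have hlim : Tendsto φ (W : Filter ℂ) (𝓝 u) := hlim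
    have h1 : Tendsto (fun x => φ (f v x)) (W : Filter ℂ) (𝓝 (φ (f v z))) :=
      ((hb.differentiableOn.differentiableAt (hb.isOpen.mem_nhds hfz)).continuousAt.tendsto.comp
        ((differentiable_f v).continuous.tendsto z)).comp hWz
    have h2 : u ^ 2 = φ (f v z) :=
      tendsto_nhds_unique ((hlim.pow 2).congr' (hWU.mono fun x hx => (hb.conj x hx).symm)) h1
    have hu : u ∈ ball (0 : ℂ) 1 := by
      have h3 := hb.bijOn.mapsTo hfz
      rw [← h2, mem_ball_zero_iff, norm_pow] at h3
      rw [mem_ball_zero_iff]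
      by_contra! hge
      nlinarith
    refine ⟨u, hu, ?_⟩
    have h4 : Tendsto (fun x => -2 * Z v (φ x)) (W : Filter ℂ) (𝓝 (-2 * Z v u)) :=
      (h.differentiableOn_neg_two.differentiableAt
        (isOpen_ball.mem_nhds hu)).continuousAt.tendsto.comp hlim
    refine tendsto_nhds_unique (h4.congr' (hWU.mono ?_)) hWz
    rintro _ ⟨y, hy, rfl⟩
    beta_reduce
    rw [hφ, (h.injOn_neg_two hv).leftInvOn_invFunOn hy]; rfl
  have hback_iter : ∀ n : ℕ, ∀ z ∈ closure U, (f v)^[n] z ∈ U → z ∈ U := by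
    intro n
    induction n with
    | zero => intro z _ hz; exact hz
    | succ n ih =>
      intro z hz hn
      exact hback z hz (ih _ (hb.mapsTo.closure (differentiable_f v).continuous hz) hn)
  have h0F : (0 : ℂ) ∈ B v := h.domainU_subset_B hv hb.zero_mem
  refine isPreconnected_connectedComponentIn.subset_of_closure_inter_subset hb.isOpen
    ⟨0, h0F, hb.zero_mem⟩ ?_
  rintro z ⟨hzc, hzB⟩
  obtain ⟨N, hNo, hzN, hN⟩ := connectedComponentIn_subset _ _ hzB
  obtain ⟨ε, hε, hεN⟩ := Metric.isOpen_iff.1 hNo z hzN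
  obtain ⟨p, hpb, hpU⟩ := mem_closure_iff.1 hzc _ isOpen_ball (mem_ball_self hε)
  have hzero : ∀ x ∈ U, Tendsto (fun n => (f v)^[n] x) atTop (𝓝 0) := fun x hx =>
    (h.tendstoLocallyUniformlyOn_iterate hv).tendsto_at hx
  -- A finite limit function vanishes near `p ∈ U`, hence at `z` by the identity theorem, so the
  -- orbit of `z` enters `U`. An infinite limit contradicts the convergence to `0` at `p`.
  obtain ⟨t, ht, hl | hinf⟩ := hN id strictMono_id
  · obtain ⟨l, hl⟩ := hl
    simp only [id] at hl
    have hld : DifferentiableOn ℂ l N := hl.differentiableOn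
      (Eventually.of_forall fun n => ((differentiable_f v).iterate _).differentiableOn) hNo
    have hl0 : ∀ x ∈ U ∩ N, l x = 0 := fun x hx =>
      tendsto_nhds_unique (hl.tendsto_at hx.2) ((hzero x hx.1).comp ht.tendsto_atTop)
    have hEq : EqOn l 0 (ball z ε) :=
      AnalyticOnNhd.eqOn_of_preconnected_of_eventuallyEq
        (fun x hx => hld.analyticAt (hNo.mem_nhds (hεN hx))) analyticOnNhd_const
        (convex_ball _ _).isPreconnected hpb (by
          filter_upwards [hb.isOpen.mem_nhds hpU, hNo.mem_nhds (hεN hpb)] with x hx hx'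
            using hl0 x ⟨hx, hx'⟩)
    have hz0 := hl.tendsto_at hzN
    rw [hEq (mem_ball_self hε)] at hz0
    obtain ⟨n, hn⟩ := (hz0.eventually (hb.isOpen.mem_nhds hb.zero_mem)).exists
    exact hback_iter _ z hzc hn
  · have h1 := hinf {p} (singleton_subset_iff.2 (hεN hpb)) isCompact_singleton 1
    have h2 := ((hzero p hpU).comp ht.tendsto_atTop).norm.eventually
      (gt_mem_nhds (show ‖(0 : ℂ)‖ < 1 by simp))
    obtain ⟨n, hn1, hn2⟩ := (h1.and h2).exists
    exact absurd (hn1 p rfl) (not_le.2 hn2)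

theorem isTypeAParameter_iff {v : ℂ} (hv : v ≠ 0) : IsTypeAParameter v ↔ v ∈ paramA := by
  constructor
  · intro h
    rcases exists_isVal_or_isSol_one hv with hw | h1
    · exact hw
    · obtain ⟨u, hu, hu'⟩ := h1.B_subset_domainU hv h
      exact ⟨u, hv, 1, h1, hu, mul_left_cancel₀ (by norm_num) hu'⟩
  · rintro ⟨w, -, R, hR, hw, hZ⟩
    exact hR.domainU_subset_B hv ⟨w, hw, by beta_reduce; rw [hZ]⟩


/-! ### `paramA` inside the hyperbolic locus -/

theorem tendsto_iterate_of_mem_paramA {v : ℂ} (h : v ∈ paramA) :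
    Tendsto (fun n => (f v)^[n] (-2 * v)) atTop (𝓝 0) := by
  obtain ⟨hv, R, hR, hw, hZ⟩ := isVal_val h
  have := (hR.tendstoLocallyUniformlyOn_iterate hv).tendsto_at ⟨val v, hw, rfl⟩
  simpa only [hZ] using this

theorem paramA_subset_hyperbolicLocus : paramA ⊆ hyperbolicLocus := by
  intro v h
  refine ⟨ne_zero_of_mem_paramA h, 1, 0, one_pos, ?_, ?_, ?_⟩
  · simp [Function.IsPeriodicPt, Function.IsFixedPt, f_zero]
  · have : HasDerivAt (f v) (v * (-Complex.sin 0)) 0 :=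
      ((Complex.hasDerivAt_cos 0).sub_const 1).const_mul v
    rw [Function.iterate_one, this.deriv]; simp
  · simpa using tendsto_iterate_of_mem_paramA h

theorem continuous_iterate_f (k : ℕ) : Continuous fun q : ℂ × ℂ => (f q.1)^[k] q.2 := by
  induction k with
  | zero => exact continuous_snd
  | succ k ih =>
    simp only [Function.iterate_succ_apply']
    exact continuous_fst.mul ((Complex.continuous_cos.comp ih).sub continuous_const)

/-- The `k`-th image of the critical value has coordinate `val v ^ 2 ^ k`, which equals `u` by
injectivity on the larger of the two discs. It prevents `‖val v‖` from approaching `1`. -/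
theorem norm_val_pow_lt {v u : ℂ} (h : v ∈ paramA) {s : ℝ} (hs : IsSol v s (Z v))
    (hu : u ∈ ball (0 : ℂ) s) {k : ℕ} (hk : -2 * Z v u = (f v)^[k] (-2 * v)) :
    ‖val v‖ ^ 2 ^ k < s := by
  have hval := isVal_val h
  have hsq := hval.isSol_sqrt
  have hw0 := hval.ne_zero
  have hw1 := hval.norm_lt_one
  obtain ⟨hv, R, hR, hw, hZ⟩ := hval
  have hmax : IsSol v (max s (√‖val v‖)) (Z v) := by
    rcases le_total s (√‖val v‖) with h1 | h1
    · rwa [max_eq_right h1]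
    · rwa [max_eq_left h1]
  have hwm : val v ∈ ball (0 : ℂ) (max s (√‖val v‖)) :=
    mem_ball_zero_iff.2 ((norm_lt_sqrt hw0 hw1).trans_le (le_max_right _ _))
  have h2 := hmax.f_iterate hwm k
  rw [hZ, ← hk] at h2
  have h3 := hmax.injOn_neg_two hv (ball_subset_ball (le_max_left _ _) hu)
    (pow_two_pow_mem_ball hmax.le_one hwm k) h2
  rw [← norm_pow, ← h3]
  exact mem_ball_zero_iff.1 hu

/-- `paramA` is relatively closed in the hyperbolic locus. -/
theorem closure_paramA_inter_subset : closure paramA ∩ hyperbolicLocus ⊆ paramA := by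
  rintro v₀ ⟨hcl, hv₀, p, z, hp, hper, hmult, hlim⟩
  have hne : (𝓝 v₀ ⊓ 𝓟 paramA).NeBot := mem_closure_iff_nhdsWithin_neBot.1 hcl
  have hfreq : ∃ᶠ v in 𝓝 v₀, v ∈ paramA := mem_closure_iff_frequently.1 hcl
  by_cases hz : z = 0
  · subst hz
    obtain ⟨ρ, hρ, hloc⟩ := exists_uniform_isSol (V := ‖v₀‖ + 1) (by positivity)
    have hsol := (hloc v₀ hv₀ (by linarith)).1
    have hb := hsol.isBottcherMap hv₀
    -- Some iterate of the critical value enters the Böttcher domain. This persists nearby with a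
    -- coordinate of norm below a fixed `s < 1`, so limits of `val` stay inside the unit disc.
    obtain ⟨n, u₀, hu₀, hu₀e⟩ := (hlim.eventually (hb.isOpen.mem_nhds hb.zero_mem)).exists
    set k := p * n
    obtain ⟨s, hs, hsR, -, hev⟩ := eventually_exists_Z_eq hv₀ hsol hu₀
      (τ := fun v => (f v)^[k] (-2 * v) / (-2))
      (((continuous_iterate_f k).comp (by fun_prop :
        Continuous fun v : ℂ => (v, -2 * v))).div_const _).continuousAt
      (by rw [← hu₀e]; ring) one_pos
    have hs1 : s < 1 := hsR.trans_le hsol.le_one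
    have hbd : ∀ᶠ v in 𝓝 v₀, v ∈ paramA → ‖val v‖ ^ 2 ^ k < s := by
      filter_upwards [hev] with v ⟨h1, u, hu, _, hZu⟩ hv
      exact norm_val_pow_lt hv h1 hu (by rw [hZu]; ring)
    set U := Ultrafilter.of (𝓝 v₀ ⊓ 𝓟 paramA)
    have hU : (U : Filter ℂ) ≤ 𝓝 v₀ ⊓ 𝓟 paramA := Ultrafilter.of_le _
    have hUA : ∀ᶠ x in (U : Filter ℂ), x ∈ paramA := hU (mem_inf_of_right (mem_principal_self _))
    have hUv : Tendsto id (U : Filter ℂ) (𝓝 v₀) := hU.trans inf_le_left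
    have hcl : (Ultrafilter.map val U : Filter ℂ) ≤ 𝓟 (closedBall (0 : ℂ) 1) := by
      rw [le_principal_iff]
      exact hUA.mono fun x hx => mem_closedBall_zero_iff.2 (isVal_val hx).norm_lt_one.le
    obtain ⟨w₀, -, hlimw⟩ := (isCompact_closedBall (0 : ℂ) 1).ultrafilter_le_nhds _ hcl
    have hlimw : Tendsto val (U : Filter ℂ) (𝓝 w₀) := hlimw
    have hw₀ : ‖w₀‖ < 1 := by
      have h1 : ‖w₀‖ ^ 2 ^ k ≤ s := by
        refine le_of_tendsto (hlimw.norm.pow (2 ^ k)) ?_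
        filter_upwards [hUv.eventually hbd, hUA] with v h1 h2 using (h1 h2).le
      by_contra! hge
      have := one_le_pow₀ hge (n := 2 ^ k)
      linarith
    exact ⟨w₀, isVal_of_tendsto hv₀ hUv hlimw hw₀ (hUA.mono fun v hv => isVal_val hv)⟩
  -- For nearby parameters `f^[p]` maps a closed ball about `z`, of radius at most `‖z‖/2`, into
  -- itself. The critical orbit of some parameter in `paramA` gets trapped there along multiples of
  -- `p`, yet it tends to `0`.
  · exfalso
    have hgd : DifferentiableAt ℂ (f v₀)^[p] z := (differentiable_f v₀).iterate p z
    obtain ⟨c, hc1, hc2⟩ := exists_between hmult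
    have hcontr : ∀ᶠ x in 𝓝 z, ‖(f v₀)^[p] x - z‖ ≤ c * ‖x - z‖ := by
      have h1 := (hasDerivAt_iff_tendsto_slope.1 hgd.hasDerivAt).norm.eventually (gt_mem_nhds hc1)
      rw [eventually_nhdsWithin_iff] at h1
      filter_upwards [h1] with x hx
      by_cases hxz : x = z
      · rw [hxz, hper]; simp
      · have h2 := (hx hxz).le
        rw [slope_def_field, hper, norm_div,
          div_le_iff₀ (norm_pos_iff.2 (sub_ne_zero.2 hxz))] at h2
        exact h2
    obtain ⟨ε₀, hε₀, hball⟩ := Metric.nhds_basis_closedBall.mem_iff.1 hcontr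
    set ε := min ε₀ (‖z‖ / 2) with hε
    have hεpos : 0 < ε := lt_min hε₀ (by have := norm_pos_iff.2 hz; linarith)
    have hinv : ∀ᶠ v in 𝓝 v₀, ∀ x ∈ closedBall z ε, ‖(f v)^[p] x - z‖ < ε := by
      refine (isCompact_closedBall z ε).eventually_forall_of_forall_eventually fun x hx => ?_
      have hxc : ‖(f v₀)^[p] x - z‖ < ε := by
        have h1 : ‖(f v₀)^[p] x - z‖ ≤ c * ‖x - z‖ :=
          hball (closedBall_subset_closedBall (min_le_left _ _) hx)
        rw [mem_closedBall, dist_eq_norm] at hx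
        nlinarith [norm_nonneg (x - z), norm_nonneg (deriv (f v₀)^[p] z)]
      exact (((continuous_iterate_f p).sub continuous_const).norm.continuousAt
        (x := (v₀, x))).eventually (gt_mem_nhds hxc)
    obtain ⟨n, hn⟩ := (hlim.eventually (ball_mem_nhds z hεpos)).exists
    have hn' : ∀ᶠ v in 𝓝 v₀, (f v)^[p * n] (-2 * v) ∈ ball z ε :=
      (((continuous_iterate_f (p * n)).comp (by fun_prop :
        Continuous fun v : ℂ => (v, -2 * v))).continuousAt (x := v₀)).eventually
        (isOpen_ball.mem_nhds hn)
    obtain ⟨v, hvA, h1, h2⟩ := (hfreq.and_eventually (hinv.and hn')).exists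
    have hstay : ∀ j : ℕ, (f v)^[p * (n + j)] (-2 * v) ∈ closedBall z ε := by
      intro j
      induction j with
      | zero => exact ball_subset_closedBall h2
      | succ j ih =>
        have h3 := h1 _ ih
        rw [← Function.iterate_add_apply] at h3
        rw [show p * (n + (j + 1)) = p + p * (n + j) by ring, mem_closedBall, dist_eq_norm]
        exact h3.le
    have ht : Tendsto (fun j : ℕ => p * (n + j)) atTop atTop :=
      (tendsto_add_atTop_nat n |>.congr fun j => add_comm _ _).const_mul_atTop' hp
    have h0 := isClosed_closedBall.mem_of_tendsto ((tendsto_iterate_of_mem_paramA hvA).comp ht)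
      (Eventually.of_forall hstay)
    rw [mem_closedBall, dist_zero_left] at h0
    have : ε ≤ ‖z‖ / 2 := min_le_right _ _
    have := norm_pos_iff.2 hz
    linarith


/-! ### Properness of `val` and the count of preimages -/

theorem val_mem_puncturedDisc {v : ℂ} (h : v ∈ paramA) : val v ∈ puncturedDisc :=
  ⟨mem_ball_zero_iff.2 (isVal_val h).norm_lt_one, (isVal_val h).ne_zero⟩

theorem analyticAt_val {v : ℂ} (h : v ∈ paramA) : AnalyticAt ℂ val v :=
  (DifferentiableOn.analyticAt (s := paramA)
    (fun _ hx => (differentiableAt_val hx).differentiableWithinAt) (isOpen_paramA.mem_nhds h))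

theorem tendsto_val_zero : Tendsto val (𝓝[≠] 0) (𝓝 0) := by
  obtain ⟨δ, K, hδ, hK, h⟩ := exists_small_param
  rw [tendsto_zero_iff_norm_tendsto_zero]
  have h1 : Tendsto (fun v : ℂ => ‖v‖ ^ 2 + K * ‖v‖ ^ 3) (𝓝[≠] 0) (𝓝 0) := by
    have : Continuous fun v : ℂ => ‖v‖ ^ 2 + K * ‖v‖ ^ 3 := by fun_prop
    simpa using (this.tendsto 0).mono_left nhdsWithin_le_nhds
  refine squeeze_zero' (Eventually.of_forall fun _ => norm_nonneg _) ?_ h1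
  filter_upwards [self_mem_nhdsWithin, mem_nhdsWithin_of_mem_nhds (ball_mem_nhds 0 hδ)]
    with v hv hvδ
  have h2 := (h v hv (mem_ball_zero_iff.1 hvδ)).2
  calc ‖val v‖ = ‖v ^ 2 + (val v - v ^ 2)‖ := by congr 1; ring
    _ ≤ ‖v ^ 2‖ + ‖val v - v ^ 2‖ := norm_add_le _ _
    _ ≤ _ := by rw [norm_pow]; gcongr

/-- The critical Böttcher coordinate is proper as a map to the punctured disc. -/
theorem exists_tendsto_of_tendsto_val {ι : Type*} {U : Ultrafilter ι} {v : ι → ℂ} {w₀ : ℂ}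
    (hv : ∀ᶠ i in (U : Filter ι), v i ∈ paramA)
    (h : Tendsto (fun i => val (v i)) U (𝓝 w₀)) (hw₀ : w₀ ∈ puncturedDisc) :
    ∃ v₀ ∈ paramA, Tendsto v U (𝓝 v₀) ∧ val v₀ = w₀ := by
  have hb : (Ultrafilter.map v U : Filter ℂ) ≤ 𝓟 (closedBall 0 8) := by
    rw [le_principal_iff]
    filter_upwards [hv] with i hi using mem_closedBall_zero_iff.2 (norm_lt_eight hi).le
  obtain ⟨v₀, -, hv₀⟩ := (isCompact_closedBall (0 : ℂ) 8).ultrafilter_le_nhds _ hb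
  have ht : Tendsto v U (𝓝 v₀) := hv₀
  have hne : v₀ ≠ 0 := by
    rintro rfl
    have h1 : Tendsto v U (𝓝[≠] 0) := tendsto_nhdsWithin_iff.2
      ⟨ht, by filter_upwards [hv] with i hi using ne_zero_of_mem_paramA hi⟩
    exact hw₀.2 (tendsto_nhds_unique h (tendsto_val_zero.comp h1))
  have hval : IsVal v₀ w₀ := isVal_of_tendsto hne ht h (mem_ball_zero_iff.1 hw₀.1)
    (hv.mono fun i hi => isVal_val hi)
  exact ⟨v₀, ⟨_, hval⟩, ht, hval.val_eq⟩

/-- Otherwise parameters bounded away from `0` with `val → 0` would accumulate at a parameter with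
critical coordinate `0`. So small values come only from small parameters. -/
theorem exists_norm_val_lt {ε : ℝ} (hε : 0 < ε) :
    ∃ δ > 0, ∀ v ∈ paramA, ‖val v‖ < δ → ‖v‖ < ε := by
  by_contra! hcon
  choose! u hu hu1 hu2 using fun n : ℕ => hcon (1 / ((n : ℝ) + 1)) (by positivity)
  let U : Ultrafilter ℕ := Ultrafilter.of atTop
  have hU : (U : Filter ℕ) ≤ atTop := Ultrafilter.of_le _
  have hval0 : Tendsto (fun n => val (u n)) U (𝓝 0) := by
    refine Tendsto.mono_left ?_ hU
    exact squeeze_zero_norm (fun n => (hu1 n).le) tendsto_one_div_add_atTop_nhds_zero_nat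
  have hb : (Ultrafilter.map u U : Filter ℂ) ≤ 𝓟 (closedBall 0 8) := by
    rw [le_principal_iff]
    exact Ultrafilter.mem_map.2 (univ_mem' fun n =>
      mem_closedBall_zero_iff.2 (norm_lt_eight (hu n)).le)
  obtain ⟨v₀, -, hv₀⟩ := (isCompact_closedBall (0 : ℂ) 8).ultrafilter_le_nhds _ hb
  have ht : Tendsto u U (𝓝 v₀) := hv₀
  have hε' : ε ≤ ‖v₀‖ := ge_of_tendsto ht.norm (Eventually.of_forall hu2)
  have hne : v₀ ≠ 0 := norm_pos_iff.1 (hε.trans_le hε')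
  exact (isVal_of_tendsto hne ht hval0 (by simp)
    (Eventually.of_forall fun n => isVal_val (hu n))).ne_zero rfl

/-- The set where `val` is locally this constant is open; by properness and isolation of zeros it is
closed in the whole plane, yet it omits `0`. Consequently `val` is an open map. -/
theorem not_eventually_val_eq {v₁ : ℂ} (h₁ : v₁ ∈ paramA) :
    ¬ ∀ᶠ v in 𝓝 v₁, val v = val v₁ := by
  intro hcon
  set S : Set ℂ := {v | v ∈ paramA ∧ ∀ᶠ z in 𝓝 v, val z = val v₁} with hS
  have hopen : IsOpen S := isOpen_paramA.inter isOpen_setOfPred_eventually_nhds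
  have hclosed : IsClosed S := by
    rw [isClosed_iff_ultrafilter]
    intro v₀ U hU hSU
    have hSU' : ∀ᶠ v in (U : Filter ℂ), v ∈ S := hSU
    have ht : Tendsto (fun v => val v) U (𝓝 (val v₁)) := by
      refine tendsto_const_nhds.congr' ?_
      filter_upwards [hSU'] with v hv using hv.2.self_of_nhds.symm
    obtain ⟨v₂, hv₂, ht₂, hval⟩ := exists_tendsto_of_tendsto_val (v := id)
      (hSU'.mono fun v hv => hv.1) ht (val_mem_puncturedDisc h₁)
    have : v₀ = v₂ := tendsto_nhds_unique (f := id) hU ht₂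
    subst this
    refine ⟨hv₂, ?_⟩
    rcases (analyticAt_val hv₂).eventually_eq_or_eventually_ne
      (analyticAt_const (v := val v₁)) with h | h
    · exact h
    · by_cases hm : v₀ ∈ S
      · exact hm.2
      have h' := hU (eventually_nhdsWithin_iff.1 h)
      obtain ⟨v, hv, hvS⟩ := ((show ∀ᶠ v in (U : Filter ℂ), _ from h').and hSU').exists
      exact (hv (fun hE => hm (hE ▸ hvS)) hvS.2.self_of_nhds).elim
  have huniv : S = univ := IsClopen.eq_univ ⟨hclosed, hopen⟩ ⟨v₁, h₁, hcon⟩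
  have h0 : (0 : ℂ) ∈ S := huniv ▸ mem_univ _
  exact ne_zero_of_mem_paramA h0.1 rfl

theorem image_val_mem_nhds {v : ℂ} (h : v ∈ paramA) {N : Set ℂ} (hN : N ∈ 𝓝 v) :
    val '' N ∈ 𝓝 (val v) :=
  ((analyticAt_val h).eventually_constant_or_nhds_le_map_nhds.resolve_left
    (not_eventually_val_eq h)) (image_mem_map hN)

theorem isPreconnected_ball_diff_zero {r : ℝ} (hr : 0 < r) :
    IsPreconnected (ball (0 : ℂ) r \ {0}) := by
  have hc : Convex ℝ {z : ℂ | z.re < Real.log r} := convex_halfSpace_re_lt _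
  have he : ball (0 : ℂ) r \ {0} = Complex.exp '' {z : ℂ | z.re < Real.log r} := by
    ext z
    constructor
    · rintro ⟨hz, hz0⟩
      refine ⟨Complex.log z, ?_, Complex.exp_log hz0⟩
      rw [mem_ofPred_eq, Complex.log_re]
      exact Real.log_lt_log (norm_pos_iff.2 hz0) (mem_ball_zero_iff.1 hz)
    · rintro ⟨y, hy, rfl⟩
      refine ⟨?_, Complex.exp_ne_zero _⟩
      rw [mem_ball_zero_iff, Complex.norm_exp]
      exact (Real.lt_log_iff_exp_lt hr).1 hy
  rw [he]
  exact hc.isPreconnected.image _ Complex.continuous_exp.continuousOn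

/-- The value `w` is attained by the critical Böttcher coordinate exactly at two opposite
parameters, at which the derivative does not vanish. -/
def IsRegularValue (w : ℂ) : Prop :=
  ∃ v ∈ paramA, val v = w ∧ deriv val v ≠ 0 ∧ ∀ u ∈ paramA, val u = w → u ^ 2 = v ^ 2

/-- If regularity failed arbitrarily near, there would be preimages `v` near `v₀` and `u` with `u² ≠
v²`. By properness `u` converges to `±v₀`, and after a sign change, allowed by evenness, this
contradicts local injectivity. -/
theorem isOpen_isRegularValue : IsOpen {w | IsRegularValue w} := by
  rw [isOpen_iff_mem_nhds]
  rintro w₀ ⟨v₀, hv₀, rfl, hd, huniq⟩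
  by_contra hcon
  have hfr : ∃ᶠ w in 𝓝 (val v₀), ¬ IsRegularValue w := not_eventually.1 hcon
  obtain ⟨-, N₁, hN₁, hinj⟩ := local_inverse (analyticAt_val hv₀) hd
  have hN : N₁ ∩ paramA ∩ {v | deriv val v ≠ 0} ∈ 𝓝 v₀ :=
    inter_mem (inter_mem hN₁ (isOpen_paramA.mem_nhds hv₀))
      ((analyticAt_val hv₀).deriv.continuousAt.eventually_ne hd)
  have hkey : ∃ᶠ w in 𝓝 (val v₀), ∃ v ∈ N₁, ∃ u ∈ paramA, val v = w ∧ val u = w ∧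
      u ^ 2 ≠ v ^ 2 := by
    refine (hfr.and_eventually (image_val_mem_nhds hv₀ hN)).mono ?_
    rintro w ⟨hw, v, ⟨⟨hvN, hvA⟩, hvd⟩, rfl⟩
    unfold IsRegularValue at hw
    push Not at hw
    obtain ⟨u, hu, huv, hne⟩ := hw v hvA rfl hvd
    exact ⟨v, hvN, u, hu, rfl, huv, hne⟩
  have hne : (𝓝 (val v₀) ⊓ 𝓟 {w | ∃ v ∈ N₁, ∃ u ∈ paramA, val v = w ∧ val u = w ∧
      u ^ 2 ≠ v ^ 2}).NeBot := frequently_mem_iff_neBot.1 hkey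
  let U := Ultrafilter.of (𝓝 (val v₀) ⊓ 𝓟 {w | ∃ v ∈ N₁, ∃ u ∈ paramA, val v = w ∧ val u = w ∧
      u ^ 2 ≠ v ^ 2})
  have hU := Ultrafilter.of_le (𝓝 (val v₀) ⊓ 𝓟 {w | ∃ v ∈ N₁, ∃ u ∈ paramA, val v = w ∧
      val u = w ∧ u ^ 2 ≠ v ^ 2})
  have hUn : (U : Filter ℂ) ≤ 𝓝 (val v₀) := hU.trans inf_le_left
  have hUp : ∀ᶠ w in (U : Filter ℂ), ∃ v ∈ N₁, ∃ u ∈ paramA, val v = w ∧ val u = w ∧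
      u ^ 2 ≠ v ^ 2 := hU (mem_inf_of_right (mem_principal_self _))
  choose! v hvN u huA hvw huw hne' using
    fun w (hw : ∃ v ∈ N₁, ∃ u ∈ paramA, val v = w ∧ val u = w ∧ u ^ 2 ≠ v ^ 2) => hw
  obtain ⟨u₀, hu₀, ht, hu₀v⟩ := exists_tendsto_of_tendsto_val (v := u) (hUp.mono huA)
    (Tendsto.congr' (hUp.mono fun w hw => (huw w hw).symm) hUn) (val_mem_puncturedDisc hv₀)
  rcases sq_eq_sq_iff_eq_or_eq_neg.1 (huniq u₀ hu₀ hu₀v) with rfl | hneg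
  · obtain ⟨w, hw, hwN⟩ := (hUp.and (ht hN₁)).exists
    exact hne' w hw (by rw [hinj hwN (hvN w hw) ((huw w hw).trans (hvw w hw).symm)])
  · have ht' : Tendsto (fun w => -u w) U (𝓝 v₀) := by simpa [hneg] using ht.neg
    obtain ⟨w, hw, hwN⟩ := (hUp.and (ht' hN₁)).exists
    refine hne' w hw ?_
    rw [← hinj hwN (hvN w hw)
      ((neg_mem_paramA (huA w hw)).2.trans ((huw w hw).trans (hvw w hw).symm)), neg_sq]

/-- Preimages of regular values converge by properness. A critical limit would have two distinct
preimages of one regular value close to it, hence opposite ones, but the ball of radius `‖v₀‖` about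
`v₀` contains no opposite pair. An extra preimage at the limit would persist because `val` is open.
-/
theorem closure_isRegularValue_inter :
    closure {w | IsRegularValue w} ∩ puncturedDisc ⊆ {w | IsRegularValue w} := by
  rintro w₀ ⟨hcl, hw₀⟩
  obtain ⟨U, hUr, hUn⟩ := mem_closure_iff_ultrafilter.1 hcl
  have hUr' : ∀ᶠ w in (U : Filter ℂ), IsRegularValue w := hUr
  by_cases hself : IsRegularValue w₀
  · exact hself
  choose! v hvA hvw hvd huniq using fun w (hw : IsRegularValue w) => hw
  obtain ⟨v₀, hv₀, ht, hval⟩ := exists_tendsto_of_tendsto_val (v := v) (hUr'.mono hvA)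
    (Tendsto.congr' (hUr'.mono fun w hw => (hvw w hw).symm) hUn) hw₀
  refine ⟨v₀, hv₀, hval, fun hd => ?_, fun u hu huv => ?_⟩
  · have hv₀n : 0 < ‖v₀‖ := norm_pos_iff.2 (ne_zero_of_mem_paramA hv₀)
    have h2 := exists_two_preimages (analyticAt_val hv₀) (not_eventually_val_eq hv₀) hd
      (inter_mem (ball_mem_nhds v₀ hv₀n) (isOpen_paramA.mem_nhds hv₀))
    rw [hval, eventually_nhdsWithin_iff] at h2
    obtain ⟨w, hw, hwr⟩ := ((show ∀ᶠ w in (U : Filter ℂ), _ from hUn h2).and hUr').exists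
    obtain ⟨x, hx, y, hy, hxy, hxw, hyw⟩ := hw (fun h => hself (h ▸ hwr))
    have hsq : x ^ 2 = y ^ 2 := (huniq w hwr x hx.2 hxw).trans (huniq w hwr y hy.2 hyw).symm
    have hneg : x = -y := (sq_eq_sq_iff_eq_or_eq_neg.1 hsq).resolve_left hxy
    have h1 := mem_ball_iff_norm.1 hx.1
    have h3 := mem_ball_iff_norm.1 hy.1
    have h4 : ‖(x - v₀) + (y - v₀)‖ ≤ ‖x - v₀‖ + ‖y - v₀‖ := norm_add_le _ _
    have h5 : (x - v₀) + (y - v₀) = -(2 * v₀) := by rw [hneg]; ring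
    rw [h5, norm_neg, norm_mul, Complex.norm_two] at h4
    linarith
  · by_contra hne
    obtain ⟨A, B, hA, hB, huA, hvB, hAB⟩ := t2_separation hne
    have hcont : Continuous fun z : ℂ => z ^ 2 := continuous_pow 2
    have h1 := image_val_mem_nhds hu (inter_mem (isOpen_paramA.mem_nhds hu)
      ((hA.preimage hcont).mem_nhds huA))
    rw [huv] at h1
    obtain ⟨w, ⟨⟨x, ⟨hxA, hx⟩, hxw⟩, hwB⟩, hwr⟩ :=
      ((show ∀ᶠ w in (U : Filter ℂ), _ from hUn h1).and
        (ht ((hB.preimage hcont).mem_nhds hvB))).and hUr' |>.exists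
    have : x ^ 2 = v w ^ 2 := huniq w hwr x hxA hxw
    exact Set.disjoint_left.1 hAB hx (show x ^ 2 ∈ B by rw [this]; exact hwB)

/-- Near `0` the critical Böttcher coordinate is the square of a local coordinate. -/
theorem exists_sqrt_val : ∃ h : ℂ → ℂ, AnalyticAt ℂ h 0 ∧ h 0 = 0 ∧ deriv h 0 ≠ 0 ∧
    ∀ᶠ v in 𝓝[≠] 0, val v = h v ^ 2 := by
  obtain ⟨δ, K, hδ, hK, hsmall⟩ := exists_small_param
  -- The asymptotics make `0` a removable singularity with value `1`, so `P` has an analytic square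
  -- root there.
  set P : ℂ → ℂ := Function.update (fun v => val v / v ^ 2) 0 1 with hP
  have hPne : ∀ v : ℂ, v ≠ 0 → P v = val v / v ^ 2 := fun v hv => Function.update_of_ne hv _ _
  have hP0 : P 0 = 1 := Function.update_self _ _ _
  have hev : ∀ᶠ v : ℂ in 𝓝[≠] 0, v ≠ 0 ∧ ‖v‖ < δ := by
    filter_upwards [self_mem_nhdsWithin, mem_nhdsWithin_of_mem_nhds (ball_mem_nhds 0 hδ)]
      with v hv hvδ using ⟨hv, mem_ball_zero_iff.1 hvδ⟩
  have hPa : AnalyticAt ℂ P 0 := by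
    refine Complex.analyticAt_of_differentiable_on_punctured_nhds_of_continuousAt ?_ ?_
    · filter_upwards [hev] with v hv
      have h1 : DifferentiableAt ℂ (fun v => val v / v ^ 2) v :=
        (differentiableAt_val (hsmall v hv.1 hv.2).1).fun_div (by fun_prop) (pow_ne_zero 2 hv.1)
      refine h1.congr_of_eventuallyEq ?_
      filter_upwards [isOpen_ne.mem_nhds hv.1] with z hz using hPne z hz
    · rw [hP, continuousAt_update_same]
      rw [tendsto_iff_norm_sub_tendsto_zero]
      have h1 : Tendsto (fun v : ℂ => K * ‖v‖) (𝓝[≠] 0) (𝓝 0) := by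
        have : Continuous fun v : ℂ => K * ‖v‖ := by fun_prop
        simpa using (this.tendsto 0).mono_left nhdsWithin_le_nhds
      refine squeeze_zero' (Eventually.of_forall fun _ => norm_nonneg _) ?_ h1
      filter_upwards [hev] with v hv
      have hvn : 0 < ‖v‖ := norm_pos_iff.2 hv.1
      have h2 : val v / v ^ 2 - 1 = (val v - v ^ 2) / v ^ 2 := by
        have := hv.1
        field_simp
      rw [h2, norm_div, norm_pow, div_le_iff₀ (by positivity)]
      calc _ ≤ K * ‖v‖ ^ 3 := (hsmall v hv.1 hv.2).2
        _ = _ := by ring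
  have hq : AnalyticAt ℂ (fun v => Complex.exp (Complex.log (P v) / 2)) 0 :=
    ((hPa.clog (by rw [hP0]; exact Complex.one_mem_slitPlane)).div_const).cexp
  refine ⟨fun v => v * Complex.exp (Complex.log (P v) / 2), analyticAt_id.mul hq, by simp, ?_, ?_⟩
  · have h1 := (hasDerivAt_id (0 : ℂ)).fun_mul hq.differentiableAt.hasDerivAt
    have h2 := h1.deriv
    simp only [id_eq, hP0] at h2
    rw [h2]
    simp
  · have hne : ∀ᶠ v in 𝓝[≠] 0, P v ≠ 0 :=
      (hPa.continuousAt.eventually_ne (by rw [hP0]; exact one_ne_zero)).filter_mono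
        nhdsWithin_le_nhds
    filter_upwards [hev, hne] with v hv hPv
    rw [mul_pow, ← Complex.exp_nat_mul]
    rw [show ((2 : ℕ) : ℂ) * (Complex.log (P v) / 2) = Complex.log (P v) by push_cast; ring,
      Complex.exp_log hPv, hPne v hv.1]
    have := hv.1
    field_simp

/-- Near `0`, `val = h²` with `h` injective and, by evenness of `val`, odd at the parameter used.
All preimages of a small value are small, and `h u = ±h v` gives `u = ±v`. -/
theorem exists_isRegularValue : ∃ w ∈ puncturedDisc, IsRegularValue w := by
  obtain ⟨h, hh, h0, hd, hsq⟩ := exists_sqrt_val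
  obtain ⟨δ₁, K, hδ₁, hK, hsmall⟩ := exists_small_param
  obtain ⟨-, N, hN, hinj⟩ := local_inverse hh hd
  rw [eventually_nhdsWithin_iff] at hsq
  have hall : ∀ᶠ v in 𝓝 (0 : ℂ), v ∈ N ∧ (v ≠ 0 → val v = h v ^ 2) ∧ deriv h v ≠ 0 ∧
      AnalyticAt ℂ h v :=
    (show ∀ᶠ v in 𝓝 (0 : ℂ), v ∈ N from hN).and (hsq.and
      ((hh.deriv.continuousAt.eventually_ne hd).and hh.eventually_analyticAt))
  obtain ⟨ε, hε, hball⟩ := Metric.eventually_nhds_iff_ball.1 hall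
  obtain ⟨η, hη, hlt⟩ := exists_norm_val_lt hε
  have hv : ∀ᶠ v in 𝓝[≠] (0 : ℂ), v ≠ 0 ∧ v ∈ ball 0 δ₁ ∧ v ∈ ball 0 ε ∧ ‖val v‖ < η :=
    (show ∀ᶠ v in 𝓝[≠] (0 : ℂ), v ≠ 0 from self_mem_nhdsWithin).and
      ((show ∀ᶠ v in 𝓝[≠] (0 : ℂ), v ∈ ball (0 : ℂ) δ₁ from
        mem_nhdsWithin_of_mem_nhds (ball_mem_nhds 0 hδ₁)).and
      ((show ∀ᶠ v in 𝓝[≠] (0 : ℂ), v ∈ ball (0 : ℂ) ε from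
        mem_nhdsWithin_of_mem_nhds (ball_mem_nhds 0 hε)).and
        (tendsto_val_zero.norm.eventually_lt_const (by simpa using hη))))
  obtain ⟨v, hv0, hvδ, hvε, hvη⟩ := hv.exists
  have hvA := (hsmall v hv0 (mem_ball_zero_iff.1 hvδ)).1
  have hmemN : ∀ u ∈ ball (0 : ℂ) ε, u ∈ N := fun u hu => (hball u hu).1
  have hneg : h (-v) = -h v := by
    have h1 : h (-v) ^ 2 = h v ^ 2 := by
      rw [← (hball v hvε).2.1 hv0, ← (hball (-v) (by simpa using hvε)).2.1 (neg_ne_zero.2 hv0),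
        (neg_mem_paramA hvA).2]
    refine (sq_eq_sq_iff_eq_or_eq_neg.1 h1).resolve_left fun h2 => hv0 ?_
    exact self_eq_neg.1 (hinj (hmemN _ (by simpa using hvε)) (hmemN _ hvε) h2).symm
  refine ⟨val v, val_mem_puncturedDisc hvA, v, hvA, rfl, ?_, fun u hu huv => ?_⟩
  · have heq : val =ᶠ[𝓝 v] fun z => h z ^ 2 := by
      filter_upwards [isOpen_ball.mem_nhds hvε, isOpen_ne.mem_nhds hv0] with z hz hz0
        using (hball z hz).2.1 hz0
    have hd' := ((hball v hvε).2.2.2.differentiableAt.hasDerivAt).fun_pow 2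
    rw [heq.deriv_eq, hd'.deriv]
    have hhv : h v ≠ 0 := fun hz => (isVal_val hvA).ne_zero (by
      rw [(hball v hvε).2.1 hv0, hz]; simp)
    have := (hball v hvε).2.2.1
    simp [hhv, this]
  · have huε : u ∈ ball (0 : ℂ) ε := mem_ball_zero_iff.2 (hlt u hu (by rwa [huv]))
    have h1 : h u ^ 2 = h v ^ 2 := by
      rw [← (hball v hvε).2.1 hv0, ← (hball u huε).2.1 (ne_zero_of_mem_paramA hu), huv]
    rcases sq_eq_sq_iff_eq_or_eq_neg.1 h1 with h2 | h2
    · rw [hinj (hmemN u huε) (hmemN v hvε) h2]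
    · rw [hinj (hmemN u huε) (hmemN (-v) (by simpa using hvε)) (h2.trans hneg.symm), neg_sq]

theorem isRegularValue_of_mem {w : ℂ} (hw : w ∈ puncturedDisc) : IsRegularValue w := by
  obtain ⟨w₁, hw₁, h₁⟩ := exists_isRegularValue
  exact (isPreconnected_ball_diff_zero one_pos).subset_of_closure_inter_subset
    isOpen_isRegularValue ⟨w₁, hw₁, h₁⟩ closure_isRegularValue_inter hw

theorem eq_or_eq_neg_of_val_eq {u v : ℂ} (hu : u ∈ paramA) (hv : v ∈ paramA)
    (h : val u = val v) : u = v ∨ u = -v := by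
  obtain ⟨x, -, -, -, hx⟩ := isRegularValue_of_mem (val_mem_puncturedDisc hv)
  exact sq_eq_sq_iff_eq_or_eq_neg.1 ((hx u hu h).trans (hx v hv rfl).symm)

theorem deriv_val_ne_zero {v : ℂ} (hv : v ∈ paramA) : deriv val v ≠ 0 := by
  obtain ⟨x, hxA, hxv, hd, hx⟩ := isRegularValue_of_mem (val_mem_puncturedDisc hv)
  rcases eq_or_eq_neg_of_val_eq hxA hv hxv with rfl | rfl
  · exact hd
  · have heq : (fun z => val (-z)) =ᶠ[𝓝 v] val := by
      filter_upwards [isOpen_paramA.mem_nhds hv] with z hz using (neg_mem_paramA hz).2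
    rw [← heq.deriv_eq, deriv_comp_neg]
    exact neg_ne_zero.2 hd

/-! ### Connectedness: `paramA` is a hyperbolic component -/

/-- The image is open, and relatively closed by properness: a limit parameter has an open component
of its own, which must be the given one. -/
theorem surjOn_val_connectedComponentIn {v₁ : ℂ} (h₁ : v₁ ∈ paramA) :
    SurjOn val (connectedComponentIn paramA v₁) puncturedDisc := by
  set C := connectedComponentIn paramA v₁ with hC
  have hCo : IsOpen C := isOpen_paramA.connectedComponentIn
  have hCA : C ⊆ paramA := connectedComponentIn_subset _ _
  have h₁C : v₁ ∈ C := mem_connectedComponentIn h₁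
  refine (isPreconnected_ball_diff_zero one_pos).subset_of_closure_inter_subset (u := val '' C) ?_
    ⟨val v₁, val_mem_puncturedDisc h₁, v₁, h₁C, rfl⟩ ?_
  · rw [isOpen_iff_mem_nhds]
    rintro _ ⟨v, hv, rfl⟩
    exact image_val_mem_nhds (hCA hv) (hCo.mem_nhds hv)
  · rintro w₀ ⟨hcl, hw₀⟩
    obtain ⟨U, hUr, hUn⟩ := mem_closure_iff_ultrafilter.1 hcl
    have hUr' : ∀ᶠ w in (U : Filter ℂ), w ∈ val '' C := hUr
    choose! v hvC hvw using fun w (hw : w ∈ val '' C) => hw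
    obtain ⟨v₀, hv₀, ht, hval⟩ := exists_tendsto_of_tendsto_val (v := v)
      (hUr'.mono fun w hw => hCA (hvC w hw))
      (Tendsto.congr' (hUr'.mono fun w hw => (hvw w hw).symm) hUn) hw₀
    refine ⟨v₀, ?_, hval⟩
    have hD := (isOpen_paramA.connectedComponentIn (x := v₀)).mem_nhds
      (mem_connectedComponentIn hv₀)
    obtain ⟨w, hw, hwD⟩ := (hUr'.and (ht hD)).exists
    have e1 := connectedComponentIn_eq (hvC w hw)
    have e2 := connectedComponentIn_eq (show v w ∈ connectedComponentIn paramA v₀ from hwD)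
    rw [hC, e1, ← e2]
    exact mem_connectedComponentIn hv₀

/-- Each component attains a very small value, hence contains a parameter in a punctured disc about
`0` that lies in `paramA`; so there is only one component. -/
theorem isPreconnected_paramA : IsPreconnected paramA := by
  obtain ⟨δ, K, hδ, hK, hsmall⟩ := exists_small_param
  obtain ⟨η, hη, hlt⟩ := exists_norm_val_lt hδ
  have hsub : ball (0 : ℂ) δ \ {0} ⊆ paramA := fun v hv =>
    (hsmall v hv.2 (mem_ball_zero_iff.1 hv.1)).1
  have hδ2 : ((δ / 2 : ℝ) : ℂ) ∈ ball (0 : ℂ) δ \ {0} := by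
    refine ⟨?_, by simpa using hδ.ne'⟩
    rw [mem_ball_zero_iff, Complex.norm_real, Real.norm_of_nonneg (by positivity)]
    linarith
  have hkey : ∀ v ∈ paramA, connectedComponentIn paramA v =
      connectedComponentIn paramA ((δ / 2 : ℝ) : ℂ) := by
    intro v hv
    have hm : ((min η 1 / 2 : ℝ) : ℂ) ∈ puncturedDisc ∧ ‖((min η 1 / 2 : ℝ) : ℂ)‖ < η := by
      have hpos : 0 < min η 1 := lt_min hη one_pos
      have hn : ‖((min η 1 / 2 : ℝ) : ℂ)‖ = min η 1 / 2 := by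
        rw [Complex.norm_real, Real.norm_of_nonneg (by positivity)]
      have h1 := min_le_left η 1
      have h2 := min_le_right η 1
      refine ⟨⟨mem_ball_zero_iff.2 (by rw [hn]; linarith), ?_⟩, by rw [hn]; linarith⟩
      exact norm_pos_iff.1 (by rw [hn]; positivity)
    obtain ⟨u, hu, huv⟩ := surjOn_val_connectedComponentIn hv hm.1
    have huA : u ∈ paramA := connectedComponentIn_subset _ _ hu
    have hub : u ∈ ball (0 : ℂ) δ \ {0} :=
      ⟨mem_ball_zero_iff.2 (hlt u huA (by rw [huv]; exact hm.2)), ne_zero_of_mem_paramA huA⟩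
    rw [connectedComponentIn_eq hu]
    exact connectedComponentIn_eq ((isPreconnected_ball_diff_zero hδ).subset_connectedComponentIn
      hub hsub hδ2)
  have heq : paramA = connectedComponentIn paramA ((δ / 2 : ℝ) : ℂ) :=
    Subset.antisymm (fun v hv => hkey v hv ▸ mem_connectedComponentIn hv)
      (connectedComponentIn_subset _ _)
  rw [heq]
  exact isPreconnected_connectedComponentIn

theorem connectedComponentIn_hyperbolicLocus {v : ℂ} (hv : v ∈ paramA) :
    connectedComponentIn hyperbolicLocus v = paramA := by
  have hvH := paramA_subset_hyperbolicLocus hv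
  refine Subset.antisymm ?_ (isPreconnected_paramA.subset_connectedComponentIn hv
    paramA_subset_hyperbolicLocus)
  refine isPreconnected_connectedComponentIn.subset_of_closure_inter_subset isOpen_paramA
    ⟨v, mem_connectedComponentIn hvH, hv⟩ fun u hu => closure_paramA_inter_subset
      ⟨hu.1, connectedComponentIn_subset _ _ hu.2⟩

/-! ### The covering property and the degree of `Φ₀` -/

theorem mapsTo_Phi0 : MapsTo Phi0 paramA puncturedDisc := fun v hv => by
  rw [Phi0_eq_val hv]; exact val_mem_puncturedDisc hv

theorem eventuallyEq_Phi0 {v : ℂ} (hv : v ∈ paramA) : Phi0 =ᶠ[𝓝 v] val := by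
  filter_upwards [isOpen_paramA.mem_nhds hv] with z hz using Phi0_eq_val hz

theorem analyticAt_Phi0 {v : ℂ} (hv : v ∈ paramA) : AnalyticAt ℂ Phi0 v :=
  (analyticAt_val hv).congr (eventuallyEq_Phi0 hv).symm

theorem isLocalHomeomorph_restrict_Phi0 :
    IsLocalHomeomorph (mapsTo_Phi0.restrict Phi0 paramA puncturedDisc) := by
  have hlocal : IsLocalHomeomorphOn Phi0 paramA := fun v hv => by
    have hs := (analyticAt_Phi0 hv).hasStrictDerivAt
    have hd : deriv Phi0 v ≠ 0 := by
      rw [(eventuallyEq_Phi0 hv).deriv_eq]; exact deriv_val_ne_zero hv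
    exact ⟨(hs.hasStrictFDerivAt_equiv hd).toOpenPartialHomeomorph Phi0,
      (hs.hasStrictFDerivAt_equiv hd).mem_toOpenPartialHomeomorph_source, rfl⟩
  have hcomp : IsLocalHomeomorph (Phi0 ∘ (Subtype.val : paramA → ℂ)) :=
    isLocalHomeomorph_iff_isLocalHomeomorphOn_univ.2 (hlocal.comp
      isOpen_paramA.isOpenEmbedding_subtypeVal.isLocalHomeomorph.isLocalHomeomorphOn
      fun v _ => v.2)
  have hopen : IsOpen puncturedDisc := isOpen_ball.sdiff isClosed_singleton
  refine IsLocalHomeomorph.of_comp (g := (Subtype.val : puncturedDisc → ℂ)) hcomp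
    hopen.isOpenEmbedding_subtypeVal.isLocalHomeomorph ?_
  exact ContinuousOn.mapsToRestrict
    (fun v hv => (analyticAt_Phi0 hv).continuousAt.continuousWithinAt) _

theorem isClosedMap_restrict_Phi0 :
    IsClosedMap (mapsTo_Phi0.restrict Phi0 paramA puncturedDisc) := by
  intro S hS
  rw [isClosed_iff_ultrafilter]
  intro w₀ U hUn hU
  have hU' : ∀ᶠ w in (U : Filter puncturedDisc),
      w ∈ mapsTo_Phi0.restrict Phi0 paramA puncturedDisc '' S := hU
  have hdef : ∀ w ∈ mapsTo_Phi0.restrict Phi0 paramA puncturedDisc '' S,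
      ∃ v : ℂ, ∃ hv : v ∈ paramA, (⟨v, hv⟩ : paramA) ∈ S ∧ val v = w := by
    rintro _ ⟨v, hv, rfl⟩
    exact ⟨v, v.2, hv, (Phi0_eq_val v.2).symm⟩
  choose! v hvA hvS hvw using hdef
  obtain ⟨v₀, hv₀, ht, hval⟩ := exists_tendsto_of_tendsto_val (v := v) (w₀ := (w₀ : ℂ))
    (hU'.mono hvA) (Tendsto.congr' (hU'.mono fun w hw => (hvw w hw).symm)
      ((continuous_subtype_val.tendsto w₀).mono_left hUn)) w₀.2
  refine ⟨⟨v₀, hv₀⟩, ?_, Subtype.ext ((Phi0_eq_val hv₀).trans hval)⟩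
  by_contra hcon
  obtain ⟨O, hO, hOS⟩ := isOpen_induced_iff.1 hS.isOpen_compl
  have hmem : v₀ ∈ O := by
    have : (⟨v₀, hv₀⟩ : paramA) ∈ Subtype.val ⁻¹' O := hOS ▸ hcon
    exact this
  obtain ⟨w, hw, hwO⟩ := (hU'.and (ht (hO.mem_nhds hmem))).exists
  have : (⟨v w, hvA w hw⟩ : paramA) ∈ Sᶜ := hOS ▸ hwO
  exact this (hvS w hw)

theorem fiber_Phi0 {v : ℂ} (hv : v ∈ paramA) :
    {u | u ∈ paramA ∧ Phi0 u = Phi0 v} = {v, -v} := by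
  ext u
  constructor
  · rintro ⟨hu, h⟩
    rw [Phi0_eq_val hu, Phi0_eq_val hv] at h
    exact eq_or_eq_neg_of_val_eq hu hv h
  · rintro (rfl | rfl)
    · exact ⟨hv, rfl⟩
    · have := neg_mem_paramA hv
      exact ⟨this.1, by rw [Phi0_eq_val this.1, Phi0_eq_val hv, this.2]⟩

/-- A closed local homeomorphism with finite fibres between these spaces is a covering; closedness
is the properness of `val`. -/
theorem isCoveringMap_restrict_Phi0 :
    IsCoveringMap (mapsTo_Phi0.restrict Phi0 paramA puncturedDisc) := by
  rw [isCoveringMap_iff_isCoveringMapOn_univ]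
  refine isClosedMap_restrict_Phi0.isCoveringMapOn_of_isLocalHomeomorphOn (fun w _ => ?_)
    (isLocalHomeomorph_restrict_Phi0.isLocalHomeomorphOn)
  rcases (mapsTo_Phi0.restrict Phi0 paramA puncturedDisc ⁻¹' {w}).eq_empty_or_nonempty
    with h | ⟨v, rfl⟩
  · rw [h]; exact finite_empty
  · refine Finite.of_injOn (f := Subtype.val) (t := {(v : ℂ), -(v : ℂ)}) (fun u hu => ?_)
      Subtype.val_injective.injOn (toFinite _)
    rw [← fiber_Phi0 v.2]
    exact ⟨u.2, congrArg Subtype.val hu⟩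

theorem ncard_fiber_Phi0 {w : ℂ} (hw : w ∈ puncturedDisc) :
    {v | v ∈ paramA ∧ Phi0 v = w}.ncard = 2 := by
  obtain ⟨v, hv, rfl, -⟩ := isRegularValue_of_mem hw
  rw [← Phi0_eq_val hv, fiber_Phi0 hv]
  exact ncard_pair (fun h => ne_zero_of_mem_paramA hv (self_eq_neg.1 h))

end CosFamily

theorem mainTheorem4 :
    ∃ H₀ : Set ℂ,
      -- `H₀` is the hyperbolic component that contains a punctured disc centred at `0`
      CosFamily.IsHyperbolicComponent H₀ ∧
      (∃ ρ : ℝ, 0 < ρ ∧ Metric.ball (0 : ℂ) ρ \ {0} ⊆ H₀) ∧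
      -- it is of type A, and no other hyperbolic component has a parameter of type A
      (∀ v ∈ H₀, CosFamily.IsTypeAParameter v) ∧
      (∀ U : Set ℂ, CosFamily.IsHyperbolicComponent U →
        (∃ v ∈ U, CosFamily.IsTypeAParameter v) → U = H₀) ∧
      -- `Φ₀` is well defined on `H₀`
      (∀ v ∈ H₀, CosFamily.IsBottcherValue v (CosFamily.Phi0 v) ∧
        ∀ w, CosFamily.IsBottcherValue v w → w = CosFamily.Phi0 v) ∧
      -- `Φ₀ : H₀ → 𝔻*` is an analytic covering of degree `2`
      AnalyticOnNhd ℂ CosFamily.Phi0 H₀ ∧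
      (∃ h : Set.MapsTo CosFamily.Phi0 H₀ CosFamily.puncturedDisc,
        IsCoveringMap (h.restrict CosFamily.Phi0 H₀ CosFamily.puncturedDisc)) ∧
      (∀ w ∈ CosFamily.puncturedDisc, {v | v ∈ H₀ ∧ CosFamily.Phi0 v = w}.ncard = 2) := by
  obtain ⟨δ, K, hδ, -, hsmall⟩ := CosFamily.exists_small_param
  have hδ2 : ((δ / 2 : ℝ) : ℂ) ∈ CosFamily.paramA := by
    refine (hsmall _ (by simpa using hδ.ne') ?_).1
    rw [Complex.norm_real, Real.norm_of_nonneg (by positivity)]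
    linarith
  refine ⟨CosFamily.paramA,
    ⟨_, CosFamily.paramA_subset_hyperbolicLocus hδ2,
      (CosFamily.connectedComponentIn_hyperbolicLocus hδ2).symm⟩,
    ⟨δ, hδ, fun v hv => (hsmall v hv.2 (mem_ball_zero_iff.1 hv.1)).1⟩,
    fun v hv => (CosFamily.isTypeAParameter_iff (CosFamily.ne_zero_of_mem_paramA hv)).2 hv,
    ?_, fun v hv => ?_, fun v hv => CosFamily.analyticAt_Phi0 hv,
    ⟨CosFamily.mapsTo_Phi0, CosFamily.isCoveringMap_restrict_Phi0⟩,
    fun w hw => CosFamily.ncard_fiber_Phi0 hw⟩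
  · rintro _ ⟨u, -, rfl⟩ ⟨v, hv, hA⟩
    have hv0 : v ≠ 0 := (connectedComponentIn_subset _ _ hv).1
    rw [connectedComponentIn_eq hv]
    exact CosFamily.connectedComponentIn_hyperbolicLocus
      ((CosFamily.isTypeAParameter_iff hv0).1 hA)
  · rw [CosFamily.Phi0_eq_val hv]
    exact ⟨(CosFamily.isVal_val hv).isBottcherValue, fun w hw =>
      ((hw.isVal (CosFamily.ne_zero_of_mem_paramA hv)).val_eq).symm⟩
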